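/- Let $G$ be a simple algebraic group over $\mathbb C$ (a connected linear algebraic group with simple Lie algebra $\mathfrak g$) of rank $r$. Fix a Borel subgroup $B\subset G$ with Lie algebra $\mathfrak b$ and a maximal torus $T\subset B$, let $\alpha_1,\dots,\alpha_r$ be the simple roots, $\theta$ the maximal root, $\rho$ half the sum of the positive coroots (an element of $\operatorname{Lie} T$), and $h$ the Coxeter number (the number of roots divided by $r$). Choose non-zero vectors $X_{-\alpha_i}\in\mathfrak g_{-\alpha_i}$ and $E\in\mathfrak g_\theta$, and put $N=\sum_i X_{-\alpha_i}$. On the trivial $G$-bundle on $\mathbb P^1$ with coordinate $t$ consider the connection $$\nabla=d+N\,\frac{dt}{t}+E\,dt .$$ Definitions. A connection on the punctured formal disc has a *regular singularity* if in some trivialization of the $G$-bundle over $\mathbb C((s))$ it has a pole of order at most one, and an *irregular* one otherwise. It has *slope* $a/b>0$ if, after passing to $u^b=s$ and in some trivialization over $\mathbb C((u))$, it has a pole of order $a+1$ with non-nilpotent leading coefficient. A unipotent element of $G$ is *principal* if its centralizer has dimension $r$. A *$G$-oper* on $\mathbb G_m$ is a connection $d+\sum_i\psi_iX_{-\alpha_i}+\mathbf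 v$ with $\psi_i\in\mathbb C[t,t^{-1}]^\times dt$ and $\mathbf v\in\mathfrak b[t,t^{-1}]\,dt$, modulo gauge transformations by $B[t,t^{-1}]$. Then: 1. At $t=0$, $\nabla$ has a simple pole with residue $N$, in particular a regular singularity, and its monodromy around $0$ is a principal unipotent element of $G$ (for every base point in $\mathbb C^\times$). 2. At $t=\infty$, $\nabla$ has a pole of order two and an irregular singularity; its slope there is $1/h$, and no other number. 3. $N+E$ is a regular semisimple element of $\mathfrak g$ (its $\operatorname{ad}$ is semisimple, with kernel of dimension $r$). 4. If $G$ is of adjoint type (trivial center), then $\rho$ is a cocharacter of $T$. Whenever $\rho$ is a cocharacter of $T$, after the substitution $u^h=t^{-1}$ and the gauge transformation by $\rho(u)$ the connection $\nabla$ becomes $$d-h(N+E)\frac{du}{u^2}-\rho\,\frac{du}{u}.$$ For every $G$, $2\rho$ is a cocharacter of $T$, and after the substitution $w^{2h}=t^{-1}$ and the gauge transformation by $(2\rho)(w)$ the connection $\nabla$ becomes $$d-2h(N+E)\frac{dw}{w^3}-2\rho\,\frac{dw}{w}.$$ 5. $\nabla$ is an oper connection on $\mathbb G_m$. A $G$-oper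 on $\mathbb G_m$ coincides, as an oper, with the pull-back of $\nabla$ under some rescaling $t\mapsto ct$, $c\in\mathbb C^\times$, if and only if it has a representative $d+\sum_i\psi_iX_{-\alpha_i}+\mathbf v$ such that - at $t=0$: $\psi_i\in\mathbb C^\times t^{-1}dt$ for all $i$, $\mathbf v$ has at most a simple pole, the residue of the connection is nilpotent, and the monodromy is a principal unipotent element of $G$; - at $t=\infty$: the one-form $\mathbf v$ has a pole of order two, with leading term in $\mathfrak g_\theta$. -/

import Mathlib

open scoped LaurentPolynomial

attribute [local instance 100] LieRing.ofAssociativeRing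

namespace OperConn

noncomputable section

/-! ### Linear algebraic groups over `ℂ`, as Zariski closed subgroups of `GL_n(ℂ)` -/

/-- The coordinates of an invertible matrix. -/
def coords {n : ℕ} {R : Type} [CommRing R] (g : GL (Fin n) R) : Fin n × Fin n → R :=
  fun p => (g : Matrix (Fin n) (Fin n) R) p.1 p.2

/-- A subset of `GL_n(ℂ)` is Zariski closed if it is cut out by polynomials in the entries. -/
def IsZariskiClosed {n : ℕ} (Z : Set (GL (Fin n) ℂ)) : Prop :=
  ∃ S : Set (MvPolynomial (Fin n × Fin n) ℂ),
    Z = {g | ∀ f ∈ S, MvPolynomial.aeval (coords g) f = 0}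

/-- Connectedness in the Zariski topology of a subset of `GL_n(ℂ)` (used for closed subsets). -/
def IsZariskiConnected {n : ℕ} (Z : Set (GL (Fin n) ℂ)) : Prop :=
  Z.Nonempty ∧ ∀ Z₁ Z₂ : Set (GL (Fin n) ℂ), IsZariskiClosed Z₁ → IsZariskiClosed Z₂ →
    Z₁ ∪ Z₂ = Z → Z₁ ∩ Z₂ = ∅ → Z₁ = ∅ ∨ Z₂ = ∅

/-- The ideal of polynomials in the matrix entries that vanish on the group `G`. -/
def idealOf {n : ℕ} (G : Subgroup (GL (Fin n) ℂ)) :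
    Ideal (MvPolynomial (Fin n × Fin n) ℂ) :=
  MvPolynomial.vanishingIdeal ℂ (coords '' (G : Set (GL (Fin n) ℂ)))

/-- The points `G(R)` of `G` over a commutative `ℂ`-algebra `R`. -/
def points {n : ℕ} (G : Subgroup (GL (Fin n) ℂ)) (R : Type) [CommRing R] [Algebra ℂ R] :
    Set (GL (Fin n) R) :=
  {g | ∀ f ∈ idealOf G, MvPolynomial.aeval (coords g) f = 0}

/-- The left invariant derivation `f ↦ (g ↦ d/dε f(g (1 + ε X)))` attached to a matrix `X`. -/
def leftInvDerivation {n : ℕ} (X : Matrix (Fin n) (Fin n) ℂ) :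
    Derivation ℂ (MvPolynomial (Fin n × Fin n) ℂ) (MvPolynomial (Fin n × Fin n) ℂ) :=
  MvPolynomial.mkDerivation ℂ
    (fun p => ∑ k, MvPolynomial.X (p.1, k) * MvPolynomial.C (X k p.2))

theorem leftInvDerivation_X {n : ℕ} (X : Matrix (Fin n) (Fin n) ℂ) (p : Fin n × Fin n) :
    leftInvDerivation X (MvPolynomial.X p) =
      ∑ k, MvPolynomial.X (p.1, k) * MvPolynomial.C (X k p.2) := by
  simp [leftInvDerivation]

theorem leftInvDerivation_zero {n : ℕ} :
    leftInvDerivation (0 : Matrix (Fin n) (Fin n) ℂ) = 0 := by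
  apply MvPolynomial.derivation_ext
  intro p
  simp [leftInvDerivation_X]

theorem leftInvDerivation_add {n : ℕ} (X Y : Matrix (Fin n) (Fin n) ℂ) :
    leftInvDerivation (X + Y) = leftInvDerivation X + leftInvDerivation Y := by
  apply MvPolynomial.derivation_ext
  intro p
  simp [leftInvDerivation_X, mul_add, Finset.sum_add_distrib]

theorem leftInvDerivation_smul {n : ℕ} (c : ℂ) (X : Matrix (Fin n) (Fin n) ℂ) :
    leftInvDerivation (c • X) = c • leftInvDerivation X := by
  apply MvPolynomial.derivation_ext
  intro p
  simp only [leftInvDerivation_X, Derivation.smul_apply, Finset.smul_sum, Matrix.smul_apply,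
    smul_eq_mul, MvPolynomial.C_mul, MvPolynomial.smul_eq_C_mul]
  exact Finset.sum_congr rfl fun k _ => by ring

theorem leftInvDerivation_comp {n : ℕ} (X Y : Matrix (Fin n) (Fin n) ℂ) (p : Fin n × Fin n) :
    leftInvDerivation X (leftInvDerivation Y (MvPolynomial.X p)) =
      ∑ k, MvPolynomial.X (p.1, k) * MvPolynomial.C ((X * Y) k p.2) := by
  have key : ∀ k, leftInvDerivation X (MvPolynomial.X (p.1, k) * MvPolynomial.C (Y k p.2)) =
      MvPolynomial.C (Y k p.2) * ∑ l, MvPolynomial.X (p.1, l) * MvPolynomial.C (X l k) := by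
    intro k
    have hC : leftInvDerivation X (MvPolynomial.C (Y k p.2)) = 0 := MvPolynomial.derivation_C _ _
    rw [Derivation.leibniz, hC, leftInvDerivation_X]
    simp
  rw [leftInvDerivation_X, map_sum, Finset.sum_congr rfl fun k _ => key k]
  simp only [Matrix.mul_apply, map_sum, Finset.mul_sum, MvPolynomial.C_mul]
  rw [Finset.sum_comm]
  exact Finset.sum_congr rfl fun k _ => Finset.sum_congr rfl fun l _ => by ring

theorem leftInvDerivation_lie {n : ℕ} (X Y : Matrix (Fin n) (Fin n) ℂ) :
    leftInvDerivation ⁅X, Y⁆ = ⁅leftInvDerivation X, leftInvDerivation Y⁆ := by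
  apply MvPolynomial.derivation_ext
  intro p
  rw [Derivation.commutator_apply, leftInvDerivation_comp, leftInvDerivation_comp,
    leftInvDerivation_X, ← Finset.sum_sub_distrib]
  exact Finset.sum_congr rfl fun k _ => by
    rw [Ring.lie_def, Matrix.sub_apply, MvPolynomial.C_sub, mul_sub]

/-- The Lie algebra of (the Zariski closure of) `G`, as a Lie subalgebra of `𝔤𝔩_n`: the matrices
whose left invariant derivation preserves the ideal of `G`. -/
def lieAlg {n : ℕ} (G : Subgroup (GL (Fin n) ℂ)) :
    LieSubalgebra ℂ (Matrix (Fin n) (Fin n) ℂ) where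
  carrier := {X | ∀ f ∈ idealOf G, leftInvDerivation X f ∈ idealOf G}
  zero_mem' := fun f _ => by simp [leftInvDerivation_zero]
  add_mem' := fun {X Y} hX hY f hf => by
    rw [leftInvDerivation_add]
    exact (idealOf G).add_mem (hX f hf) (hY f hf)
  smul_mem' := fun c X hX f hf => by
    rw [leftInvDerivation_smul, Derivation.smul_apply, MvPolynomial.smul_eq_C_mul]
    exact (idealOf G).mul_mem_left _ (hX f hf)
  lie_mem' := fun {X Y} hX hY f hf => by
    rw [leftInvDerivation_lie, Derivation.commutator_apply]
    exact (idealOf G).sub_mem (hX _ (hY f hf)) (hY _ (hX f hf))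

/-- Simple complex algebraic groups: connected, Zariski closed in some `GL_n(ℂ)`, with simple
(in particular nonabelian) Lie algebra. -/
class IsSimpleAlgebraicGroup {n : ℕ} (G : Subgroup (GL (Fin n) ℂ)) : Prop where
  isClosed : IsZariskiClosed (G : Set (GL (Fin n) ℂ))
  isConnected : IsZariskiConnected (G : Set (GL (Fin n) ℂ))
  isSimple : LieAlgebra.IsSimple ℂ (lieAlg G)

instance {n : ℕ} (G : Subgroup (GL (Fin n) ℂ)) [h : IsSimpleAlgebraicGroup G] :
    LieAlgebra.IsSimple ℂ (lieAlg G) := h.isSimple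

/-- `G` is of adjoint type: its center is trivial. -/
def IsAdjointType {n : ℕ} (G : Subgroup (GL (Fin n) ℂ)) : Prop :=
  Subgroup.center G = ⊥

/-- `K` is the connected closed subgroup of `G` whose Lie algebra is the subspace `𝔨` of
`Lie G`. -/
structure IsConnectedSubgroupWithLie {n : ℕ} (G K : Subgroup (GL (Fin n) ℂ))
    (𝔨 : Submodule ℂ (lieAlg G)) : Prop where
  le : K ≤ G
  isClosed : IsZariskiClosed (K : Set (GL (Fin n) ℂ))
  isConnected : IsZariskiConnected (K : Set (GL (Fin n) ℂ))
  lie_eq : (lieAlg K).toSubmodule = 𝔨.map (lieAlg G).toSubmodule.subtype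

/-! ### Roots -/

section Roots

variable {𝔤 : Type} [LieRing 𝔤] [LieAlgebra ℂ 𝔤] [FiniteDimensional ℂ 𝔤]
  [LieAlgebra.IsSimple ℂ 𝔤] (H : LieSubalgebra ℂ 𝔤) [H.IsCartanSubalgebra]

/-- The Coxeter number of the root system of `(𝔤, H)`: the number of roots divided by the rank
(an exact division for an irreducible root system). -/
def coxeterNumber : ℕ := H.root.card / Module.finrank ℂ H

variable {H}
variable (b : (LieAlgebra.IsKilling.rootSystem H).Base)

/-- The Borel subalgebra spanned by the Cartan subalgebra and the positive root spaces. -/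
def borelSubspace : Submodule ℂ 𝔤 :=
  H.toSubmodule ⊔ ⨆ α : {α : H.root // b.IsPos α},
    (LieAlgebra.rootSpace H (α.1.1 : H → ℂ)).toSubmodule

/-- `θ` is the maximal root: `θ - β` is a sum of simple roots for every root `β`. -/
def IsMaximalRoot (θ : H.root) : Prop :=
  ∀ β : H.root, (LieAlgebra.IsKilling.rootSystem H).root θ -
    (LieAlgebra.IsKilling.rootSystem H).root β ∈
      AddSubmonoid.closure ((LieAlgebra.IsKilling.rootSystem H).root '' b.support)

open Classical in
/-- Half the sum of the positive coroots, an element of the Cartan subalgebra. -/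
def rhoCheck : H :=
  (1 / 2 : ℂ) • ∑ α : H.root,
    if b.IsPos α then LieAlgebra.IsKilling.coroot (α.1 : LieModule.Weight ℂ H 𝔤) else 0

variable (H) in
/-- An element of `𝔤` is regular semisimple if it is `ad`-semisimple and the dimension of its
centralizer is the rank of `𝔤`. -/
def IsRegularSemisimple (x : 𝔤) : Prop :=
  (LieAlgebra.ad ℂ 𝔤 x).IsSemisimple ∧
    Module.finrank ℂ (LinearMap.ker (LieAlgebra.ad ℂ 𝔤 x)) = Module.finrank ℂ H

end Roots

/-- A principal (regular) unipotent element `M` of the group `G` of rank `r`: it is unipotent and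
its centralizer in `G` has dimension `r`. -/
def IsPrincipalUnipotent {n : ℕ} (G : Subgroup (GL (Fin n) ℂ)) (r : ℕ) (M : GL (Fin n) ℂ) :
    Prop :=
  M ∈ G ∧ IsNilpotent ((M : Matrix (Fin n) (Fin n) ℂ) - 1) ∧
    Module.finrank ℂ (lieAlg (G ⊓ Subgroup.centralizer {M})) = r

/-! ### Connections

A connection `d + A(t) dt` on the trivial bundle is given by the matrix `A` of coefficients of
`dt`, over Laurent polynomials (on the punctured line) or Laurent series (on the punctured formal
disc). -/

/-- A matrix with constant entries. -/
def const {n : ℕ} (R : Type) [CommRing R] [Algebra ℂ R] (X : Matrix (Fin n) (Fin n) ℂ) :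
    Matrix (Fin n) (Fin n) R :=
  X.map (algebraMap ℂ R)

/-- The action of a gauge transformation `g` on the connection `d + A`, for the derivation `δ`:
`A ↦ g A g⁻¹ - δ(g) g⁻¹`. -/
def gauge {n : ℕ} {R : Type} [CommRing R] (δ : R → R) (g : GL (Fin n) R)
    (A : Matrix (Fin n) (Fin n) R) : Matrix (Fin n) (Fin n) R :=
  (g : Matrix (Fin n) (Fin n) R) * A * ((g⁻¹ : GL (Fin n) R) : Matrix (Fin n) (Fin n) R) -
    (g : Matrix (Fin n) (Fin n) R).map δ * ((g⁻¹ : GL (Fin n) R) : Matrix (Fin n) (Fin n) R)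

/-- The derivative `d/dt` on `ℂ[t, t⁻¹]`. -/
def derivPoly (f : ℂ[T;T⁻¹]) : ℂ[T;T⁻¹] :=
  f.coeff.sum fun k a => LaurentPolynomial.C (k * a) * LaurentPolynomial.T (k - 1)

/-- The derivative `d/du` on `ℂ((u))`. -/
def derivSeries (f : LaurentSeries ℂ) : LaurentSeries ℂ := LaurentSeries.derivative ℂ f

/-- The monomial `c t^m`, a unit of `ℂ[t, t⁻¹]`. -/
def monomialUnit (c : ℂˣ) (m : ℤ) : (ℂ[T;T⁻¹])ˣ where
  val := LaurentPolynomial.C (c : ℂ) * LaurentPolynomial.T m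
  inv := LaurentPolynomial.C ((c⁻¹ : ℂˣ) : ℂ) * LaurentPolynomial.T (-m)
  val_inv := by
    rw [mul_mul_mul_comm, ← map_mul, ← LaurentPolynomial.T_add]
    simp
  inv_val := by
    rw [mul_mul_mul_comm, ← map_mul, ← LaurentPolynomial.T_add]
    simp

/-- The inclusion of `ℂ[u, u⁻¹]` into `ℂ((u))`. -/
def toSeries : ℂ[T;T⁻¹] →+* LaurentSeries ℂ :=
  LaurentPolynomial.eval₂ (algebraMap ℂ (LaurentSeries ℂ))
    ⟨HahnSeries.single 1 1, HahnSeries.single (-1) 1,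
      by rw [HahnSeries.single_mul_single]; simp, by rw [HahnSeries.single_mul_single]; simp⟩

/-- The value of a Laurent polynomial at a nonzero complex number. -/
def evalPoly (z : ℂˣ) : ℂ[T;T⁻¹] →+* ℂ := LaurentPolynomial.eval₂ (RingHom.id ℂ) z

/-- The pull-back of the form `A(t) dt` under the substitution `t = c u^m`. -/
def pullback {n : ℕ} (c : ℂˣ) (m : ℤ) (A : Matrix (Fin n) (Fin n) ℂ[T;T⁻¹]) :
    Matrix (Fin n) (Fin n) ℂ[T;T⁻¹] :=
  derivPoly (monomialUnit c m) •
    A.map (LaurentPolynomial.eval₂ LaurentPolynomial.C (monomialUnit c m))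

/-- The matrix coefficient of `t^k` in a matrix of Laurent polynomials. -/
def coeffPoly {n : ℕ} (A : Matrix (Fin n) (Fin n) ℂ[T;T⁻¹]) (k : ℤ) :
    Matrix (Fin n) (Fin n) ℂ :=
  A.map fun f => f.coeff k

/-- The matrix coefficient of `u^k` in a matrix of Laurent series. -/
def coeffSeries {n : ℕ} (A : Matrix (Fin n) (Fin n) (LaurentSeries ℂ)) (k : ℤ) :
    Matrix (Fin n) (Fin n) ℂ :=
  A.map fun f => f.coeff k

/-- The form `A(u) du` has a pole of order exactly `m` at `u = 0`, with leading coefficient `L`. -/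
def HasPole {n : ℕ} (A : Matrix (Fin n) (Fin n) (LaurentSeries ℂ)) (m : ℕ)
    (L : Matrix (Fin n) (Fin n) ℂ) : Prop :=
  (∀ k : ℤ, k < -(m : ℤ) → coeffSeries A k = 0) ∧ coeffSeries A (-(m : ℤ)) = L ∧ L ≠ 0

/-- A connection on the punctured formal disc has a regular singularity (possibly removable) if
in some trivialization of the `G`-bundle it has a pole of order at most one. -/
def IsRegularSingular {n : ℕ} (G : Subgroup (GL (Fin n) ℂ))
    (A : Matrix (Fin n) (Fin n) (LaurentSeries ℂ)) : Prop :=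
  ∃ g ∈ points G (LaurentSeries ℂ), ∀ k : ℤ, k < -1 →
    coeffSeries (gauge derivSeries g A) k = 0

/-- The connection `d + A(t) dt` has slope `q > 0` at `t = ∞`: we have `q = a / b` such that,
after the substitution `u^b = t⁻¹` and in some trivialization of the `G`-bundle on the punctured
disc, it has a pole of order `a + 1` whose leading coefficient is not nilpotent. -/
def HasSlopeAtInfinity {n : ℕ} (G : Subgroup (GL (Fin n) ℂ))
    (A : Matrix (Fin n) (Fin n) ℂ[T;T⁻¹]) (q : ℚ) : Prop :=
  ∃ a b : ℕ, 0 < a ∧ 0 < b ∧ q = a / b ∧ ∃ g ∈ points G (LaurentSeries ℂ),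
    ∃ L : Matrix (Fin n) (Fin n) ℂ,
      HasPole (gauge derivSeries g ((pullback 1 (-(b : ℤ)) A).map toSeries)) (a + 1) L ∧
        ¬ IsNilpotent L

/-- The point `t₀ exp(2πis)` of the positively oriented loop around `0` based at `t₀`. -/
def loopPoint (t₀ : ℂˣ) (s : ℝ) : ℂˣ :=
  t₀ * Units.mk0 (Complex.exp (2 * Real.pi * Complex.I * s)) (Complex.exp_ne_zero _)

/-- `M` is the monodromy of `d + A(t) dt` along the positively oriented loop around `0` based at
`t₀`: the value at the end of the loop of the fundamental solution `Y` of `dY = -A Y dt` along the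
loop with `Y = 1` at the start. -/
def IsMonodromy {n : ℕ} (A : Matrix (Fin n) (Fin n) ℂ[T;T⁻¹]) (t₀ : ℂˣ) (M : GL (Fin n) ℂ) :
    Prop :=
  ∃ Y : ℝ → Matrix (Fin n) (Fin n) ℂ, Y 0 = 1 ∧ Y 1 = M ∧ ∀ (s : ℝ) (i j : Fin n),
    HasDerivAt (fun r : ℝ => Y r i j)
      (-(2 * Real.pi * Complex.I * (loopPoint t₀ s : ℂ)) *
        (A.map (evalPoly (loopPoint t₀ s)) * Y s) i j) s

/-- The monodromy around `0` is a principal unipotent element of `G`, for every base point. -/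
def HasPrincipalUnipotentMonodromy {n : ℕ} (G : Subgroup (GL (Fin n) ℂ)) (r : ℕ)
    (A : Matrix (Fin n) (Fin n) ℂ[T;T⁻¹]) : Prop :=
  ∀ t₀ : ℂˣ, ∃ M : GL (Fin n) ℂ, IsMonodromy A t₀ M ∧ IsPrincipalUnipotent G r M

/-- A cocharacter `𝔾_m → T`, given by an invertible matrix of Laurent polynomials in the
parameter of `𝔾_m`, with differential `X`. -/
structure IsCocharacter {n : ℕ} (T : Subgroup (GL (Fin n) ℂ)) (g : GL (Fin n) ℂ[T;T⁻¹])
    (X : Matrix (Fin n) (Fin n) ℂ) : Prop where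
  mem : g ∈ points T ℂ[T;T⁻¹]
  map_mul : ∀ z w : ℂˣ, g.1.map (evalPoly (z * w)) = g.1.map (evalPoly z) * g.1.map (evalPoly w)
  differential : (g.1.map derivPoly).map (evalPoly 1) = X

/-! ### Opers on the punctured line -/

/-- The connection `d + N dt/t + E dt`. -/
def nabla {n : ℕ} (N E : Matrix (Fin n) (Fin n) ℂ) : Matrix (Fin n) (Fin n) ℂ[T;T⁻¹] :=
  (LaurentPolynomial.T (-1) : ℂ[T;T⁻¹]) • const ℂ[T;T⁻¹] N + const ℂ[T;T⁻¹] E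

/-- The coefficients of `A` lie in the subspace `W`. -/
def IsValuedIn {n : ℕ} (W : Submodule ℂ (Matrix (Fin n) (Fin n) ℂ))
    (A : Matrix (Fin n) (Fin n) ℂ[T;T⁻¹]) : Prop :=
  ∀ k : ℤ, coeffPoly A k ∈ W

/-- Oper connections on `𝔾_m`: `d + ∑ ψ_i X_{-α_i} + v`, where the `ψ_i` are nowhere vanishing
one-forms and `v` is a regular one-form with values in `Lie B`. Since `B`-bundles on `𝔾_m` are
trivial, a `G`-oper on `𝔾_m` is such a connection modulo the gauge action of `B[t, t⁻¹]`. -/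
def IsOper {n : ℕ} {ι : Type} [Fintype ι] (B : Subgroup (GL (Fin n) ℂ))
    (x : ι → Matrix (Fin n) (Fin n) ℂ) (A : Matrix (Fin n) (Fin n) ℂ[T;T⁻¹]) : Prop :=
  ∃ (ψ : ι → (ℂ[T;T⁻¹])ˣ) (v : Matrix (Fin n) (Fin n) ℂ[T;T⁻¹]),
    IsValuedIn (lieAlg B).toSubmodule v ∧
      A = ∑ i, (ψ i : ℂ[T;T⁻¹]) • const ℂ[T;T⁻¹] (x i) + v

/-- Two oper connections define the same oper if they are related by an element of
`B[t, t⁻¹]`. -/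
def OperEquiv {n : ℕ} (B : Subgroup (GL (Fin n) ℂ))
    (A A' : Matrix (Fin n) (Fin n) ℂ[T;T⁻¹]) : Prop :=
  ∃ g ∈ points B ℂ[T;T⁻¹], gauge derivPoly g A = A'

/-- The local conditions at `0` and `∞` on an oper connection `d + ∑ ψ_i X_{-α_i} + v`.
At `0`: every `ψ_i` has a simple pole, `v` has at most a simple pole, the residue of the connection
is nilpotent, and the monodromy is principal unipotent.
At `∞`: the form `v` has a pole of order two, with leading term in the highest root space `𝔤θ`
(in terms of `v = ∑ v_k t^k dt` this means `v_k = 0` for `k > 0` and `0 ≠ v_0 ∈ 𝔤θ`). -/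
def SatisfiesLocalConditions {n : ℕ} {ι : Type} [Fintype ι] (G B : Subgroup (GL (Fin n) ℂ))
    (r : ℕ) (x : ι → Matrix (Fin n) (Fin n) ℂ) (𝔤θ : Submodule ℂ (Matrix (Fin n) (Fin n) ℂ))
    (A : Matrix (Fin n) (Fin n) ℂ[T;T⁻¹]) : Prop :=
  ∃ (c : ι → ℂˣ) (v : Matrix (Fin n) (Fin n) ℂ[T;T⁻¹]),
    IsValuedIn (lieAlg B).toSubmodule v ∧
    A = ∑ i, (monomialUnit (c i) (-1) : ℂ[T;T⁻¹]) • const ℂ[T;T⁻¹] (x i) + v ∧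
    (∀ k : ℤ, k < -1 → coeffPoly v k = 0) ∧
    IsNilpotent (coeffPoly A (-1)) ∧
    HasPrincipalUnipotentMonodromy G r A ∧
    (∀ k : ℤ, 0 < k → coeffPoly v k = 0) ∧
    coeffPoly v 0 ∈ 𝔤θ ∧ coeffPoly v 0 ≠ 0

end

end OperConn

/-! Everything rests on the grading of 𝔤 by the eigenvalues of ad ρ, that is, by height. N has
degree -1 and E has degree h - 1, so after t = u^{-h} the gauge transformation by ρ(u) gives both
terms of ∇ the same power of u and exhibits the leading coefficient N + E. What remains is Lie
theory for N and N + E, the passage between matrix groups and their Lie algebras, and the local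
theory at 0 and ∞.

Lie theory, after Kostant. N is the lowering element of an sl₂-triple with middle element 2ρ, so ad
N is injective in degrees ≥ 0. Comparison of leading terms carries this over to every x in N + 𝔟: ad
x is injective on the nilradical 𝔫, and Killing duality bounds the dimension of its centralizer by r
(`finrank_ker_ad_le`). The reverse bound holds for all elements (`finrank_cartan_le_ker_ad`): near ρ
every element is conjugate into the Cartan subalgebra, and a rank bound near one point of a line
spreads along the line. For X = N + E let ζ be a primitive root of unity of order ht θ + 1. The
operator ζ^ρ scales X by ζ⁻¹, hence also its semisimple part, which must then lie in degrees -1 and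
ht θ. Comparison with an explicit element commuting with X makes it a multiple of X, and ad X is not
nilpotent, so X is semisimple (`cyclic_isSemisimple`). The eigenspaces of ζ^ρ on the image of ad X
are permuted cyclically by ad X and have dimension r, so there are (ht θ + 1) r roots and h = ht θ +
1 (`card_root_eq`).

Groups. The Lie algebra of a closed subgroup consists of the generators of its one-parameter
subgroups. The sl₂-triple acts on ℂⁿ, so 2ρ is diagonalizable with integral eigenvalues and
integrates to a cocharacter. The element exp(2πiρ) centralizes 𝔤; since a closed subgroup of G with
the full Lie algebra is G (`eq_of_lieAlg_le`, by leading terms at 1 and Krull's intersection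
theorem), it is central. If the center is trivial, ρ itself is integral.

Local theory. At 0 the operator ad N is nilpotent, so there are no resonances and P(t) t^{-N} is a
fundamental solution with P entire; the monodromy is a conjugate of exp(-2πiN). At ∞, a pole whose
order can be lowered by a gauge transformation has nilpotent leading coefficient
(`isNilpotent_of_gauge`). Hence all trivializations with non-nilpotent leading coefficient have the
same slope, and the one given by 2ρ has slope 1/h.

Opers. The local conditions leave a nilpotent residue y in ∑ cᵢ X_{-αᵢ} + 𝔟 and a constant term F in
𝔤_θ. Nilpotency yields n in 𝔫 with [ρ + n, y] = -y. Conjugating ρ + n to ρ by unipotent elements of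
B turns y into ∑ cᵢ X_{-αᵢ} and fixes F. The torus makes all cᵢ equal to 1, and the remaining
multiple of E is a rescaling of t. -/

namespace OperConn

/-! ### The principal grading by height. -/

section Grading

open LieAlgebra LieAlgebra.IsKilling Module

/-- If `W i ≤ D i`, the `D i` are independent and the `W i` span, then `W = D`. -/
theorem eq_of_iSupIndep_of_iSup_eq_top {ι R M : Type*} [Ring R] [AddCommGroup M] [Module R M]
    {W D : ι → Submodule R M} (hWD : ∀ i, W i ≤ D i) (hD : iSupIndep D) (hW : ⨆ i, W i = ⊤)
    (i : ι) : W i = D i := by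
  refine le_antisymm (hWD i) fun v hv => ?_
  have hv' : v ∈ W i ⊔ ⨆ (j) (_ : j ≠ i), W j := by
    rw [← iSup_split_single W i, hW]; trivial
  obtain ⟨a, ha, c, hc, rfl⟩ := Submodule.mem_sup.1 hv'
  have hc' : c ∈ ⨆ (j) (_ : j ≠ i), D j := iSup₂_mono (fun j _ => hWD j) hc
  have : c ∈ D i := by simpa using (D i).sub_mem hv (hWD i ha)
  have hc0 : c = 0 := (Submodule.disjoint_def.1 (hD i)) c this hc'
  simpa [hc0] using ha

theorem cartan_sup_iSup_rootSpace {L : Type} [LieRing L] [LieAlgebra ℂ L]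
    [FiniteDimensional ℂ L] {H : LieSubalgebra ℂ L} [H.IsCartanSubalgebra] :
    H.toSubmodule ⊔ ⨆ α : H.root, (rootSpace H (α.1 : H → ℂ)).toSubmodule = ⊤ := by
  have h := LieModule.iSup_genWeightSpace_eq_top' ℂ H L
  rw [← LieSubmodule.toSubmodule_inj, LieSubmodule.iSup_toSubmodule] at h
  rw [eq_top_iff]
  refine le_trans (le_of_eq h.symm) (iSup_le fun χ => ?_)
  by_cases hχ : χ.IsZero
  · have h0 : (LieModule.genWeightSpace L (χ : H → ℂ)) = rootSpace H 0 := by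
      rw [hχ.eq]
    rw [h0, rootSpace_zero_eq]
    exact le_sup_left
  · exact le_trans (le_iSup (fun α : H.root => (rootSpace H (α.1 : H → ℂ)).toSubmodule)
      ⟨χ, by simpa using hχ⟩) le_sup_right

variable {L : Type} [LieRing L] [LieAlgebra ℂ L] [FiniteDimensional ℂ L]
  [LieAlgebra.IsSimple ℂ L] {H : LieSubalgebra ℂ L} [H.IsCartanSubalgebra]
  (b : (rootSystem H).Base)

/-- The reflection in αᵢ permutes the positive roots other than αᵢ and changes the sign of their
pairing with αᵢ. Those terms cancel, and half of ⟨αᵢ, αᵢ^∨⟩ = 2 is left. -/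
theorem simple_apply_rhoCheck {i : H.root} (hi : i ∈ b.support) :
    (i.1 : H → ℂ) (rhoCheck b) = 1 := by
  classical
  let P := rootSystem H
  have h1 : (i.1 : H → ℂ) (rhoCheck b) =
      (1 / 2 : ℂ) * ∑ j : H.root, if b.IsPos j then P.pairing i j else 0 := by
    have : (i.1 : H → ℂ) (rhoCheck b) = P.root i (rhoCheck b) := rfl
    rw [this, rhoCheck, map_smul, map_sum, smul_eq_mul]
    congr 1
    refine Finset.sum_congr rfl fun j _ => ?_
    split_ifs
    · rfl
    · simp
  have hinv : ∀ j, P.pairing i (P.reflectionPerm i j) = - P.pairing i j := fun j => by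
    rw [RootPairing.pairing_reflectionPerm, RootPairing.pairing_reflectionPerm_self_left]
  have h2 : ∑ j ∈ Finset.univ.erase i, (if b.IsPos j then P.pairing i j else 0) = 0 := by
    have key : ∑ j ∈ Finset.univ.erase i, (if b.IsPos j then P.pairing i j else 0) =
        ∑ j ∈ Finset.univ.erase i, -(if b.IsPos j then P.pairing i j else 0) := by
      rw [← Finset.sum_filter, Finset.sum_neg_distrib, ← Finset.sum_filter,
        ← Finset.sum_neg_distrib]
      have hmem : ∀ a, a ∈ (Finset.univ.erase i).filter (fun j => b.IsPos j) →
          P.reflectionPerm i a ∈ (Finset.univ.erase i).filter (fun j => b.IsPos j) := by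
        intro a ha
        simp only [Finset.mem_filter, Finset.mem_erase, Finset.mem_univ, and_true] at ha ⊢
        have hp : b.IsPos (P.reflectionPerm i a) := ha.2.reflectionPerm hi ha.1
        refine ⟨fun h => ?_, hp⟩
        -- A root sent to αᵢ would be -αᵢ, which has negative height.
        have : a = P.reflectionPerm i i := by
          have := congrArg (P.reflectionPerm i) h
          rwa [RootPairing.reflectionPerm_self] at this
        have h3 : b.IsPos (P.reflectionPerm i i) := this ▸ ha.2
        have h4 := b.height_reflectionPerm_self i
        have h5 := b.isPos_of_mem_support hi
        rw [RootPairing.Base.isPos_iff] at h3 h5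
        have h6 : b.height (P.reflectionPerm i i) = - b.height i := h4
        omega
      refine Finset.sum_bij' (fun a _ => P.reflectionPerm i a) (fun a _ => P.reflectionPerm i a)
        hmem hmem (by simp) (by simp) fun a _ => by rw [hinv, neg_neg]
    rw [Finset.sum_neg_distrib] at key
    exact self_eq_neg.1 key
  rw [h1, ← Finset.add_sum_erase _ _ (Finset.mem_univ i), h2,
    if_pos (b.isPos_of_mem_support hi), RootPairing.pairing_same]
  norm_num

theorem root_apply_rhoCheck (α : H.root) : (α.1 : H → ℂ) (rhoCheck b) = b.height α := by
  obtain ⟨f, -, -, hf⟩ := b.exists_root_eq_sum_int α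
  rw [RootPairing.Base.height_eq_sum hf]
  have h : (α.1 : H → ℂ) (rhoCheck b) = (rootSystem H).root α (rhoCheck b) := rfl
  rw [h, hf, LinearMap.sum_apply]
  push_cast
  refine Finset.sum_congr rfl fun j hj => ?_
  rw [LinearMap.smul_apply]
  have : (rootSystem H).root j (rhoCheck b) = 1 := simple_apply_rhoCheck b hj
  rw [this]; simp

/-- The principal grading: the eigenspaces of `ad ρ`. -/
noncomputable def deg (k : ℤ) : Submodule ℂ L := End.eigenspace (ad ℂ L (rhoCheck b : L)) (k : ℂ)

variable {b} in
theorem mem_deg {k : ℤ} {v : L} : v ∈ deg b k ↔ ⁅(rhoCheck b : L), v⁆ = (k : ℂ) • v := by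
  simp [deg]

theorem rootSpace_le_deg (α : H.root) :
    (rootSpace H (α.1 : H → ℂ)).toSubmodule ≤ deg b (b.height α) := by
  intro v hv
  rw [mem_deg, ← root_apply_rhoCheck]
  exact lie_eq_smul_of_mem_rootSpace hv (rhoCheck b)

theorem cartan_le_deg : H.toSubmodule ≤ deg b 0 := by
  intro v hv
  rw [mem_deg]
  have : ⁅rhoCheck b, (⟨v, hv⟩ : H)⁆ = 0 := LieModule.IsTrivial.trivial _ _
  simpa using congrArg (Subtype.val) this

theorem iSupIndep_deg : iSupIndep (deg b) :=
  (End.eigenspaces_iSupIndep _).comp Int.cast_injective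

open Classical in
/-- The sum of the root spaces of height `k`, together with the Cartan subalgebra for `k = 0`. -/
noncomputable def heightSpace (k : ℤ) : Submodule ℂ L :=
  (if k = 0 then H.toSubmodule else ⊥) ⊔
    ⨆ α : {α : H.root // b.height α = k}, (rootSpace H (α.1.1 : H → ℂ)).toSubmodule

theorem heightSpace_le_deg (k : ℤ) : heightSpace b k ≤ deg b k := by
  refine sup_le ?_ (iSup_le fun α => ?_)
  · split_ifs with h
    · subst h; exact cartan_le_deg b
    · exact bot_le
  · have := rootSpace_le_deg b α.1
    rwa [α.2] at this

theorem iSup_heightSpace : ⨆ k, heightSpace b k = ⊤ := by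
  rw [eq_top_iff, ← cartan_sup_iSup_rootSpace (H := H)]
  refine sup_le (le_iSup_of_le 0 ?_) (iSup_le fun α => le_iSup_of_le (b.height α) ?_)
  · exact le_sup_of_le_left (by simp)
  · exact le_sup_of_le_right (le_iSup_of_le ⟨α, rfl⟩ le_rfl)

/-- The height spaces span and sit inside independent eigenspaces, so the inclusions are equalities.
This makes the grading usable both through ad ρ and through roots. -/
theorem heightSpace_eq_deg (k : ℤ) : heightSpace b k = deg b k :=
  eq_of_iSupIndep_of_iSup_eq_top (heightSpace_le_deg b) (iSupIndep_deg b) (iSup_heightSpace b) k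

theorem iSup_deg : ⨆ k, deg b k = ⊤ := by
  rw [← iSup_heightSpace b]; exact iSup_congr fun k => (heightSpace_eq_deg b k).symm

theorem deg_zero : deg b 0 = H.toSubmodule := by
  rw [← heightSpace_eq_deg, heightSpace]
  have : IsEmpty {α : H.root // b.height α = 0} := ⟨fun α => b.height_ne_zero _ α.2⟩
  simp

theorem deg_of_ne_zero {k : ℤ} (hk : k ≠ 0) : deg b k =
    ⨆ α : {α : H.root // b.height α = k}, (rootSpace H (α.1.1 : H → ℂ)).toSubmodule := by
  rw [← heightSpace_eq_deg, heightSpace, if_neg hk, bot_sup_eq]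

variable {b} in
theorem lie_mem_deg {j k l : ℤ} {x y : L} (hx : x ∈ deg b j) (hy : y ∈ deg b k)
    (hl : j + k = l) : ⁅x, y⁆ ∈ deg b l := by
  rw [mem_deg] at *
  rw [leibniz_lie, hx, hy, ← hl]
  simp [add_smul]

variable {b} in
-- Invariance under ad ρ gives (j + k) κ(x, y) = 0.
theorem killingForm_deg {j k : ℤ} {x y : L} (hx : x ∈ deg b j) (hy : y ∈ deg b k)
    (hjk : j + k ≠ 0) : killingForm ℂ L x y = 0 := by
  rw [mem_deg] at *
  have h := LieModule.traceForm_apply_lie_apply ℂ L L x (rhoCheck b : L) y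
  have h2 : ⁅x, (rhoCheck b : L)⁆ = -((j : ℂ) • x) := by rw [← hx, lie_skew]
  rw [h2, hy] at h
  simp only [map_neg, LinearMap.neg_apply, map_smul, LinearMap.smul_apply, smul_eq_mul] at h
  have h3 : ((j + k : ℤ) : ℂ) * killingForm ℂ L x y = 0 := by
    push_cast
    change _ = _ at h
    have h' : -((j : ℂ) * killingForm ℂ L x y) = (k : ℂ) * killingForm ℂ L x y := h
    linear_combination -h'
  exact (mul_eq_zero.1 h3).resolve_left (by exact_mod_cast hjk)

/-- The filtration by the degree of the principal grading. -/
noncomputable def filt (k : ℤ) : Submodule ℂ L := ⨆ j : {j : ℤ // k ≤ j}, deg b j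

theorem deg_le_filt {j k : ℤ} (h : k ≤ j) : deg b j ≤ filt b k :=
  le_iSup_of_le (⟨j, h⟩ : {j : ℤ // k ≤ j}) le_rfl

theorem filt_anti : Antitone (filt b) := fun _ _ h =>
  iSup_le fun j => deg_le_filt b (h.trans j.2)

theorem filt_succ (k : ℤ) : filt b k = deg b k ⊔ filt b (k + 1) := by
  refine le_antisymm (iSup_le fun j => ?_)
    (sup_le (deg_le_filt b le_rfl) (filt_anti b (by omega)))
  rcases eq_or_lt_of_le j.2 with h | h
  · exact le_sup_of_le_left (by rw [← h])
  · exact le_sup_of_le_right (deg_le_filt b (by omega))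

theorem deg_disjoint_filt {j k : ℤ} (h : j < k) : Disjoint (deg b j) (filt b k) :=
  (iSupIndep_deg b j).mono_right (iSup_le fun i => le_iSup₂_of_le i.1 (by have := i.2; omega) le_rfl)

variable {b} in
theorem lie_mem_filt {j k l : ℤ} {x y : L} (hx : x ∈ filt b j) (hy : y ∈ filt b k)
    (hl : l ≤ j + k) : ⁅x, y⁆ ∈ filt b l := by
  induction hx using Submodule.iSup_induction' with
  | mem i x hx =>
    induction hy using Submodule.iSup_induction' with
    | mem i' y hy =>
      exact deg_le_filt b (by have := i.2; have := i'.2; omega) (lie_mem_deg hx hy rfl)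
    | zero => simp
    | add y z _ _ h1 h2 => rw [lie_add]; exact add_mem h1 h2
  | zero => simp
  | add y z _ _ h1 h2 => rw [add_lie]; exact add_mem h1 h2

theorem exists_filt_eq_bot : ∃ K : ℤ, filt b K = ⊥ := by
  obtain ⟨K, hK⟩ : ∃ K : ℤ, ∀ α : H.root, b.height α < K := by
    obtain ⟨K, hK⟩ := (Set.finite_range b.height).bddAbove
    exact ⟨K + 1, fun α => Int.lt_add_one_iff.2 (hK ⟨α, rfl⟩)⟩
  refine ⟨max K 1, ?_⟩
  rw [eq_bot_iff]
  refine iSup_le fun j => ?_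
  rw [deg_of_ne_zero b (by have := j.2; omega)]
  refine iSup_le fun α => absurd α.2 ?_
  have := hK α.1
  have := j.2
  omega

theorem borelSubspace_eq : borelSubspace b = filt b 0 := by
  refine le_antisymm (sup_le ?_ (iSup_le fun α => ?_)) (iSup_le fun j => ?_)
  · rw [← deg_zero b]; exact deg_le_filt b le_rfl
  · exact (rootSpace_le_deg b α.1).trans (deg_le_filt b (le_of_lt α.2))
  · by_cases hj : (j : ℤ) = 0
    · rw [hj, deg_zero]; exact le_sup_left
    · rw [deg_of_ne_zero b hj]
      refine le_sup_of_le_right (iSup_le fun α => le_iSup_of_le ⟨α.1, ?_⟩ le_rfl)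
      rw [RootPairing.Base.isPos_iff, α.2]
      have := j.2
      omega

end Grading

end OperConn

namespace OperConn

/-! ### The principal sl₂-triple. -/

section Principal

open LieAlgebra LieAlgebra.IsKilling Module

variable {L : Type} [LieRing L] [LieAlgebra ℂ L] [FiniteDimensional ℂ L]
  [LieAlgebra.IsSimple ℂ L] {H : LieSubalgebra ℂ L} [H.IsCartanSubalgebra]
  (b : (rootSystem H).Base)

/-- The element of the Cartan subalgebra that represents a root for the Killing form. -/
noncomputable def rootDual (α : H.root) : H :=
  (cartanEquivDual H).symm ((rootSystem H).root α)

theorem exists_killingForm_eq_one {α : H.root} {x : L}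
    (hx : x ∈ rootSpace H (-(α.1 : H → ℂ))) (hx0 : x ≠ 0) :
    ∃ y ∈ rootSpace H (α.1 : H → ℂ), killingForm ℂ L y x = 1 ∧ ⁅y, x⁆ = (rootDual α : L) := by
  obtain ⟨y, hy, hyx⟩ : ∃ y ∈ rootSpace H (α.1 : H → ℂ), killingForm ℂ L x y ≠ 0 := by
    by_contra! h
    apply hx0
    have := mem_ker_killingForm_of_mem_rootSpace_of_forall_rootSpace_neg ℂ L H
      (α := -(α.1 : H → ℂ)) hx (by simpa using h)
    simpa using this
  have hs : killingForm ℂ L y x = killingForm ℂ L x y := LieModule.traceForm_comm ℂ L L y x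
  have h1 : killingForm ℂ L ((killingForm ℂ L x y)⁻¹ • y) x = 1 := by
    rw [map_smul, LinearMap.smul_apply, hs, smul_eq_mul, inv_mul_cancel₀ hyx]
  have hy' := (rootSpace H (α.1 : H → ℂ)).smul_mem (killingForm ℂ L x y)⁻¹ hy
  refine ⟨_, hy', h1, ?_⟩
  rw [lie_eq_killingForm_smul_of_mem_rootSpace_of_mem_rootSpace_neg hy' hx, h1, one_smul]
  rfl

theorem rootDual_linearIndependent_basis :
    ∃ B : Basis b.support ℂ H, ∀ i, B i = rootDual i.1 :=
  ⟨b.toWeightBasis.map (cartanEquivDual H).symm, fun i => by simp [rootDual]⟩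

/-- The difference of two distinct simple roots is neither zero nor a root. -/
theorem lie_simple_eq_zero {i j : b.support} (hij : i ≠ j) {x y : L}
    (hy : y ∈ rootSpace H (i.1.1 : H → ℂ)) (hx : x ∈ rootSpace H (-(j.1.1 : H → ℂ))) :
    ⁅y, x⁆ = 0 := by
  have h := lie_mem_genWeightSpace_of_mem_genWeightSpace hy hx
  by_contra hne
  have hbot : rootSpace H ((i.1.1 : H → ℂ) + -(j.1.1 : H → ℂ)) ≠ ⊥ := by
    intro h0
    change ⁅y, x⁆ ∈ rootSpace H ((i.1.1 : H → ℂ) + -(j.1.1 : H → ℂ)) at h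
    rw [h0] at h
    exact hne (by simpa using h)
  have hnz : (i.1.1 : H → ℂ) + -(j.1.1 : H → ℂ) ≠ 0 := by
    intro h0
    apply hij
    have : i.1.1 = j.1.1 := by
      ext z
      have := congrFun h0 z
      simp only [Pi.add_apply, Pi.neg_apply, Pi.zero_apply] at this
      linear_combination this
    exact Subtype.ext (Subtype.ext this)
  have hw : (⟨_, hbot⟩ : LieModule.Weight ℂ H L).IsNonZero := fun h => hnz h
  refine b.sub_notMem_range_root i.2 j.2 ⟨⟨⟨_, hbot⟩, ?_⟩, ?_⟩
  · exact Finset.mem_filter.2 ⟨Finset.mem_univ _, hw⟩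
  · ext z
    simp [sub_eq_add_neg]

theorem killingForm_simple_eq_zero {i j : b.support} (hij : i ≠ j) {x y : L}
    (hy : y ∈ rootSpace H (i.1.1 : H → ℂ)) (hx : x ∈ rootSpace H (-(j.1.1 : H → ℂ))) :
    killingForm ℂ L y x = 0 := by
  refine killingForm_apply_eq_zero_of_mem_rootSpace_of_add_ne_zero ℂ L H hy hx fun h0 => hij ?_
  have : i.1.1 = j.1.1 := by
    ext z
    have := congrFun h0 z
    simp only [Pi.add_apply, Pi.neg_apply, Pi.zero_apply] at this
    linear_combination this
  exact Subtype.ext (Subtype.ext this)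

theorem simple_mem_deg (i : b.support) : 
    (rootSpace H (i.1.1 : H → ℂ)).toSubmodule ≤ deg b 1 := by
  have := rootSpace_le_deg b i.1
  rwa [RootPairing.Base.height_one_of_mem_support i.2] at this

theorem neg_mem_deg {α : H.root} {x : L} (hx : x ∈ rootSpace H (-(α.1 : H → ℂ))) :
    x ∈ deg b (-b.height α) := by
  rw [mem_deg]
  have := lie_eq_smul_of_mem_rootSpace hx (rhoCheck b)
  rw [Pi.neg_apply, root_apply_rhoCheck] at this
  push_cast
  exact this

theorem neg_simple_mem_deg {i : b.support} {x : L} (hx : x ∈ rootSpace H (-(i.1.1 : H → ℂ))) :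
    x ∈ deg b (-1) := by
  have := neg_mem_deg b hx
  rwa [RootPairing.Base.height_one_of_mem_support i.2] at this

theorem eq_zero_of_simple_apply_eq_zero {a : H}
    (ha : ∀ i : b.support, (i.1.1 : H → ℂ) a = 0) : a = 0 := by
  rw [← Module.forall_dual_apply_eq_zero_iff ℂ]
  intro f
  have : Module.Dual.eval ℂ H a = 0 := b.toWeightBasis.ext fun i => by
    simpa using ha i
  exact LinearMap.congr_fun this f

/-- Without roots the algebra would equal its abelian Cartan subalgebra. -/
instance nonempty_root : Nonempty H.root := by
  by_contra h
  rw [not_nonempty_iff] at h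
  have h1 := cartan_sup_iSup_rootSpace (L := L) (H := H)
  rw [iSup_of_empty, sup_bot_eq] at h1
  refine LieAlgebra.IsSimple.non_abelian ℂ (L := L) ⟨fun x y => ?_⟩
  have hx : x ∈ H.toSubmodule := h1 ▸ trivial
  have hy : y ∈ H.toSubmodule := h1 ▸ trivial
  have : ⁅(⟨x, hx⟩ : H), (⟨y, hy⟩ : H)⁆ = 0 := LieModule.IsTrivial.trivial _ _
  simpa using congrArg (Subtype.val) this

theorem rhoCheck_ne_zero : rhoCheck b ≠ 0 := by
  intro h
  obtain ⟨i, hi⟩ := b.support_nonempty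
  have := simple_apply_rhoCheck b hi
  rw [h] at this
  have h0 : (i.1 : H → ℂ) 0 = 0 := (i.1.toLinear).map_zero
  rw [h0] at this
  exact zero_ne_one this

variable {b} {x : b.support → L}

theorem exists_dual_simple
    (hx : ∀ i : b.support, x i ∈ rootSpace H (-(i.1.1 : H → ℂ)) ∧ x i ≠ 0) :
    ∃ y : b.support → L, (∀ i, y i ∈ rootSpace H (i.1.1 : H → ℂ)) ∧
      (∀ i, ⁅y i, x i⁆ = (rootDual i.1 : L)) ∧ (∀ i j, i ≠ j → ⁅y i, x j⁆ = 0) ∧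
      (∀ i, killingForm ℂ L (y i) (x i) = 1) ∧
      ∀ i j, i ≠ j → killingForm ℂ L (y i) (x j) = 0 := by
  choose y hy using fun i => exists_killingForm_eq_one (hx i).1 (hx i).2
  exact ⟨y, fun i => (hy i).1, fun i => (hy i).2.2,
    fun i j hij => lie_simple_eq_zero b hij (hy i).1 (hx j).1, fun i => (hy i).2.1,
    fun i j hij => killingForm_simple_eq_zero b hij (hy i).1 (hx j).1⟩

theorem sum_mem_deg
    (hx : ∀ i : b.support, x i ∈ rootSpace H (-(i.1.1 : H → ℂ)) ∧ x i ≠ 0) : ∑ i, x i ∈ deg b (-1) :=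
  Submodule.sum_mem _ fun i _ => neg_simple_mem_deg b (hx i).1

/-- The Killing duals of the simple roots form a basis of H. With the coefficients of 2ρ in this
basis, e = ∑ cᵢ yᵢ satisfies [e, N] = 2ρ, since the mixed brackets [yᵢ, xⱼ] vanish. The other two
relations only express the degrees of e and N. -/
theorem exists_principal_sl2
    (hx : ∀ i : b.support, x i ∈ rootSpace H (-(i.1.1 : H → ℂ)) ∧ x i ≠ 0) :
    ∃ e ∈ deg b 1, IsSl2Triple ((2 : ℂ) • (rhoCheck b : L)) e (∑ i, x i) := by
  classical
  obtain ⟨y, hy, hyx, hyx', -, -⟩ := exists_dual_simple hx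
  obtain ⟨B, hB⟩ := rootDual_linearIndependent_basis b
  let c := B.repr ((2 : ℂ) • rhoCheck b)
  have he : ∑ i, c i • y i ∈ deg b 1 :=
    Submodule.sum_mem _ fun i _ => Submodule.smul_mem _ _ (simple_mem_deg b i (hy i))
  refine ⟨_, he, ?_, ?_, ?_, ?_⟩
  · intro h
    have h0 := smul_eq_zero.1 h
    exact rhoCheck_ne_zero b (by simpa using h0)
  · have h1 : ∀ i, ⁅c i • y i, ∑ j, x j⁆ = c i • (rootDual i.1 : L) := fun i => by
      rw [smul_lie, lie_sum, Finset.sum_eq_single i (fun j _ hj => hyx' i j (Ne.symm hj))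
        (by simp), hyx]
    rw [sum_lie, Finset.sum_congr rfl fun i _ => h1 i]
    have h3 : ((∑ i, c i • B i : H) : L) = ∑ i, c i • (rootDual i.1 : L) := by
      simp [hB]
    rw [← h3, B.sum_repr]
    rfl
  · rw [smul_lie, mem_deg.1 he]
    simp [two_smul]
  · rw [smul_lie, mem_deg.1 (sum_mem_deg hx)]
    simp [two_smul]

/-- The principal nilpotent element acts injectively in non-negative degrees. -/
theorem eq_zero_of_lie_principal_eq_zero
    (hx : ∀ i : b.support, x i ∈ rootSpace H (-(i.1.1 : H → ℂ)) ∧ x i ≠ 0)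
    {k : ℤ} (hk : 0 ≤ k) {a : L} (ha : a ∈ deg b k)
    (h : ⁅∑ i, x i, a⁆ = 0) : a = 0 := by
  by_contra hne
  rcases hk.eq_or_lt with rfl | hk
  -- In degree 0 the bracket is ∑ αᵢ(a) xᵢ; pairing with yⱼ isolates αⱼ(a), and the simple roots
  -- separate the points of H.
  · obtain ⟨y, hy, -, -, hκ, hκ'⟩ := exists_dual_simple hx
    rw [deg_zero] at ha
    lift a to H using ha
    refine hne (congrArg Subtype.val (eq_zero_of_simple_apply_eq_zero b (a := a) fun j => ?_))
    have h1 : ∀ i, ⁅x i, (a : L)⁆ = (i.1.1 : H → ℂ) a • x i := fun i => by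
      have := lie_eq_smul_of_mem_rootSpace (hx i).1 a
      rw [← lie_skew, show ⁅(a : L), x i⁆ = ⁅a, x i⁆ from rfl, this]
      simp
    have h2 : ∑ i, (i.1.1 : H → ℂ) a • x i = 0 := by
      rw [← h, sum_lie, Finset.sum_congr rfl fun i _ => h1 i]
    have h3 := congrArg (killingForm ℂ L (y j)) h2
    rw [map_sum, Finset.sum_eq_single j (fun i _ hi => by rw [map_smul, hκ' j i hi.symm, smul_zero])
      (by simp), map_smul, hκ, map_zero] at h3
    simpa using h3
  -- In positive degree a would be primitive for the reversed triple with eigenvalue -2k, which is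
  -- not a natural number.
  · obtain ⟨e, -, t⟩ := exists_principal_sl2 hx
    have P : t.symm.HasPrimitiveVectorWith a (-2 * (k : ℂ)) := by
      refine ⟨hne, ?_, h⟩
      rw [neg_lie, smul_lie, mem_deg.1 ha, smul_smul, neg_mul, neg_smul]
    obtain ⟨n, hn⟩ := P.exists_nat
    have : (-2 * k : ℤ) = n := by exact_mod_cast hn
    omega

end Principal

/-! ### Centralizers of elements of N + 𝔟. -/

section Regular

open LieAlgebra LieAlgebra.IsKilling Module

variable {L : Type} [LieRing L] [LieAlgebra ℂ L] [FiniteDimensional ℂ L]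
  [LieAlgebra.IsSimple ℂ L] {H : LieSubalgebra ℂ L} [H.IsCartanSubalgebra]
  {b : (rootSystem H).Base}

theorem killingForm_filt {x y : L} (hx : x ∈ filt b 0) (hy : y ∈ filt b 1) :
    killingForm ℂ L x y = 0 := by
  induction hx using Submodule.iSup_induction' with
  | mem i x hx =>
    induction hy using Submodule.iSup_induction' with
    | mem i' y hy => exact killingForm_deg hx hy (by have := i.2; have := i'.2; omega)
    | zero => simp
    | add y z _ _ h1 h2 => rw [map_add, h1, h2, add_zero]
  | zero => simp
  | add y z _ _ h1 h2 => rw [map_add, LinearMap.add_apply, h1, h2, add_zero]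

theorem killingForm_filt_neg {x y : L} {k : ℤ} (hk : k < 0) (hx : x ∈ deg b k)
    (hy : y ∈ ⨆ j : {j : ℤ // j ≤ 0}, deg b j) : killingForm ℂ L x y = 0 := by
  induction hy using Submodule.iSup_induction' with
  | mem i y hy => exact killingForm_deg hx hy (by have := i.2; omega)
  | zero => simp
  | add y z _ _ h1 h2 => rw [map_add, h1, h2, add_zero]

/-- The Killing form pairs degree j only with degree -j and is nondegenerate, so 𝔟^⊥ = 𝔫. -/
theorem orthogonal_filt_zero : (killingForm ℂ L).orthogonal (filt b 0) = filt b 1 := by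
  refine le_antisymm (fun z hz => ?_) fun z hz w hw => killingForm_filt hw hz
  have htop : z ∈ filt b 1 ⊔ ⨆ j : {j : ℤ // j ≤ 0}, deg b j := by
    have : (⊤ : Submodule ℂ L) ≤ filt b 1 ⊔ ⨆ j : {j : ℤ // j ≤ 0}, deg b j := by
      rw [← iSup_deg b]
      refine iSup_le fun j => ?_
      rcases le_or_gt j 0 with h | h
      · exact le_sup_of_le_right (le_iSup_of_le (⟨j, h⟩ : {j : ℤ // j ≤ 0}) le_rfl)
      · exact le_sup_of_le_left (deg_le_filt b h)
    exact this trivial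
  obtain ⟨w, hw, c, hc, rfl⟩ := Submodule.mem_sup.1 htop
  have hc0 : ∀ j, ∀ u ∈ deg b j, killingForm ℂ L u c = 0 := by
    intro j u hu
    rcases le_or_gt 0 j with h | h
    · have h1 : killingForm ℂ L u (w + c) = 0 := hz u (deg_le_filt b h hu)
      rwa [map_add, killingForm_filt (deg_le_filt b h hu) hw, zero_add] at h1
    · exact killingForm_filt_neg h hu hc
  have hc1 : c = 0 := by
    refine (killingForm_nondegenerate ℂ L).2 c fun u => ?_
    have hu : u ∈ ⨆ k, deg b k := iSup_deg b ▸ trivial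
    induction hu using Submodule.iSup_induction' with
    | mem i x hx => exact hc0 i x hx
    | zero => simp
    | add y z _ _ h1 h2 => rw [map_add, LinearMap.add_apply, h1, h2, add_zero]
  simpa [hc1] using hw

theorem finrank_filt_zero :
    finrank ℂ (filt b 0) = finrank ℂ H + finrank ℂ (filt b 1) := by
  have h := Submodule.finrank_sup_add_finrank_inf_eq (deg b 0) (filt b 1)
  rw [(deg_disjoint_filt b one_pos).eq_bot, finrank_bot, add_zero] at h
  have h2 := filt_succ b 0
  rw [zero_add] at h2
  rw [h2, h, deg_zero]
  rfl

/-- By invariance the image of ad x is orthogonal to its kernel, and the dimensions agree. -/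
theorem range_ad_eq (x : L) : LinearMap.range (ad ℂ L x) =
    (killingForm ℂ L).orthogonal (LinearMap.ker (ad ℂ L x)) := by
  refine Submodule.eq_of_le_of_finrank_eq ?_ ?_
  · rintro _ ⟨v, rfl⟩ z hz
    have h := LieModule.traceForm_apply_lie_apply ℂ L L z x v
    have hz' : ⁅x, z⁆ = 0 := by simpa using hz
    rw [← lie_skew, hz', neg_zero, map_zero, LinearMap.zero_apply] at h
    exact h.symm
  · rw [LinearMap.BilinForm.finrank_orthogonal (killingForm_nondegenerate ℂ L)]
    have := LinearMap.finrank_range_add_finrank_ker (ad ℂ L x)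
    omega

/-- `N` has degree `-1` and acts injectively in non-negative degrees. -/
structure IsPrincipalNegative (b : (rootSystem H).Base) (N : L) : Prop where
  mem : N ∈ deg b (-1)
  inj : ∀ k : ℤ, 0 ≤ k → ∀ a ∈ deg b k, ⁅N, a⁆ = 0 → a = 0

theorem isPrincipalNegative_sum {x : b.support → L}
    (hx : ∀ i : b.support, x i ∈ rootSpace H (-(i.1.1 : H → ℂ)) ∧ x i ≠ 0) :
    IsPrincipalNegative b (∑ i, x i) :=
  ⟨sum_mem_deg hx, fun _ hk _ ha h => eq_zero_of_lie_principal_eq_zero hx hk ha h⟩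

/-- The lowest term of [x, v] is N bracketed with the lowest term of v. Injectivity of ad N pushes v
up the filtration until it is exhausted. -/
theorem eq_zero_of_lie_eq_zero_of_mem_filt {N x v : L} (hN : IsPrincipalNegative b N)
    (hx : x - N ∈ filt b 0) (hv : v ∈ filt b 1) (h : ⁅x, v⁆ = 0) : v = 0 := by
  have key : ∀ m : ℕ, v ∈ filt b (1 + m) := by
    intro m
    induction m with
    | zero => simpa using hv
    | succ m ih =>
      have ih' := ih
      rw [filt_succ] at ih'
      obtain ⟨a, ha, c, hc, hac⟩ := Submodule.mem_sup.1 ih'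
      have h1 : ⁅N, a⁆ ∈ deg b m := lie_mem_deg hN.mem ha (by ring)
      have h2 : ⁅N, a⁆ ∈ filt b (m + 1) := by
        have : ⁅N, a⁆ = -(⁅N, c⁆ + ⁅x - N, v⁆) := by
          rw [sub_lie, h, ← hac, lie_add]; abel
        rw [this]
        refine neg_mem (add_mem ?_ ?_)
        · exact lie_mem_filt (deg_le_filt b le_rfl hN.mem) hc (by omega)
        · exact lie_mem_filt hx ih (by omega)
      have h3 := Submodule.disjoint_def.1 (deg_disjoint_filt b (lt_add_one (m : ℤ))) _ h1 h2
      have h4 := hN.inj _ (by omega) a ha h3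
      rw [← hac, h4, zero_add]
      have : (1 : ℤ) + (m + 1 : ℕ) = 1 + m + 1 := by push_cast; ring
      rwa [this]
  obtain ⟨K, hK⟩ := exists_filt_eq_bot b
  have : v ∈ filt b K := filt_anti b (by omega : K ≤ 1 + K.toNat) (key _)
  simpa [hK] using this

theorem map_ad_filt_le {N x : L} (hN : IsPrincipalNegative b N) (hx : x - N ∈ filt b 0) :
    (filt b 1).map (ad ℂ L x) ≤ LinearMap.range (ad ℂ L x) ⊓ filt b 0 := by
  rintro _ ⟨v, hv, rfl⟩
  refine ⟨⟨v, rfl⟩, ?_⟩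
  have : ad ℂ L x v = ⁅N, v⁆ + ⁅x - N, v⁆ := by rw [sub_lie]; simp
  rw [this]
  exact add_mem (lie_mem_filt (deg_le_filt b le_rfl hN.mem) hv (by omega))
    (lie_mem_filt hx hv (by omega))

theorem finrank_map_ad_filt {N x : L} (hN : IsPrincipalNegative b N) (hx : x - N ∈ filt b 0) :
    finrank ℂ ((filt b 1).map (ad ℂ L x)) = finrank ℂ (filt b 1) := by
  have := LinearMap.finrank_range_of_inj (f := (ad ℂ L x).domRestrict (filt b 1)) (by
    rw [← LinearMap.ker_eq_bot, LinearMap.ker_eq_bot']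
    intro v hv
    exact Subtype.ext (eq_zero_of_lie_eq_zero_of_mem_filt hN hx v.2 (by simpa using hv)))
  rwa [LinearMap.range_domRestrict] at this

/-- The reason is that the image of ad x and 𝔟 together span: an element orthogonal to both lies in
𝔫 and commutes with x, hence vanishes. -/
theorem finrank_range_inf {N x : L} (hN : IsPrincipalNegative b N) (hx : x - N ∈ filt b 0) :
    finrank ℂ L + finrank ℂ (LinearMap.range (ad ℂ L x) ⊓ filt b 0 : Submodule ℂ L) =
      finrank ℂ (LinearMap.range (ad ℂ L x)) + finrank ℂ (filt b 0) := by
  have htop : LinearMap.range (ad ℂ L x) ⊔ filt b 0 = ⊤ := by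
    have h := LinearMap.BilinForm.finrank_orthogonal (killingForm_nondegenerate ℂ L)
      (LinearMap.range (ad ℂ L x) ⊔ filt b 0)
    have h0 : (killingForm ℂ L).orthogonal (LinearMap.range (ad ℂ L x) ⊔ filt b 0) = ⊥ := by
      rw [eq_bot_iff]
      intro v hv
      have h1 : v ∈ filt b 1 := by
        rw [← orthogonal_filt_zero]
        exact LinearMap.BilinForm.orthogonal_le le_sup_right hv
      have h2 : ⁅x, v⁆ = 0 := by
        refine (killingForm_nondegenerate ℂ L).2 _ fun u => ?_
        have h3 : killingForm ℂ L ⁅x, u⁆ v = 0 := 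
          hv _ (Submodule.mem_sup_left ⟨u, rfl⟩)
        have h4 := LieModule.traceForm_apply_lie_apply ℂ L L u x v
        have h5 : killingForm ℂ L ⁅u, x⁆ v = 0 := by
          rw [← lie_skew, map_neg, LinearMap.neg_apply, h3, neg_zero]
        exact h4.symm.trans h5
      exact eq_zero_of_lie_eq_zero_of_mem_filt hN hx h1 h2
    rw [h0, finrank_bot] at h
    refine Submodule.eq_top_of_finrank_eq (le_antisymm (Submodule.finrank_le _) ?_)
    omega
  have := Submodule.finrank_sup_add_finrank_inf_eq (LinearMap.range (ad ℂ L x)) (filt b 0)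
  rwa [htop, finrank_top] at this

/-- The space [x, 𝔫] has the dimension of 𝔫 and lies in im(ad x) ∩ 𝔟. With `finrank_range_inf` the
nullity is at most dim 𝔟 - dim 𝔫 = r. -/
theorem finrank_ker_ad_le {N x : L} (hN : IsPrincipalNegative b N) (hx : x - N ∈ filt b 0) :
    finrank ℂ (LinearMap.ker (ad ℂ L x)) ≤ finrank ℂ H := by
  have h1 := finrank_range_inf hN hx
  have h2 := Submodule.finrank_mono (map_ad_filt_le hN hx)
  rw [finrank_map_ad_filt hN hx] at h2
  have h3 := LinearMap.finrank_range_add_finrank_ker (ad ℂ L x)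
  have h4 := finrank_filt_zero (b := b)
  omega

/-- When the nullity is r, the estimate in `finrank_ker_ad_le` is sharp and forces equality of the
two spaces. -/
theorem range_inf_filt_zero {N x : L} (hN : IsPrincipalNegative b N) (hx : x - N ∈ filt b 0)
    (hlow : finrank ℂ H ≤ finrank ℂ (LinearMap.ker (ad ℂ L x))) :
    LinearMap.range (ad ℂ L x) ⊓ filt b 0 = (filt b 1).map (ad ℂ L x) := by
  refine (Submodule.eq_of_le_of_finrank_le (map_ad_filt_le hN hx) ?_).symm
  have h1 := finrank_range_inf hN hx
  rw [finrank_map_ad_filt hN hx]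
  have h3 := LinearMap.finrank_range_add_finrank_ker (ad ℂ L x)
  have h4 := finrank_filt_zero (b := b)
  omega

theorem killingForm_eq_zero_of_commute {x y : L} (hx : IsNilpotent (ad ℂ L x))
    (hxy : ⁅x, y⁆ = 0) : killingForm ℂ L x y = 0 := by
  have hc : Commute (ad ℂ L x) (ad ℂ L y) := by
    rw [commute_iff_lie_eq, ← LieHom.map_lie, hxy, map_zero]
  have h := hc.isNilpotent_mul_right hx
  exact (LinearMap.isNilpotent_trace_of_isNilpotent h).eq_zero

/-- A nilpotent element of `N + 𝔟` is homogeneous of degree `-1` for a conjugate of `ρ`. -/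
theorem exists_lie_eq_neg_of_isNilpotent {N x : L} (hN : IsPrincipalNegative b N)
    (hx : x - N ∈ filt b 0) (hnil : IsNilpotent (ad ℂ L x))
    (hlow : finrank ℂ H ≤ finrank ℂ (LinearMap.ker (ad ℂ L x))) :
    ∃ n ∈ filt b 1, ⁅(rhoCheck b : L) + n, x⁆ = -x := by
  have hρ : (rhoCheck b : L) ∈ deg b 0 := cartan_le_deg b (rhoCheck b).2
  -- A nilpotent x is Killing-orthogonal to everything commuting with it, hence lies in (ker ad x)^⊥
  -- = im ad x.
  have h1 : x ∈ LinearMap.range (ad ℂ L x) := by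
    rw [range_ad_eq]
    intro z hz
    have := killingForm_eq_zero_of_commute hnil (y := z) (by simpa using hz)
    rw [← this]
    exact LieModule.traceForm_comm ℂ L L z x
  -- The degree -1 part N cancels in -x - [ρ, x], so this vector lies in 𝔟 and can be written as [x,
  -- n] with n in 𝔫.
  have h2 : -x - ⁅(rhoCheck b : L), x⁆ ∈ LinearMap.range (ad ℂ L x) ⊓ filt b 0 := by
    refine ⟨sub_mem (neg_mem h1) ⟨-(rhoCheck b : L), by simp⟩, ?_⟩
    have : -x - ⁅(rhoCheck b : L), x⁆ = -(x - N) - ⁅(rhoCheck b : L), x - N⁆ := by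
      rw [lie_sub, mem_deg.1 hN.mem]; push_cast; rw [neg_one_smul]; abel
    rw [this]
    exact sub_mem (neg_mem hx) (lie_mem_filt (deg_le_filt b le_rfl hρ) hx (by omega))
  rw [range_inf_filt_zero hN hx hlow] at h2
  obtain ⟨n, hn, hnx⟩ := h2
  refine ⟨-n, neg_mem hn, ?_⟩
  rw [add_lie, neg_lie, lie_skew]
  rw [ad_apply] at hnx
  rw [hnx]; abel

end Regular

end OperConn

namespace OperConn

/-! ### Decompositions into eigenspaces and the maximal root. -/

section Cyclic

open LieAlgebra LieAlgebra.IsKilling Module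

theorem finrank_eq_sum_of_iSupIndep {ι V : Type*} [Fintype ι] [AddCommGroup V]
    [Module ℂ V] [FiniteDimensional ℂ V] {D : ι → Submodule ℂ V} (hD : iSupIndep D)
    (hT : ⨆ i, D i = ⊤) : finrank ℂ V = ∑ i, finrank ℂ (D i) := by
  classical
  have h := DirectSum.isInternal_submodule_of_iSupIndep_of_iSup_eq_top hD hT
  rw [← finrank_directSum]
  exact (LinearEquiv.ofBijective (DirectSum.coeLinearMap D) h).finrank_eq.symm

theorem exists_linearMap_of_iSupIndep {ι V : Type*} [AddCommGroup V] [Module ℂ V]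
    {D : ι → Submodule ℂ V} (hD : iSupIndep D) (hT : ⨆ i, D i = ⊤) (c : ι → ℂ) :
    ∃ σ : V →ₗ[ℂ] V, ∀ i, ∀ v ∈ D i, σ v = c i • v := by
  classical
  have h := DirectSum.isInternal_submodule_of_iSupIndep_of_iSup_eq_top hD hT
  let e := LinearEquiv.ofBijective (DirectSum.coeLinearMap D) h
  refine ⟨DirectSum.toModule ℂ ι V (fun i => c i • (D i).subtype) ∘ₗ e.symm.toLinearMap,
    fun i v hv => ?_⟩
  have h1 : e.symm v = DirectSum.lof ℂ ι (fun i => D i) i ⟨v, hv⟩ := by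
    rw [LinearEquiv.symm_apply_eq]
    change v = DirectSum.coeLinearMap D _
    rw [DirectSum.coeLinearMap_lof]
  rw [LinearMap.comp_apply, LinearEquiv.coe_coe, h1, DirectSum.toModule_lof]
  rfl

/-- On an eigenspace of s, the operator n + s minus the eigenvalue acts as n and is nilpotent. The
eigenspaces of s span and the generalized ones are independent, so the inclusions are equalities. -/
theorem eigenspace_eq_maxGenEigenspace_of_add {V : Type*} [AddCommGroup V] [Module ℂ V]
    [FiniteDimensional ℂ V] {n s : End ℂ V} (hn : IsNilpotent n) (hs : s.IsSemisimple)
    (hc : Commute n s) (μ : ℂ) : s.eigenspace μ = (n + s).maxGenEigenspace μ := by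
  refine eq_of_iSupIndep_of_iSup_eq_top (fun ν v hv => ?_)
    (n + s).independent_maxGenEigenspace hs.iSup_eigenspace_eq_top μ
  obtain ⟨k, hk⟩ := hn
  rw [End.mem_maxGenEigenspace]
  refine ⟨k, ?_⟩
  have hinv : ∀ j : ℕ, ((n + s - ν • 1) ^ j) v = (n ^ j) v := by
    intro j
    have hmem : ∀ j : ℕ, (n ^ j) v ∈ s.eigenspace ν := by
      intro j
      rw [End.mem_eigenspace_iff] at hv ⊢
      rw [← LinearMap.comp_apply, ← End.mul_eq_comp, ← (hc.pow_left j).eq, End.mul_apply, hv,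
        map_smul]
    induction j with
    | zero => simp
    | succ j ih =>
      rw [pow_succ', End.mul_apply, ih, pow_succ' n, End.mul_apply]
      have := End.mem_eigenspace_iff.1 (hmem j)
      simp [this]
  rw [hinv, hk, LinearMap.zero_apply]

theorem finrank_eq_finrank_cartan_add_card {L : Type} [LieRing L] [LieAlgebra ℂ L]
    [FiniteDimensional ℂ L] [LieAlgebra.IsKilling ℂ L] (H : LieSubalgebra ℂ L)
    [H.IsCartanSubalgebra] [Nontrivial L] : finrank ℂ L = finrank ℂ H + H.root.card := by
  classical
  have hT := LieModule.iSup_genWeightSpace_eq_top' ℂ H L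
  rw [← LieSubmodule.toSubmodule_inj, LieSubmodule.iSup_toSubmodule] at hT
  have hI : iSupIndep fun χ : LieModule.Weight ℂ H L =>
      (LieModule.genWeightSpace L (χ : H → ℂ)).toSubmodule :=
    LieSubmodule.iSupIndep_toSubmodule.2 (LieModule.iSupIndep_genWeightSpace' ℂ H L)
  rw [finrank_eq_sum_of_iSupIndep hI hT, ← Finset.add_sum_erase _ _ (Finset.mem_univ 0)]
  have h0 : finrank ℂ (LieModule.genWeightSpace L ((0 : LieModule.Weight ℂ H L) : H → ℂ)).toSubmodule
      = finrank ℂ H := by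
    have : (LieModule.genWeightSpace L ((0 : LieModule.Weight ℂ H L) : H → ℂ)) =
        rootSpace H (0 : H → ℂ) := rfl
    rw [this, rootSpace_zero_eq]
    rfl
  have hroot : Finset.univ.erase (0 : LieModule.Weight ℂ H L) = H.root := by
    ext χ
    simp [LieModule.Weight.IsNonZero, LieModule.Weight.isZero_iff_eq_zero]
  rw [h0, hroot, Finset.sum_congr rfl (g := fun _ => 1) fun χ hχ => ?_, Finset.sum_const,
    smul_eq_mul, mul_one]
  exact finrank_rootSpace_eq_one χ (by simpa using hχ)

variable {L : Type} [LieRing L] [LieAlgebra ℂ L] [FiniteDimensional ℂ L]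
  [LieAlgebra.IsSimple ℂ L] {H : LieSubalgebra ℂ L} [H.IsCartanSubalgebra]
  {b : (rootSystem H).Base}

/-- Evaluation at ρ counts the simple roots in a sum, so the value 0 means the empty sum. Applied to
θ - β, this bounds heights and gives uniqueness at the top. -/
theorem closure_apply_rhoCheck {f : Dual ℂ H}
    (hf : f ∈ AddSubmonoid.closure ((rootSystem H).root '' b.support)) :
    ∃ n : ℕ, f (rhoCheck b) = n ∧ (n = 0 → f = 0) := by
  induction hf using AddSubmonoid.closure_induction with
  | mem f hf =>
    obtain ⟨i, hi, rfl⟩ := hf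
    exact ⟨1, by simpa using simple_apply_rhoCheck b hi, by simp⟩
  | zero => exact ⟨0, by simp⟩
  | add f g _ _ h1 h2 =>
    obtain ⟨n, hn, hn'⟩ := h1
    obtain ⟨m, hm, hm'⟩ := h2
    refine ⟨n + m, by simp [hn, hm], fun h => ?_⟩
    rw [hn' (by omega), hm' (by omega), add_zero]

theorem closure_repr {f : Dual ℂ H}
    (hf : f ∈ AddSubmonoid.closure ((rootSystem H).root '' b.support)) (i : b.support) :
    ∃ n : ℕ, b.toWeightBasis.repr f i = n := by
  classical
  induction hf using AddSubmonoid.closure_induction with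
  | mem f hf =>
    obtain ⟨j, hj, rfl⟩ := hf
    have : (rootSystem H).root j = b.toWeightBasis ⟨j, hj⟩ := by simp
    rw [this, Basis.repr_self, Finsupp.single_apply]
    split_ifs
    · exact ⟨1, by simp⟩
    · exact ⟨0, by simp⟩
  | zero => exact ⟨0, by simp⟩
  | add f g _ _ h1 h2 =>
    obtain ⟨n, hn⟩ := h1
    obtain ⟨m, hm⟩ := h2
    exact ⟨n + m, by simp [hn, hm]⟩

theorem IsMaximalRoot.height_le {θ : H.root} (hθ : IsMaximalRoot b θ) (β : H.root) :
    b.height β ≤ b.height θ ∧ (b.height β = b.height θ → β = θ) := by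
  obtain ⟨n, hn, hn'⟩ := closure_apply_rhoCheck (hθ β)
  have h1 : (rootSystem H).root θ (rhoCheck b) = b.height θ := root_apply_rhoCheck b θ
  have h2 : (rootSystem H).root β (rhoCheck b) = b.height β := root_apply_rhoCheck b β
  rw [LinearMap.sub_apply, h1, h2] at hn
  have h3 : b.height θ - b.height β = n := by exact_mod_cast hn
  refine ⟨by omega, fun h => ?_⟩
  have := hn' (by omega)
  exact ((rootSystem H).root.injective (sub_eq_zero.1 this)).symm

theorem IsMaximalRoot.height_pos {θ : H.root} (hθ : IsMaximalRoot b θ) : 0 < b.height θ := by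
  obtain ⟨i, hi⟩ := b.support_nonempty
  have := (hθ.height_le i).1
  rw [RootPairing.Base.height_one_of_mem_support hi] at this
  omega

/-- Maximality against αᵢ itself: θ - αᵢ has natural coefficients, so the coefficient of αᵢ in θ is
at least 1. -/
theorem IsMaximalRoot.exists_coeff {θ : H.root} (hθ : IsMaximalRoot b θ) :
    ∃ a : b.support → ℕ, (∀ i, a i ≠ 0) ∧
      (rootSystem H).root θ = ∑ i, (a i : ℂ) • (rootSystem H).root i.1 := by
  classical
  have : ∀ i : b.support, ∃ n : ℕ, n ≠ 0 ∧ b.toWeightBasis.repr ((rootSystem H).root θ) i = n := by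
    intro i
    obtain ⟨n, hn⟩ := closure_repr (hθ i.1) i
    refine ⟨n + 1, by omega, ?_⟩
    have h : (rootSystem H).root i.1 = b.toWeightBasis i := by simp
    rw [map_sub, Finsupp.sub_apply, h, Basis.repr_self, Finsupp.single_eq_same] at hn
    push_cast
    linear_combination hn
  choose a ha ha' using this
  refine ⟨a, ha, ?_⟩
  conv_lhs => rw [← b.toWeightBasis.sum_repr ((rootSystem H).root θ)]
  simp only [ha', RootPairing.Base.toWeightBasis_apply]

theorem height_neg_root (α : H.root) : ∃ β : H.root, (β.1 : H → ℂ) = -(α.1 : H → ℂ) ∧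
    b.height β = - b.height α := by
  refine ⟨(rootSystem H).reflectionPerm α α, ?_, b.height_reflectionPerm_self α⟩
  have : (rootSystem H).root ((rootSystem H).reflectionPerm α α) = -(rootSystem H).root α := by
    rw [RootPairing.root_reflectionPerm, RootPairing.reflection_apply_self]
  ext z
  exact LinearMap.congr_fun this z

theorem IsMaximalRoot.deg_eq_bot {θ : H.root} (hθ : IsMaximalRoot b θ) {k : ℤ}
    (hk : b.height θ < |k|) : deg b k = ⊥ := by
  have := hθ.height_pos
  rw [deg_of_ne_zero b (by rintro rfl; simp at hk; omega), eq_bot_iff]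
  refine iSup_le fun α => absurd α.2 ?_
  have h1 := (hθ.height_le α.1).1
  obtain ⟨β, -, hβ⟩ := height_neg_root (b := b) α.1
  have h2 := (hθ.height_le β).1
  rcases abs_cases k with h | h <;> omega

theorem IsMaximalRoot.deg_height {θ : H.root} (hθ : IsMaximalRoot b θ) :
    deg b (b.height θ) = (rootSpace H (θ.1 : H → ℂ)).toSubmodule := by
  refine le_antisymm ?_ (rootSpace_le_deg b θ)
  rw [deg_of_ne_zero b hθ.height_pos.ne']
  refine iSup_le fun α => ?_
  rw [(hθ.height_le α.1).2 α.2]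

theorem rootSpace_le_span {α : LieModule.Weight ℂ H L} (hα : α.IsNonZero) {x : L}
    (hx : x ∈ rootSpace H (α : H → ℂ)) (hx0 : x ≠ 0) :
    (rootSpace H (α : H → ℂ)).toSubmodule ≤ ℂ ∙ x := by
  intro v hv
  obtain ⟨c, hc⟩ := (finrank_eq_one_iff_of_nonzero' (⟨x, hx⟩ : rootSpace H (α : H → ℂ))
    (by simpa [Subtype.ext_iff] using hx0)).1 (finrank_rootSpace_eq_one α hα) ⟨v, hv⟩
  exact Submodule.mem_span_singleton.2 ⟨c, congrArg Subtype.val hc⟩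

theorem exists_support_of_height_eq_one {α : H.root} (h : b.height α = 1) : α ∈ b.support := by
  classical
  obtain ⟨f, -, hf⟩ := b.exists_root_eq_sum_nat_or_neg α
  rcases hf with hf | hf
  · have h1 : b.height α = ∑ j ∈ b.support, (f j : ℤ) :=
      RootPairing.Base.height_eq_sum (f := fun j => (f j : ℤ)) (by simpa using hf)
    rw [h] at h1
    have h2 : ∑ j ∈ b.support, f j = 1 := by exact_mod_cast h1.symm
    obtain ⟨i, hi, hi0⟩ : ∃ i ∈ b.support, f i ≠ 0 := by
      by_contra! h3
      rw [Finset.sum_eq_zero h3] at h2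
      omega
    rw [← Finset.add_sum_erase _ _ hi] at h2
    have h3 : ∑ j ∈ b.support.erase i, f j = 0 := by omega
    rw [Finset.sum_eq_zero_iff] at h3
    have h4 : (rootSystem H).root α = (rootSystem H).root i := by
      rw [hf, ← Finset.add_sum_erase _ _ hi, Finset.sum_eq_zero fun j hj => by rw [h3 j hj, zero_smul],
        show f i = 1 by omega, one_smul, add_zero]
    rw [(rootSystem H).root.injective h4]
    exact hi
  · have h1 : b.height α = ∑ j ∈ b.support, (-(f j : ℤ)) :=
      RootPairing.Base.height_eq_sum (f := fun j => -(f j : ℤ)) (by simpa using hf)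
    rw [h, Finset.sum_neg_distrib] at h1
    have : 0 ≤ ∑ j ∈ b.support, (f j : ℤ) := Finset.sum_nonneg fun _ _ => by positivity
    omega

variable {x : b.support → L}

theorem deg_neg_one_le (hx : ∀ i : b.support, x i ∈ rootSpace H (-(i.1.1 : H → ℂ)) ∧ x i ≠ 0) :
    deg b (-1) ≤ Submodule.span ℂ (Set.range x) := by
  rw [deg_of_ne_zero b (by norm_num)]
  refine iSup_le fun α => ?_
  obtain ⟨β, hβ, hβ'⟩ := height_neg_root (b := b) α.1
  have hs := exists_support_of_height_eq_one (b := b) (α := β) (by rw [hβ', α.2]; norm_num)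
  have h1 := hx ⟨β, hs⟩
  rw [hβ, neg_neg] at h1
  exact (rootSpace_le_span (LieSubalgebra.isNonZero_coe_root α.1) h1.1 h1.2).trans
    (Submodule.span_mono (by simp))

end Cyclic
end OperConn

namespace OperConn

/-! ### Semisimplicity of N + E and the Coxeter number. -/

section CyclicElement

open LieAlgebra LieAlgebra.IsKilling Module

variable {L : Type} [LieRing L] [LieAlgebra ℂ L] [FiniteDimensional ℂ L]
  [LieAlgebra.IsSimple ℂ L] {H : LieSubalgebra ℂ L} [H.IsCartanSubalgebra]
  {b : (rootSystem H).Base} {x : b.support → L} {θ : H.root} {E : L}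

theorem exists_killingForm_eq_one' {α : H.root} {x : L}
    (hx : x ∈ rootSpace H (α.1 : H → ℂ)) (hx0 : x ≠ 0) :
    ∃ y ∈ rootSpace H (-(α.1 : H → ℂ)), killingForm ℂ L x y = 1 ∧ ⁅x, y⁆ = (rootDual α : L) := by
  obtain ⟨y, hy, hyx⟩ : ∃ y ∈ rootSpace H (-(α.1 : H → ℂ)), killingForm ℂ L x y ≠ 0 := by
    by_contra! h
    apply hx0
    have := mem_ker_killingForm_of_mem_rootSpace_of_forall_rootSpace_neg ℂ L H
      (α := (α.1 : H → ℂ)) hx (by simpa using h)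
    simpa using this
  have h1 : killingForm ℂ L x ((killingForm ℂ L x y)⁻¹ • y) = 1 := by
    rw [map_smul, smul_eq_mul, inv_mul_cancel₀ hyx]
  have hy' := (rootSpace H (-(α.1 : H → ℂ))).smul_mem (killingForm ℂ L x y)⁻¹ hy
  refine ⟨_, hy', h1, ?_⟩
  rw [lie_eq_killingForm_smul_of_mem_rootSpace_of_mem_rootSpace_neg hx hy', h1, one_smul]
  rfl

/-- An element that commutes with the cyclic element `∑ x i + E`, is not orthogonal to it, and
whose centralizer meets the span of the `x i` and `E` in the line of the cyclic element. -/
theorem exists_dual_cyclic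
    (hx : ∀ i : b.support, x i ∈ rootSpace H (-(i.1.1 : H → ℂ)) ∧ x i ≠ 0)
    (hθ : IsMaximalRoot b θ) (hE : E ∈ rootSpace H (θ.1 : H → ℂ) ∧ E ≠ 0) :
    ∃ y : L, ⁅∑ i, x i + E, y⁆ = 0 ∧ killingForm ℂ L (∑ i, x i + E) y ≠ 0 ∧
      ∀ s ∈ deg b (-1) ⊔ deg b (b.height θ), ⁅s, y⁆ = 0 → ∃ c : ℂ, s = c • (∑ i, x i + E) := by
  classical
  obtain ⟨y, hy, hyx, hyx', hκ, hκ'⟩ := exists_dual_simple hx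
  obtain ⟨F, hF, hκF, hEF⟩ := exists_killingForm_eq_one' hE.1 hE.2
  obtain ⟨a, ha, hθa⟩ := hθ.exists_coeff
  obtain ⟨B, hB⟩ := rootDual_linearIndependent_basis b
  have hpos := hθ.height_pos
  have hEd : E ∈ deg b (b.height θ) := rootSpace_le_deg b θ hE.1
  have hFd : F ∈ deg b (-b.height θ) := neg_mem_deg b hF
  have hyd : ∀ i, y i ∈ deg b 1 := fun i => simple_mem_deg b i (hy i)
  have hxd : ∀ i, x i ∈ deg b (-1) := fun i => neg_simple_mem_deg b (hx i).1
  have hxF : ∀ i, ⁅x i, F⁆ = 0 := fun i => by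
    have := lie_mem_deg (hxd i) hFd rfl
    rwa [hθ.deg_eq_bot (by rw [abs_of_neg] <;> omega), Submodule.mem_bot] at this
  have hEy : ∀ i, ⁅E, y i⁆ = 0 := fun i => by
    have := lie_mem_deg hEd (hyd i) rfl
    rwa [hθ.deg_eq_bot (by rw [abs_of_pos] <;> omega), Submodule.mem_bot] at this
  have hdual : (rootDual θ : H) = ∑ i, (a i : ℂ) • B i := by
    rw [rootDual, hθa, map_sum]
    exact Finset.sum_congr rfl fun i _ => by rw [map_smul, hB]; rfl
  -- The partner is ∑ aᵢ yᵢ + F, with the coefficients aᵢ of θ as weights. Brackets of xᵢ with F and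
  -- of E with yᵢ exceed the degree range, and mixed ones vanish. The remaining combination is zero
  -- exactly when all cᵢ equal d, because no aᵢ is zero.
  have hlie : ∀ (c : b.support → ℂ) (d : ℂ),
      ⁅∑ i, c i • x i + d • E, ∑ i, (a i : ℂ) • y i + F⁆ =
        ((∑ i, ((a i : ℂ) * (d - c i)) • B i : H) : L) := by
    intro c d
    have h1 : ∀ i, ⁅c i • x i, ∑ j, (a j : ℂ) • y j + F⁆ = -((c i * a i) • (B i : L)) := fun i => by
      rw [lie_add, smul_lie (c i) (x i) F, hxF, smul_zero, add_zero, lie_sum,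
        Finset.sum_eq_single i, smul_lie, lie_smul, ← lie_skew, hyx, hB, smul_neg, smul_neg,
        smul_smul]
      · intro j _ hj
        rw [smul_lie, lie_smul, ← lie_skew, hyx' j i hj]; simp
      · simp
    have h2 : ⁅d • E, ∑ j, (a j : ℂ) • y j + F⁆ = d • (rootDual θ : L) := by
      rw [lie_add, lie_sum, Finset.sum_eq_zero fun j _ => by rw [smul_lie, lie_smul, hEy]; simp,
        zero_add, smul_lie, hEF]
    rw [add_lie, sum_lie, Finset.sum_congr rfl fun i _ => h1 i, h2, hdual]
    push_cast
    rw [Finset.smul_sum, ← Finset.sum_add_distrib]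
    refine Finset.sum_congr rfl fun i _ => ?_
    module
  refine ⟨∑ i, (a i : ℂ) • y i + F, ?_, ?_, ?_⟩
  · have := hlie (fun _ => 1) 1
    simpa using this
  · have h1 : ∀ i, killingForm ℂ L (x i) (∑ j, (a j : ℂ) • y j + F) = a i := fun i => by
      rw [map_add, killingForm_deg (hxd i) hFd (by omega), add_zero, map_sum,
        Finset.sum_eq_single i, map_smul]
      · have := LieModule.traceForm_comm ℂ L L (x i) (y i)
        rw [show killingForm ℂ L (x i) (y i) = 1 from this.trans (hκ i)]; simp
      · intro j _ hj
        rw [map_smul]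
        have := LieModule.traceForm_comm ℂ L L (x i) (y j)
        rw [show killingForm ℂ L (x i) (y j) = 0 from this.trans (hκ' j i hj)]; simp
      · simp
    have h2 : killingForm ℂ L E (∑ j, (a j : ℂ) • y j + F) = 1 := by
      rw [map_add, map_sum, Finset.sum_eq_zero, zero_add, hκF]
      intro j _
      rw [map_smul, killingForm_deg hEd (hyd j) (by omega), smul_zero]
    rw [LinearMap.map_add₂, LinearMap.map_sum₂, h2, Finset.sum_congr rfl fun i _ => h1 i]
    -- The pairing is a positive integer, the sum of the coefficients of θ plus one.
    have : ((∑ i, a i + 1 : ℕ) : ℂ) ≠ 0 := Nat.cast_ne_zero.2 (by omega)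
    push_cast at this
    exact this
  · intro s hs hsy
    obtain ⟨s₁, hs₁, s₂, hs₂, rfl⟩ := Submodule.mem_sup.1 hs
    obtain ⟨c, rfl⟩ := (Submodule.mem_span_range_iff_exists_fun ℂ).1 (deg_neg_one_le hx hs₁)
    rw [hθ.deg_height] at hs₂
    obtain ⟨d, rfl⟩ := Submodule.mem_span_singleton.1
      (rootSpace_le_span (LieSubalgebra.isNonZero_coe_root θ) hE.1 hE.2 hs₂)
    rw [hlie] at hsy
    have h0 : ∑ i, ((a i : ℂ) * (d - c i)) • B i = 0 := Subtype.ext hsy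
    have h1 := Fintype.linearIndependent_iff.1 B.linearIndependent _ h0
    have h2 : ∀ i, c i = d := fun i => by
      have := (mul_eq_zero.1 (h1 i)).resolve_left (Nat.cast_ne_zero.2 (ha i))
      linear_combination -this
    exact ⟨d, by simp only [h2, smul_add, Finset.smul_sum]⟩

/-- The automorphism `ζ ^ ρ` for a primitive root of unity `ζ` of order the Coxeter number. -/
theorem exists_coxeter_twist (hθ : IsMaximalRoot b θ) :
    ∃ (ζ : ℂ) (σ : L →ₗ[ℂ] L), IsPrimitiveRoot ζ (b.height θ + 1).toNat ∧
      ∀ k, ∀ v ∈ deg b k, σ v = ζ ^ k • v := by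
  have hpos := hθ.height_pos
  have hz := Complex.isPrimitiveRoot_exp (b.height θ + 1).toNat (by omega)
  obtain ⟨σ, hσ⟩ := exists_linearMap_of_iSupIndep (iSupIndep_deg b) (iSup_deg b) (fun k => _ ^ k)
  exact ⟨_, σ, hz, hσ⟩

theorem primitiveRoot_zpow_eq (hθ : IsMaximalRoot b θ) {ζ : ℂ}
    (hζ : IsPrimitiveRoot ζ (b.height θ + 1).toNat) {j k : ℤ} :
    ζ ^ j = ζ ^ k ↔ b.height θ + 1 ∣ j - k := by
  have hpos := hθ.height_pos
  have h0 : ζ ≠ 0 := hζ.ne_zero (by omega)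
  have h1 := hζ.zpow_eq_one_iff_dvd (j - k)
  rw [Int.toNat_of_nonneg (by omega)] at h1
  rw [← h1, zpow_sub₀ h0, div_eq_one_iff_eq (zpow_ne_zero _ h0)]

theorem eigenspace_twist {ζ : ℂ} {σ : L →ₗ[ℂ] L}
    (hσ : ∀ k, ∀ v ∈ deg b k, σ v = ζ ^ k • v) (c : ℂ) :
    End.eigenspace σ c = ⨆ k : {k : ℤ // ζ ^ k = c}, deg b k := by
  symm
  refine eq_of_iSupIndep_of_iSup_eq_top (W := fun c => ⨆ k : {k : ℤ // ζ ^ k = c}, deg b k)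
    (fun c => iSup_le fun k v hv => ?_) (End.eigenspaces_iSupIndep σ) ?_ c
  · rw [End.mem_eigenspace_iff, hσ k v hv, k.2]
  · rw [eq_top_iff, ← iSup_deg b]
    exact iSup_le fun k => le_iSup_of_le (ζ ^ k) (le_iSup_of_le ⟨k, rfl⟩ le_rfl)

theorem eigenspace_twist_neg_one (hθ : IsMaximalRoot b θ) {ζ : ℂ} {σ : L →ₗ[ℂ] L}
    (hζ : IsPrimitiveRoot ζ (b.height θ + 1).toNat)
    (hσ : ∀ k, ∀ v ∈ deg b k, σ v = ζ ^ k • v) :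
    End.eigenspace σ ζ⁻¹ ≤ deg b (-1) ⊔ deg b (b.height θ) := by
  have hpos := hθ.height_pos
  rw [eigenspace_twist hσ]
  refine iSup_le fun k => ?_
  have h1 : ζ ^ (k : ℤ) = ζ ^ (-1 : ℤ) := by rw [k.2, zpow_neg_one]
  rw [primitiveRoot_zpow_eq hθ hζ] at h1
  obtain ⟨q, hq⟩ := h1
  rcases lt_or_ge (b.height θ) |(k : ℤ)| with h | h
  · rw [hθ.deg_eq_bot h]; exact bot_le
  · have h2 := abs_le.1 h
    have h3 : q = 0 ∨ q = 1 := by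
      have : -1 < q := by nlinarith
      have : q < 2 := by nlinarith
      omega
    rcases h3 with rfl | rfl
    · rw [show (k : ℤ) = -1 by omega]; exact le_sup_left
    · rw [show (k : ℤ) = b.height θ by omega]; exact le_sup_right

theorem eigenspace_twist_one (hθ : IsMaximalRoot b θ) {ζ : ℂ} {σ : L →ₗ[ℂ] L}
    (hζ : IsPrimitiveRoot ζ (b.height θ + 1).toNat)
    (hσ : ∀ k, ∀ v ∈ deg b k, σ v = ζ ^ k • v) :
    End.eigenspace σ 1 ≤ deg b 0 := by
  have hpos := hθ.height_pos
  rw [eigenspace_twist hσ]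
  refine iSup_le fun k => ?_
  have h1 : ζ ^ (k : ℤ) = ζ ^ (0 : ℤ) := by rw [k.2, zpow_zero]
  rw [primitiveRoot_zpow_eq hθ hζ] at h1
  obtain ⟨q, hq⟩ := h1
  rcases lt_or_ge (b.height θ) |(k : ℤ)| with h | h
  · rw [hθ.deg_eq_bot h]; exact bot_le
  · have h2 := abs_le.1 h
    have h3 : q = 0 := by
      have : -1 < q := by nlinarith
      have : q < 1 := by nlinarith
      omega
    subst h3
    rw [show (k : ℤ) = 0 by omega]

/-- The degrees -1 and ht θ agree modulo the order of ζ, so both components of X are scaled by ζ⁻¹.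
-/
theorem twist_lie (hθ : IsMaximalRoot b θ) {ζ : ℂ} {σ : L →ₗ[ℂ] L}
    (hζ : IsPrimitiveRoot ζ (b.height θ + 1).toNat)
    (hσ : ∀ k, ∀ v ∈ deg b k, σ v = ζ ^ k • v) {X : L}
    (hX : X ∈ deg b (-1) ⊔ deg b (b.height θ)) (v : L) :
    σ ⁅X, v⁆ = ζ⁻¹ • ⁅X, σ v⁆ := by
  have hpos := hθ.height_pos
  have h0 : ζ ≠ 0 := hζ.ne_zero (by omega)
  obtain ⟨N, hN, E, hE, rfl⟩ := Submodule.mem_sup.1 hX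
  have hv : v ∈ ⨆ k, deg b k := iSup_deg b ▸ trivial
  induction hv using Submodule.iSup_induction' with
  | mem k v hv =>
    have h1 := hσ _ _ (lie_mem_deg hN hv rfl)
    have h2 := hσ _ _ (lie_mem_deg hE hv rfl)
    have h3 : ζ ^ (b.height θ + k) = ζ ^ (-1 + k) :=
      (primitiveRoot_zpow_eq hθ hζ).2 ⟨1, by ring⟩
    rw [add_lie, map_add, h1, h2, h3, hσ k v hv, lie_smul, smul_smul, add_lie, smul_add,
      zpow_add₀ h0, zpow_neg_one]
  | zero => simp
  | add v w _ _ h1 h2 => rw [lie_add, map_add, h1, h2, map_add, lie_add, smul_add]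

/-- The semisimple part of an inner derivation is inner. -/
theorem exists_ad_eq_of_isSemisimple {X : L} {n s : End ℂ L} (hn : IsNilpotent n)
    (hs : s.IsSemisimple) (hc : Commute n s) (h : ad ℂ L X = n + s) : ∃ z, ad ℂ L z = s := by
  have heig := eigenspace_eq_maxGenEigenspace_of_add hn hs hc
  rw [← h] at heig
  -- Generalized eigenvalues of the derivation ad X add under the bracket, so s, acting by the
  -- eigenvalues, is again a derivation; derivations here are inner.
  have hd : ∀ v w, s ⁅v, w⁆ = ⁅v, s w⁆ - ⁅w, s v⁆ := by
    intro v w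
    have hv : v ∈ ⨆ μ, s.eigenspace μ := hs.iSup_eigenspace_eq_top ▸ trivial
    have hw : w ∈ ⨆ μ, s.eigenspace μ := hs.iSup_eigenspace_eq_top ▸ trivial
    induction hv using Submodule.iSup_induction' with
    | mem μ v hv =>
      induction hw using Submodule.iSup_induction' with
      | mem ν w hw =>
        have h1 : ⁅v, w⁆ ∈ s.eigenspace (μ + ν) := by
          rw [heig] at hv hw ⊢
          exact LieModule.lie_mem_maxGenEigenspace_toEnd hv hw
        rw [End.mem_eigenspace_iff] at *
        rw [hv, hw, h1, lie_smul, lie_smul, ← lie_skew v w]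
        module
      | zero => simp
      | add w w' _ _ h1 h2 => simp only [lie_add, add_lie, map_add, h1, h2]; abel
    | zero => simp
    | add w w' _ _ h1 h2 => simp only [lie_add, add_lie, map_add, h1, h2]; abel
  obtain ⟨z, hz⟩ := LieDerivation.IsKilling.exists_eq_ad (R := ℂ) (⟨s, hd⟩ : LieDerivation ℂ L L)
  refine ⟨z, ?_⟩
  rw [← LieDerivation.coe_ad_apply_eq_ad_apply, hz]

/-- The semisimple part of ad X is ad z. The symmetry ζ^ρ forces z into degrees -1 and ht θ, and z
commutes with everything that X commutes with, in particular with y. By `exists_dual_cyclic` z = cX.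
If c ≠ 1, then ad X is proportional to its nilpotent part, which contradicts κ(X, y) ≠ 0. -/
theorem cyclic_isSemisimple
    (hx : ∀ i : b.support, x i ∈ rootSpace H (-(i.1.1 : H → ℂ)) ∧ x i ≠ 0)
    (hθ : IsMaximalRoot b θ) (hE : E ∈ rootSpace H (θ.1 : H → ℂ) ∧ E ≠ 0) :
    (ad ℂ L (∑ i, x i + E)).IsSemisimple := by
  have hpos := hθ.height_pos
  obtain ⟨y, hXy, hκ, hline⟩ := exists_dual_cyclic hx hθ hE
  obtain ⟨ζ, σ, hζ, hσ⟩ := exists_coxeter_twist hθ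
  have h0 : ζ ≠ 0 := hζ.ne_zero (by omega)
  have hN := isPrincipalNegative_sum hx
  have hEd : E ∈ deg b (b.height θ) := rootSpace_le_deg b θ hE.1
  set X := ∑ i, x i + E with hXdef
  have hX : X ∈ deg b (-1) ⊔ deg b (b.height θ) := add_mem
    (Submodule.mem_sup_left hN.mem) (Submodule.mem_sup_right hEd)
  obtain ⟨n, hnm, s, hsm, hn, hs, hns⟩ := (ad ℂ L X).exists_isNilpotent_isSemisimple
  have hc : Commute n s := Algebra.commute_of_mem_adjoin_singleton_of_commute hsm
    (Algebra.commute_of_mem_adjoin_self hnm).symm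
  have heig := eigenspace_eq_maxGenEigenspace_of_add hn hs hc
  rw [← hns] at heig
  obtain ⟨z, hz⟩ := exists_ad_eq_of_isSemisimple hn hs hc hns
  have hker : ∀ v : L, ⁅X, v⁆ = 0 → ⁅z, v⁆ = 0 := by
    intro v hv
    have h1 : v ∈ s.eigenspace 0 := by
      rw [heig, End.mem_maxGenEigenspace]
      exact ⟨1, by simpa using hv⟩
    rw [End.mem_eigenspace_iff, ← hz] at h1
    simpa using h1
  -- σ maps the generalized eigenspace of ad X for μ to that for ζμ, and these are the eigenspaces
  -- of ad z.
  have hσs : ∀ v, σ ⁅z, v⁆ = ζ⁻¹ • ⁅z, σ v⁆ := by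
    intro v
    have hv : v ∈ ⨆ μ, s.eigenspace μ := hs.iSup_eigenspace_eq_top ▸ trivial
    induction hv using Submodule.iSup_induction' with
    | mem μ v hv =>
      have h2 : σ v ∈ s.eigenspace (ζ * μ) := by
        rw [heig, End.mem_maxGenEigenspace] at hv ⊢
        obtain ⟨k, hk⟩ := hv
        refine ⟨k, ?_⟩
        have h3 : ∀ w, (ad ℂ L X - (ζ * μ) • (1 : End ℂ L)) (σ w) =
            ζ • σ ((ad ℂ L X - μ • (1 : End ℂ L)) w) := by
          intro w
          simp [twist_lie hθ hζ hσ hX, smul_smul, h0, smul_sub]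
        have h4 : ∀ j : ℕ, ((ad ℂ L X - (ζ * μ) • (1 : End ℂ L)) ^ j) (σ v) =
            ζ ^ j • σ (((ad ℂ L X - μ • (1 : End ℂ L)) ^ j) v) := by
          intro j
          induction j with
          | zero => simp
          | succ j ih => 
            rw [pow_succ' (ad ℂ L X - (ζ * μ) • (1 : End ℂ L)), End.mul_apply, ih, map_smul, h3,
              smul_smul, pow_succ' (ad ℂ L X - μ • (1 : End ℂ L)), End.mul_apply, pow_succ]
        rw [h4, hk, map_zero, smul_zero]
      rw [End.mem_eigenspace_iff, ← hz, ad_apply] at hv h2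
      rw [hv, h2, map_smul, smul_smul, inv_mul_cancel_left₀ h0]
    | zero => simp
    | add v w _ _ h1 h2 => rw [lie_add, map_add, h1, h2, map_add, lie_add, smul_add]
  have hρ0 : (rhoCheck b : L) ∈ deg b 0 := cartan_le_deg b (rhoCheck b).2
  have hσρ : σ (rhoCheck b : L) = (rhoCheck b : L) := by simpa using hσ 0 _ hρ0
  -- As σ fixes ρ, the bracket [z, ρ] is in the ζ⁻¹-eigenspace, so equals u + w with degrees -1 and
  -- ht θ. Dividing by the degrees gives z' with [ρ, z'] = [ρ, z].
  have hzd : ∃ z' ∈ deg b (-1) ⊔ deg b (b.height θ), z - z' ∈ deg b 0 := by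
    have h1 : ⁅z, (rhoCheck b : L)⁆ ∈ deg b (-1) ⊔ deg b (b.height θ) := by
      refine eigenspace_twist_neg_one hθ hζ hσ (End.mem_eigenspace_iff.2 ?_)
      rw [hσs, hσρ]
    obtain ⟨u, hu, w, hw, huw⟩ := Submodule.mem_sup.1 h1
    refine ⟨u - (b.height θ : ℂ)⁻¹ • w, sub_mem (Submodule.mem_sup_left hu)
      (Submodule.mem_sup_right (Submodule.smul_mem _ _ hw)), ?_⟩
    rw [mem_deg, lie_sub, lie_sub, lie_smul, mem_deg.1 hu, mem_deg.1 hw, ← lie_skew, ← huw,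
      smul_smul, inv_mul_cancel₀ (by exact_mod_cast hpos.ne')]
    push_cast
    module
  obtain ⟨z', hz', hzz⟩ := hzd
  have hXz : ⁅X, z⁆ = 0 := by
    rw [← lie_skew, hker X (lie_self X), neg_zero]
  -- The brackets of X with z' and with z - z' are opposite, yet σ scales them by ζ⁻² and ζ⁻¹. As ζ
  -- ≠ 1 both vanish, and the degree -1 part [N, z - z'] = 0 gives z = z'.
  have hz0 : z - z' = 0 := by
    have hσz' : σ z' = ζ⁻¹ • z' := by
      obtain ⟨u, hu, w, hw, rfl⟩ := Submodule.mem_sup.1 hz'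
      have h3 : ζ ^ (b.height θ) = ζ ^ (-1 : ℤ) := (primitiveRoot_zpow_eq hθ hζ).2 ⟨1, by ring⟩
      rw [map_add, hσ _ u hu, hσ _ w hw, h3, zpow_neg_one, smul_add]
    have h1 : σ ⁅X, z'⁆ = (ζ⁻¹ * ζ⁻¹) • ⁅X, z'⁆ := by
      rw [twist_lie hθ hζ hσ hX, hσz', lie_smul, smul_smul]
    have h2 : σ ⁅X, z - z'⁆ = ζ⁻¹ • ⁅X, z - z'⁆ := by
      rw [twist_lie hθ hζ hσ hX, hσ 0 _ hzz, zpow_zero, one_smul]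
    have h3 : ⁅X, z'⁆ = - ⁅X, z - z'⁆ := by rw [lie_sub, hXz]; abel
    rw [h3, map_neg, h2, smul_neg, neg_inj, ← sub_eq_zero, ← sub_smul, smul_eq_zero] at h1
    have h4 : ⁅X, z - z'⁆ = 0 := by
      refine h1.resolve_left fun h => ?_
      have h5 : ζ = 1 := by field_simp at h; linear_combination h
      have := hζ.eq_orderOf
      rw [h5, orderOf_one] at this
      omega
    rw [hXdef, add_lie] at h4
    have h5 := lie_mem_deg hN.mem hzz (add_zero _)
    have h6 := lie_mem_deg hEd hzz (add_zero _)
    rw [← eq_neg_iff_add_eq_zero] at h4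
    have h7 : ⁅∑ i, x i, z - z'⁆ = 0 := Submodule.disjoint_def.1
      (deg_disjoint_filt b (show (-1 : ℤ) < b.height θ by omega)) _ h5
      (h4 ▸ neg_mem (deg_le_filt b le_rfl h6))
    exact hN.inj 0 le_rfl _ hzz h7
  rw [sub_eq_zero.1 hz0] at hz hker
  obtain ⟨c, hzc⟩ := hline z' hz' (hker y hXy)
  have hs' : s = c • ad ℂ L X := by rw [← hz, hzc, map_smul]
  have hn' : n = (1 - c) • ad ℂ L X := by
    rw [sub_smul, one_smul, ← hs', hns]; abel
  by_cases hc1 : c = 1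
  · rw [hc1, one_smul] at hs'
    rwa [← hs']
  · exfalso
    apply hκ
    refine killingForm_eq_zero_of_commute ?_ hXy
    have : ad ℂ L X = (1 - c)⁻¹ • n := by
      rw [hn', smul_smul, inv_mul_cancel₀ (sub_ne_zero.2 (Ne.symm hc1)), one_smul]
    rw [this]
    exact hn.smul _

theorem cyclic_isRegularSemisimple
    (hx : ∀ i : b.support, x i ∈ rootSpace H (-(i.1.1 : H → ℂ)) ∧ x i ≠ 0)
    (hθ : IsMaximalRoot b θ) (hE : E ∈ rootSpace H (θ.1 : H → ℂ) ∧ E ≠ 0)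
    (hlow : ∀ x : L, finrank ℂ H ≤ finrank ℂ (LinearMap.ker (ad ℂ L x))) :
    IsRegularSemisimple H (∑ i, x i + E) := by
  refine ⟨cyclic_isSemisimple hx hθ hE, le_antisymm ?_ (hlow _)⟩
  refine finrank_ker_ad_le (isPrincipalNegative_sum hx) ?_
  rw [add_sub_cancel_left]
  exact deg_le_filt b hθ.height_pos.le (rootSpace_le_deg b θ hE.1)

/-- ad X maps the ζ^j-eigenspace of σ in its image injectively to the ζ^{j-1}-eigenspace. These m
spaces form a cycle, so their dimensions agree. The one for j = 0 lies in H and the one for j = -1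
contains a copy of H, so the common dimension is r; the image has dimension dim L - r, the number of
roots. -/
theorem card_root_eq
    (hx : ∀ i : b.support, x i ∈ rootSpace H (-(i.1.1 : H → ℂ)) ∧ x i ≠ 0)
    (hθ : IsMaximalRoot b θ) (hE : E ∈ rootSpace H (θ.1 : H → ℂ) ∧ E ≠ 0)
    (hlow : ∀ x : L, finrank ℂ H ≤ finrank ℂ (LinearMap.ker (ad ℂ L x))) :
    H.root.card = (b.height θ + 1).toNat * finrank ℂ H := by
  have hpos := hθ.height_pos
  obtain ⟨ζ, σ, hζ, hσ⟩ := exists_coxeter_twist hθ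
  have h0 : ζ ≠ 0 := hζ.ne_zero (by omega)
  have hN := isPrincipalNegative_sum hx
  have hEd : E ∈ deg b (b.height θ) := rootSpace_le_deg b θ hE.1
  obtain ⟨hss, hker⟩ := cyclic_isRegularSemisimple hx hθ hE hlow
  set X := ∑ i, x i + E with hXdef
  have hX : X ∈ deg b (-1) ⊔ deg b (b.height θ) := add_mem
    (Submodule.mem_sup_left hN.mem) (Submodule.mem_sup_right hEd)
  set m := (b.height θ + 1).toNat with hm
  let J : ℤ → Submodule ℂ L := fun j => LinearMap.range (ad ℂ L X) ⊓ End.eigenspace σ (ζ ^ j)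
  -- For a semisimple operator the kernel of the square is the kernel.
  have hinj : ∀ v ∈ LinearMap.range (ad ℂ L X), ⁅X, v⁆ = 0 → v = 0 := by
    rintro _ ⟨w, rfl⟩ hv
    have h1 : w ∈ (ad ℂ L X).maxGenEigenspace 0 := by
      rw [End.mem_maxGenEigenspace]
      exact ⟨2, by simpa [pow_two] using hv⟩
    rw [hss.isFinitelySemisimple.maxGenEigenspace_eq_eigenspace, End.mem_eigenspace_iff] at h1
    simpa using h1
  have hmaps : ∀ j, ∀ v ∈ End.eigenspace σ (ζ ^ j), ⁅X, v⁆ ∈ J (j - 1) := by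
    intro j v hv
    refine ⟨⟨v, rfl⟩, ?_⟩
    rw [SetLike.mem_coe, End.mem_eigenspace_iff] at *
    rw [twist_lie hθ hζ hσ hX, hv, lie_smul, smul_smul, zpow_sub_one₀ h0, mul_comm]
  have hstep : ∀ j, finrank ℂ (J j) ≤ finrank ℂ (J (j - 1)) := by
    intro j
    let f : J j →ₗ[ℂ] J (j - 1) := (ad ℂ L X).restrict fun v hv => hmaps j v hv.2
    refine LinearMap.finrank_le_finrank_of_injective (f := f) ?_
    rw [← LinearMap.ker_eq_bot, LinearMap.ker_eq_bot']
    intro v hv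
    exact Subtype.ext (hinj v v.2.1 (congrArg Subtype.val hv))
  have hJ0 : finrank ℂ (J 0) ≤ finrank ℂ H := by
    have : J 0 ≤ H.toSubmodule := by
      rw [← deg_zero b]
      refine inf_le_right.trans ?_
      rw [zpow_zero]
      exact eigenspace_twist_one hθ hζ hσ
    exact Submodule.finrank_mono this
  have hJ1 : finrank ℂ H ≤ finrank ℂ (J (-1)) := by
    let f : H.toSubmodule →ₗ[ℂ] J (-1) := (ad ℂ L X).restrict fun v hv => by
      have := hmaps 0 v (by
        rw [← deg_zero b] at hv
        rw [End.mem_eigenspace_iff, hσ 0 v hv])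
      rwa [zero_sub] at this
    refine LinearMap.finrank_le_finrank_of_injective (f := f) ?_
    rw [← LinearMap.ker_eq_bot, LinearMap.ker_eq_bot']
    intro v hv
    have hv0 : (v : L) ∈ deg b 0 := by rw [deg_zero]; exact v.2
    have h4 : ⁅X, (v : L)⁆ = 0 := congrArg Subtype.val hv
    rw [hXdef, add_lie] at h4
    have h5 := lie_mem_deg hN.mem hv0 (add_zero _)
    have h6 := lie_mem_deg hEd hv0 (add_zero _)
    rw [← eq_neg_iff_add_eq_zero] at h4
    have h7 : ⁅∑ i, x i, (v : L)⁆ = 0 := Submodule.disjoint_def.1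
      (deg_disjoint_filt b (show (-1 : ℤ) < b.height θ by omega)) _ h5
      (h4 ▸ neg_mem (deg_le_filt b le_rfl h6))
    exact Subtype.ext (hN.inj 0 le_rfl _ hv0 h7)
  have hper : ∀ j, J (j - m) = J j := by
    intro j
    have : ζ ^ (j - (m : ℤ)) = ζ ^ j := (primitiveRoot_zpow_eq hθ hζ).2 ⟨-1, by
      rw [hm, Int.toNat_of_nonneg (by omega)]; ring⟩
    simp only [J, this]
  let g : ℤ → ℕ := fun j => finrank ℂ (J j)
  have hmono : Monotone fun k : ℕ => g (-k) := by
    refine monotone_nat_of_le_succ fun k => (hstep (-k)).trans (le_of_eq (congrArg g ?_))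
    push_cast
    ring
  -- Monotone along the cycle and periodic: dim J(0) ≤ r ≤ dim J(-1), while J(-m) = J(0).
  have hconst : ∀ k : ℕ, k < m → finrank ℂ (J (-k)) = finrank ℂ H := by
    intro k hk
    have hm0 : g (-(0 : ℕ)) ≤ g (-k) := hmono (show 0 ≤ k by omega)
    have h1m : g (-(1 : ℕ)) ≤ g (-m) := hmono (show 1 ≤ m by omega)
    have hkm : g (-k) ≤ g (-m) := hmono (show k ≤ m by omega)
    have hp : g (-m) = g 0 := congrArg (fun S : Submodule ℂ L => finrank ℂ S)
      ((congrArg J (zero_sub (m : ℤ))).symm.trans (hper 0))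
    have e0 : g (-(0 : ℕ)) = g 0 := congrArg g (by simp)
    have e1 : g (-(1 : ℕ)) = g (-1) := congrArg g (by simp)
    change g (-k) = _
    change g 0 ≤ _ at hJ0
    change _ ≤ g (-1) at hJ1
    omega
  have hrange : finrank ℂ (LinearMap.range (ad ℂ L X)) = m * finrank ℂ H := by
    let D : Fin m → Submodule ℂ (LinearMap.range (ad ℂ L X)) := fun k =>
      (J (-(k : ℕ))).comap (LinearMap.range (ad ℂ L X)).subtype
    have hDfin : ∀ k, finrank ℂ (D k) = finrank ℂ H := by
      intro k
      rw [← hconst k k.2]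
      exact (Submodule.comapSubtypeEquivOfLe inf_le_left).finrank_eq
    have hDind : iSupIndep D := by
      have h1 : iSupIndep fun k : Fin m => End.eigenspace σ (ζ ^ (-((k : ℕ) : ℤ))) := by
        refine (End.eigenspaces_iSupIndep σ).comp (f := fun k : Fin m => ζ ^ (-((k : ℕ) : ℤ))) ?_
        intro k l hkl
        have := (primitiveRoot_zpow_eq hθ hζ).1 hkl
        obtain ⟨q, hq⟩ := this
        have hk := k.2
        have hl := l.2
        have hm' : (m : ℤ) = b.height θ + 1 := by rw [hm, Int.toNat_of_nonneg (by omega)]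
        rw [← hm'] at hq
        have : q = 0 := by
          have : -1 < q := by nlinarith
          have : q < 1 := by nlinarith
          omega
        subst this
        exact Fin.ext (by omega)
      rw [iSupIndep_def] at h1 ⊢
      intro k
      rw [Submodule.disjoint_def]
      intro v hv hv'
      have h2 := Submodule.disjoint_def.1 (h1 k) v hv.2 ?_
      · exact Subtype.ext h2
      · have h3 : (⨆ j, ⨆ (_ : j ≠ k), D j) ≤
            (⨆ j, ⨆ (_ : j ≠ k), End.eigenspace σ (ζ ^ (-((j : ℕ) : ℤ)))).comap
              (LinearMap.range (ad ℂ L X)).subtype :=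
          iSup₂_le fun j hj w hw => Submodule.mem_iSup_of_mem j (Submodule.mem_iSup_of_mem hj hw.2)
        exact h3 hv'
    have hDtop : ⨆ k, D k = ⊤ := by
      rw [eq_top_iff]
      rintro ⟨_, w, rfl⟩ -
      have hw : w ∈ ⨆ k, deg b k := iSup_deg b ▸ trivial
      induction hw using Submodule.iSup_induction' with
      | mem k w hw =>
        have hm' : (m : ℤ) = b.height θ + 1 := by rw [hm, Int.toNat_of_nonneg (by omega)]
        have h1 := hmaps k w (by rw [End.mem_eigenspace_iff, hσ k w hw])
        let l := ((1 - k) % (m : ℤ)).toNat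
        have hl : (l : ℤ) = (1 - k) % (m : ℤ) := Int.toNat_of_nonneg (Int.emod_nonneg _ (by omega))
        have hl2 : l < m := by
          have := Int.emod_lt_of_pos (1 - k) (show (0 : ℤ) < m by omega)
          omega
        refine Submodule.mem_iSup_of_mem ⟨l, hl2⟩ ?_
        have h2 : ζ ^ (k - 1) = ζ ^ (-(l : ℤ)) := by
          rw [primitiveRoot_zpow_eq hθ hζ, hl, ← hm']
          have := Int.emod_add_mul_ediv (1 - k) m
          exact ⟨-((1 - k) / m), by linear_combination this⟩
        have h3 : J (k - 1) = J (-(l : ℤ)) := by simp only [J, h2]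
        rw [h3] at h1
        exact h1
      | zero =>
        convert zero_mem (⨆ k, D k) using 1
        ext
        simp
      | add v w _ _ h1 h2 =>
        have := add_mem h1 h2
        convert this using 1
        ext
        simp
    rw [finrank_eq_sum_of_iSupIndep hDind hDtop, Finset.sum_congr rfl fun k _ => hDfin k,
      Finset.sum_const, Finset.card_univ, Fintype.card_fin, smul_eq_mul]
  have h1 := LinearMap.finrank_range_add_finrank_ker (ad ℂ L X)
  have : Nontrivial L := ⟨E, 0, hE.2⟩
  have h2 := finrank_eq_finrank_cartan_add_card H
  omega

theorem coxeterNumber_eq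
    (hx : ∀ i : b.support, x i ∈ rootSpace H (-(i.1.1 : H → ℂ)) ∧ x i ≠ 0)
    (hθ : IsMaximalRoot b θ) (hE : E ∈ rootSpace H (θ.1 : H → ℂ) ∧ E ≠ 0)
    (hlow : ∀ x : L, finrank ℂ H ≤ finrank ℂ (LinearMap.ker (ad ℂ L x))) :
    (coxeterNumber H : ℤ) = b.height θ + 1 := by
  have hpos := hθ.height_pos
  have h1 : 0 < finrank ℂ H := by
    rw [finrank_pos_iff_exists_ne_zero]
    exact ⟨_, rhoCheck_ne_zero b⟩
  rw [coxeterNumber, card_root_eq hx hθ hE hlow, Nat.mul_div_cancel _ h1,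
    Int.toNat_of_nonneg (by omega)]

end CyclicElement
end OperConn

namespace OperConn

/-! ### Exponentials and Lie algebras of closed subgroups. -/

section GroupLie

open scoped Matrix.Norms.Operator
open NormedSpace (exp)

variable {n : ℕ}

/-- The matrix exponential, as an element of `GL_n(ℂ)`. -/
noncomputable def expGL (X : Matrix (Fin n) (Fin n) ℂ) : GL (Fin n) ℂ where
  val := exp X
  inv := exp (-X)
  val_inv := by
    rw [← Matrix.exp_add_of_commute _ _ (Commute.neg_right (Commute.refl X)), add_neg_cancel,
      NormedSpace.exp_zero]
  inv_val := by
    rw [← Matrix.exp_add_of_commute _ _ (Commute.neg_left (Commute.refl X)), neg_add_cancel,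
      NormedSpace.exp_zero]

theorem coe_expGL (X : Matrix (Fin n) (Fin n) ℂ) : (expGL X).1 = exp X := rfl

theorem inv_expGL (X : Matrix (Fin n) (Fin n) ℂ) : (expGL X)⁻¹ = expGL (-X) := by
  ext1; rfl

theorem expGL_zero : expGL (0 : Matrix (Fin n) (Fin n) ℂ) = 1 := by
  ext1; exact NormedSpace.exp_zero

theorem expGL_add_of_commute {X Y : Matrix (Fin n) (Fin n) ℂ} (h : Commute X Y) :
    expGL (X + Y) = expGL X * expGL Y := by
  ext1; exact Matrix.exp_add_of_commute _ _ h

theorem expGL_conj (g : GL (Fin n) ℂ) (X : Matrix (Fin n) (Fin n) ℂ) :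
    expGL (g.1 * X * g⁻¹.1) = g * expGL X * g⁻¹ := by
  ext1; exact Matrix.exp_units_conj g X

theorem mem_idealOf {K : Subgroup (GL (Fin n) ℂ)} {f : MvPolynomial (Fin n × Fin n) ℂ} :
    f ∈ idealOf K ↔ ∀ g ∈ K, MvPolynomial.aeval (coords g) f = 0 := by
  simp [idealOf, MvPolynomial.mem_vanishingIdeal_iff]

/-- A Zariski closed subgroup consists of the common zeros of its ideal. -/
theorem mem_iff_idealOf {K : Subgroup (GL (Fin n) ℂ)}
    (hK : IsZariskiClosed (K : Set (GL (Fin n) ℂ))) {g : GL (Fin n) ℂ} :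
    g ∈ K ↔ ∀ f ∈ idealOf K, MvPolynomial.aeval (coords g) f = 0 := by
  refine ⟨fun hg f hf => mem_idealOf.1 hf g hg, fun h => ?_⟩
  obtain ⟨S, hS⟩ := hK
  have : g ∈ (K : Set (GL (Fin n) ℂ)) := by
    rw [hS]
    refine fun f hf => h f (mem_idealOf.2 fun k hk => ?_)
    have hk' : k ∈ (K : Set (GL (Fin n) ℂ)) := hk
    rw [hS] at hk'
    exact hk' f hf
  exact this

/-- If `M' = M X` then `(f ∘ M)' = (L_X f) ∘ M`. -/
theorem hasDerivAt_aeval {M : ℂ → Matrix (Fin n) (Fin n) ℂ} {X : Matrix (Fin n) (Fin n) ℂ} {t : ℂ}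
    (hM : ∀ i j, HasDerivAt (fun s => M s i j) ((M t * X) i j) t)
    (f : MvPolynomial (Fin n × Fin n) ℂ) :
    HasDerivAt (fun s => MvPolynomial.aeval (fun p : Fin n × Fin n => M s p.1 p.2) f)
      (MvPolynomial.aeval (fun p : Fin n × Fin n => M t p.1 p.2) (leftInvDerivation X f)) t := by
  induction f using MvPolynomial.induction_on with
  | C a =>
    have h0 : leftInvDerivation X (MvPolynomial.C a) = 0 := MvPolynomial.derivation_C _ _
    simpa [h0] using hasDerivAt_const t a
  | add p q hp hq =>
    simp only [map_add]
    exact hp.add hq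
  | mul_X p i hp =>
    have h := hp.mul (hM i.1 i.2)
    rw [Derivation.leibniz, leftInvDerivation_X]
    simp only [map_mul, MvPolynomial.aeval_X]
    refine h.congr_deriv ?_
    simp only [smul_eq_mul, map_add, map_mul, MvPolynomial.aeval_X, map_sum, MvPolynomial.aeval_C,
      Matrix.mul_apply, Algebra.algebraMap_self, RingHom.id_apply]
    ring

theorem hasDerivAt_entry_mul_exp (g X : Matrix (Fin n) (Fin n) ℂ) (t : ℂ) (i j : Fin n) :
    HasDerivAt (fun s : ℂ => (g * exp (s • X)) i j) ((g * exp (t • X) * X) i j) t := by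
  have h := (hasDerivAt_exp_smul_const (𝕂 := ℂ) X t).const_mul g
  rw [← mul_assoc] at h
  exact hasDerivAt_pi.1 (hasDerivAt_pi.1 h i) j

theorem iteratedDeriv_aeval_mul_exp (g X : Matrix (Fin n) (Fin n) ℂ)
    (f : MvPolynomial (Fin n × Fin n) ℂ) (k : ℕ) :
    iteratedDeriv k
        (fun s : ℂ => MvPolynomial.aeval (fun p : Fin n × Fin n => (g * exp (s • X)) p.1 p.2) f) =
      fun s : ℂ => MvPolynomial.aeval (fun p : Fin n × Fin n => (g * exp (s • X)) p.1 p.2)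
        ((leftInvDerivation X)^[k] f) := by
  induction k with
  | zero => simp
  | succ k ih =>
    rw [iteratedDeriv_succ, ih, Function.iterate_succ_apply']
    funext s
    exact (hasDerivAt_aeval (hasDerivAt_entry_mul_exp g X s) _).deriv

/-- One-parameter subgroups with direction in the Lie algebra stay in the group. -/
theorem expGL_mem {K : Subgroup (GL (Fin n) ℂ)} (hK : IsZariskiClosed (K : Set (GL (Fin n) ℂ)))
    {X : Matrix (Fin n) (Fin n) ℂ} (hX : X ∈ lieAlg K) : expGL X ∈ K := by
  rw [mem_iff_idealOf hK]
  intro f hf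
  set φ : ℂ → ℂ := fun s =>
    MvPolynomial.aeval (fun p : Fin n × Fin n => ((1 : Matrix (Fin n) (Fin n) ℂ) * exp (s • X)) p.1 p.2) f
    with hφ
  have hd : Differentiable ℂ φ := fun s =>
    (hasDerivAt_aeval (hasDerivAt_entry_mul_exp 1 X s) f).differentiableAt
  have hk : ∀ k, (leftInvDerivation X)^[k] f ∈ idealOf K := by
    intro k
    induction k with
    | zero => exact hf
    | succ k ih => rw [Function.iterate_succ_apply']; exact hX _ ih
  -- The Taylor coefficients of f(exp sX) are values at 1 of iterated invariant derivatives of f,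
  -- which stay in the ideal. An entire function with zero Taylor series vanishes, in particular at
  -- s = 1.
  have h0 : ∀ k, iteratedDeriv k φ 0 = 0 := by
    intro k
    rw [hφ, iteratedDeriv_aeval_mul_exp]
    have h1 : (fun p : Fin n × Fin n => ((1 : Matrix (Fin n) (Fin n) ℂ) * exp ((0 : ℂ) • X)) p.1 p.2)
        = coords (1 : GL (Fin n) ℂ) := by
      simp only [zero_smul, NormedSpace.exp_zero, mul_one]
      rfl
    simp only [h1]
    exact mem_idealOf.1 (hk k) 1 K.one_mem
  have h1 := Complex.taylorSeries_eq_of_entire' 0 1 hd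
  simp only [h0, mul_zero, zero_mul, tsum_zero] at h1
  have h2 : coords (expGL X) =
      fun p : Fin n × Fin n => ((1 : Matrix (Fin n) (Fin n) ℂ) * exp ((1 : ℂ) • X)) p.1 p.2 := by
    simp only [one_smul, one_mul]
    rfl
  rw [h2]
  exact h1.symm

theorem mem_lieAlg_of_forall_expGL_mem {K : Subgroup (GL (Fin n) ℂ)}
    {X : Matrix (Fin n) (Fin n) ℂ} (h : ∀ t : ℂ, expGL (t • X) ∈ K) : X ∈ lieAlg K := by
  intro f hf
  rw [mem_idealOf]
  intro g hg
  have h1 := hasDerivAt_aeval (hasDerivAt_entry_mul_exp g.1 X 0) f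
  have h2 : (fun s : ℂ => MvPolynomial.aeval
      (fun p : Fin n × Fin n => (g.1 * exp (s • X)) p.1 p.2) f) = fun _ => 0 := by
    funext s
    exact mem_idealOf.1 hf (g * expGL (s • X)) (K.mul_mem hg (h s))
  rw [h2] at h1
  have h3 : coords g = fun p : Fin n × Fin n => (g.1 * exp ((0 : ℂ) • X)) p.1 p.2 := by
    simp only [zero_smul, NormedSpace.exp_zero, mul_one]
    rfl
  rw [h3]
  exact h1.unique (hasDerivAt_const 0 0)

theorem mem_lieAlg_iff {K : Subgroup (GL (Fin n) ℂ)} (hK : IsZariskiClosed (K : Set (GL (Fin n) ℂ)))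
    {X : Matrix (Fin n) (Fin n) ℂ} : X ∈ lieAlg K ↔ ∀ t : ℂ, expGL (t • X) ∈ K :=
  ⟨fun hX t => expGL_mem hK ((lieAlg K).smul_mem t hX), mem_lieAlg_of_forall_expGL_mem⟩

theorem conj_mem_lieAlg {K : Subgroup (GL (Fin n) ℂ)}
    (hK : IsZariskiClosed (K : Set (GL (Fin n) ℂ))) {g : GL (Fin n) ℂ} (hg : g ∈ K)
    {X : Matrix (Fin n) (Fin n) ℂ} (hX : X ∈ lieAlg K) : g.1 * X * g⁻¹.1 ∈ lieAlg K := by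
  rw [mem_lieAlg_iff hK] at hX ⊢
  intro t
  have : t • (g.1 * X * g⁻¹.1) = g.1 * (t • X) * g⁻¹.1 := by simp
  rw [this, expGL_conj]
  exact K.mul_mem (K.mul_mem hg (hX t)) (K.inv_mem hg)

theorem IsZariskiClosed.inter {Z Z' : Set (GL (Fin n) ℂ)} (h : IsZariskiClosed Z)
    (h' : IsZariskiClosed Z') : IsZariskiClosed (Z ∩ Z') := by
  obtain ⟨S, rfl⟩ := h
  obtain ⟨S', rfl⟩ := h'
  refine ⟨S ∪ S', ?_⟩
  ext g
  simp only [Set.mem_inter_iff, Set.mem_ofPred_eq, Set.mem_union]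
  exact ⟨fun h f hf => hf.elim (h.1 f) (h.2 f), fun h => ⟨fun f hf => h f (.inl hf),
    fun f hf => h f (.inr hf)⟩⟩

theorem isZariskiClosed_commute (A : Set (Matrix (Fin n) (Fin n) ℂ)) :
    IsZariskiClosed {g : GL (Fin n) ℂ | ∀ M ∈ A, g.1 * M = M * g.1} := by
  refine ⟨{f | ∃ M ∈ A, ∃ i j, f = ∑ k, (MvPolynomial.X (i, k) * MvPolynomial.C (M k j) -
    MvPolynomial.C (M i k) * MvPolynomial.X (k, j))}, ?_⟩
  have key : ∀ (g : GL (Fin n) ℂ) (M : Matrix (Fin n) (Fin n) ℂ) (i j : Fin n),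
      MvPolynomial.aeval (coords g) (∑ k, (MvPolynomial.X (i, k) * MvPolynomial.C (M k j) -
        MvPolynomial.C (M i k) * MvPolynomial.X (k, j))) = (g.1 * M) i j - (M * g.1) i j := by
    intro g M i j
    simp [coords, Matrix.mul_apply, Finset.sum_sub_distrib]
  ext g
  constructor
  · rintro h f ⟨M, hM, i, j, rfl⟩
    rw [key, h M hM, sub_self]
  · intro h M hM
    ext i j
    have := h _ ⟨M, hM, i, j, rfl⟩
    rwa [key, sub_eq_zero] at this

theorem commute_of_forall_commute_exp {X M : Matrix (Fin n) (Fin n) ℂ}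
    (h : ∀ t : ℂ, exp (t • X) * M = M * exp (t • X)) : X * M = M * X := by
  have h1 := (hasDerivAt_exp_smul_const (𝕂 := ℂ) X 0).mul_const M
  have h2 := (hasDerivAt_exp_smul_const (𝕂 := ℂ) X 0).const_mul M
  have h3 : (fun t : ℂ => exp (t • X) * M) = fun t : ℂ => M * exp (t • X) := funext h
  change HasDerivAt (fun t : ℂ => exp (t • X) * M) _ _ at h1
  rw [h3] at h1
  simpa using h1.unique h2

theorem isZariskiClosed_centralizer (M : GL (Fin n) ℂ) :
    IsZariskiClosed (Subgroup.centralizer {M} : Set (GL (Fin n) ℂ)) := by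
  convert isZariskiClosed_commute {M.1} using 1
  ext g
  simp only [SetLike.mem_coe, Subgroup.mem_centralizer_singleton_iff, Set.mem_ofPred_eq,
    Set.mem_singleton_iff, forall_eq]
  rw [Units.ext_iff]
  rfl

/-- A one-parameter group commutes with M exactly when its generator does, by differentiation in one
direction and exponentiation in the other. -/
theorem mem_lieAlg_inf_centralizer {G : Subgroup (GL (Fin n) ℂ)}
    (hG : IsZariskiClosed (G : Set (GL (Fin n) ℂ))) {M : GL (Fin n) ℂ}
    {X : Matrix (Fin n) (Fin n) ℂ} :
    X ∈ lieAlg (G ⊓ Subgroup.centralizer {M}) ↔ X ∈ lieAlg G ∧ X * M.1 = M.1 * X := by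
  have hc : IsZariskiClosed ((G ⊓ Subgroup.centralizer {M} : Subgroup _) : Set (GL (Fin n) ℂ)) := by
    rw [Subgroup.coe_inf]
    exact hG.inter (isZariskiClosed_centralizer M)
  rw [mem_lieAlg_iff hc, mem_lieAlg_iff hG]
  simp only [Subgroup.mem_inf, Subgroup.mem_centralizer_singleton_iff]
  constructor
  · exact fun h => ⟨fun t => (h t).1, commute_of_forall_commute_exp fun t => by
      simpa [Units.ext_iff, coe_expGL] using (h t).2⟩
  · refine fun h => fun t => ⟨h.1 t, ?_⟩
    have hcm : Commute M.1 (t • X) := Commute.smul_right (Eq.symm h.2) t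
    ext1
    exact hcm.exp_right.symm

theorem lieAlg_lie_coe {K : Subgroup (GL (Fin n) ℂ)} (X Y : lieAlg K) :
    (⁅X, Y⁆ : lieAlg K).1 = X.1 * Y.1 - Y.1 * X.1 := by
  rw [LieSubalgebra.coe_bracket, Ring.lie_def]

end GroupLie

end OperConn

namespace OperConn

/-! ### The adjoint action. -/

section Adjoint

open LieAlgebra LieAlgebra.IsKilling Module

variable {n : ℕ} {K : Subgroup (GL (Fin n) ℂ)}

/-- The adjoint action of an element of `K` on the Lie algebra of `K`. -/
noncomputable def adjointAction (hK : IsZariskiClosed (K : Set (GL (Fin n) ℂ))) (g : K) :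
    lieAlg K ≃ₗ⁅ℂ⁆ lieAlg K where
  toFun X := ⟨g.1.1 * X.1 * g.1⁻¹.1, conj_mem_lieAlg hK g.2 X.2⟩
  invFun X := ⟨g.1⁻¹.1 * X.1 * g.1⁻¹⁻¹.1, conj_mem_lieAlg hK (K.inv_mem g.2) X.2⟩
  map_add' X Y := by
    ext1
    simp [mul_add, add_mul]
  map_smul' c X := by
    ext1
    simp
  map_lie' {X Y} := by
    ext1
    have h : ∀ A B : Matrix (Fin n) (Fin n) ℂ, (g.1.1 * A * g.1⁻¹.1) * (g.1.1 * B * g.1⁻¹.1) =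
        g.1.1 * (A * B) * g.1⁻¹.1 := by
      intro A B
      have := g.1.inv_mul
      calc _ = g.1.1 * A * (g.1⁻¹.1 * g.1.1) * B * g.1⁻¹.1 := by simp only [mul_assoc]
        _ = _ := by rw [this]; simp only [mul_assoc, one_mul]
    simp only [lieAlg_lie_coe, h]
    simp only [mul_sub, sub_mul]
  left_inv X := by
    ext1
    have h1 := g.1.inv_mul
    have h2 := g.1.mul_inv
    simp only [inv_inv]
    calc g.1⁻¹.1 * (g.1.1 * X.1 * g.1⁻¹.1) * g.1.1
        = (g.1⁻¹.1 * g.1.1) * X.1 * (g.1⁻¹.1 * g.1.1) := by simp only [mul_assoc]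
      _ = X.1 := by rw [h1, one_mul, mul_one]
  right_inv X := by
    ext1
    have h1 := g.1.inv_mul
    have h2 := g.1.mul_inv
    simp only [inv_inv]
    calc g.1.1 * (g.1⁻¹.1 * X.1 * g.1.1) * g.1⁻¹.1
        = (g.1.1 * g.1⁻¹.1) * X.1 * (g.1.1 * g.1⁻¹.1) := by simp only [mul_assoc]
      _ = X.1 := by rw [h2, one_mul, mul_one]

end Adjoint

/-! ### Centralizers have dimension at least the rank. -/

section MinimalNullity

open LieAlgebra LieAlgebra.IsKilling Module

/-- If a linear family `A + s B` has rank at most `m` near `s = 0` then so does `A + B`. -/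
theorem finrank_range_add_le {V : Type*} [AddCommGroup V] [Module ℂ V] [FiniteDimensional ℂ V]
    (A B : V →ₗ[ℂ] V) (m : ℕ)
    (h : ∀ᶠ s : ℂ in nhds 0, finrank ℂ (LinearMap.range (A + s • B)) ≤ m) :
    finrank ℂ (LinearMap.range (A + B)) ≤ m := by
  by_contra! hlt
  set R := LinearMap.range (A + B)
  obtain ⟨P, hP⟩ := (A + B).rangeRestrict.exists_rightInverse_of_surjective
    (LinearMap.range_rangeRestrict _)
  obtain ⟨Q, hQ⟩ := Submodule.exists_isCompl R
  let q : V →ₗ[ℂ] R := R.projectionOnto Q hQ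
  have hq : ∀ r : R, q r = r := fun r => Submodule.projectionOnto_apply_left hQ r
  let bR := finBasis ℂ R
  let a := LinearMap.toMatrix bR bR (q ∘ₗ A ∘ₗ P)
  let c := LinearMap.toMatrix bR bR (q ∘ₗ B ∘ₗ P)
  have hdet : ∀ s : ℂ, Matrix.det (a + s • c) =
      LinearMap.det (q ∘ₗ (A + s • B) ∘ₗ P) := by
    intro s
    rw [← LinearMap.det_toMatrix bR]
    congr 1
    simp only [a, c, ← map_smul, ← map_add]
    congr 1
    ext v
    simp
  -- The determinant of A + sB compressed to R, the image of A + B, is a polynomial in s with value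
  -- 1 at s = 1. If dim R > m, it vanishes for all small s, hence identically.
  let p : Polynomial ℂ := Matrix.det (a.map Polynomial.C + (Polynomial.X : Polynomial ℂ) • c.map Polynomial.C)
  have hp : ∀ s, p.eval s = Matrix.det (a + s • c) := by
    intro s
    simp only [p]
    rw [← Polynomial.coe_evalRingHom, RingHom.map_det]
    congr 1
    ext i j
    simp
    exact mul_comm _ _
  have hz : p = 0 := by
    apply Polynomial.eq_zero_of_infinite_isRoot
    refine Set.Infinite.mono ?_ (infinite_of_mem_nhds (0 : ℂ) h)
    intro s hs
    have hs' : finrank ℂ (LinearMap.range (A + s • B)) ≤ m := hs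
    change p.eval s = 0
    rw [hp, hdet s]
    by_contra hne
    have hu : LinearMap.range (q ∘ₗ (A + s • B) ∘ₗ P) = ⊤ := by
      have := LinearMap.isUnit_iff_range_eq_top (q ∘ₗ (A + s • B) ∘ₗ P)
      exact this.1 ((LinearMap.isUnit_iff_isUnit_det _).2 (isUnit_iff_ne_zero.2 hne))
    have h1 : finrank ℂ R ≤ finrank ℂ (LinearMap.range (A + s • B)) := by
      rw [← finrank_top ℂ R, ← hu, LinearMap.range_comp]
      refine (Submodule.finrank_map_le _ _).trans ?_
      exact Submodule.finrank_mono (LinearMap.range_comp_le_range _ _)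
    omega
  have h1 := hp 1
  rw [hz, Polynomial.eval_zero, hdet 1, one_smul] at h1
  have h2 : q ∘ₗ (A + B) ∘ₗ P = LinearMap.id := by
    ext1 v
    have := LinearMap.congr_fun hP v
    have h3 : (A + B) (P v) = v := congrArg Subtype.val this
    simp only [LinearMap.comp_apply, h3, hq, LinearMap.id_apply]
  rw [h2, LinearMap.det_id] at h1
  exact zero_ne_one h1

open scoped Matrix.Norms.Operator
open NormedSpace (exp)

/-- The orbit map `(v, w) ↦ exp(v) (x + q w) exp(-v)` of a subspace of matrices has derivative
`(v, w) ↦ [v, x] + q w` at the origin. -/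
theorem hasStrictFDerivAt_conj_exp {n : ℕ} (V : Submodule ℂ (Matrix (Fin n) (Fin n) ℂ)) (x : V)
    (q : V →ₗ[ℂ] V) :
    HasStrictFDerivAt (fun p : V × V => exp (p.1 : Matrix (Fin n) (Fin n) ℂ) * (x + q p.2 : V).1 *
        exp (-(p.1 : Matrix (Fin n) (Fin n) ℂ)))
      (LinearMap.toContinuousLinearMap
        (((LinearMap.mulRight ℂ x.1 - LinearMap.mulLeft ℂ x.1) ∘ₗ V.subtype ∘ₗ
          LinearMap.fst ℂ V V) + V.subtype ∘ₗ q ∘ₗ LinearMap.snd ℂ V V)) 0 := by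
  let i : V →L[ℂ] Matrix (Fin n) (Fin n) ℂ := V.subtypeL
  have hi : HasStrictFDerivAt (fun p : V × V => (p.1 : Matrix (Fin n) (Fin n) ℂ))
      (i ∘L ContinuousLinearMap.fst ℂ V V) 0 :=
    (i ∘L ContinuousLinearMap.fst ℂ V V).hasStrictFDerivAt
  have he : ∀ y : Matrix (Fin n) (Fin n) ℂ, y = 0 →
      HasStrictFDerivAt (exp : Matrix (Fin n) (Fin n) ℂ → Matrix (Fin n) (Fin n) ℂ)
        (1 : Matrix (Fin n) (Fin n) ℂ →L[ℂ] Matrix (Fin n) (Fin n) ℂ) y := by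
    rintro _ rfl
    exact hasStrictFDerivAt_exp_zero
  have h1 : HasStrictFDerivAt (fun p : V × V => exp (p.1 : Matrix (Fin n) (Fin n) ℂ))
      ((1 : Matrix (Fin n) (Fin n) ℂ →L[ℂ] Matrix (Fin n) (Fin n) ℂ) ∘L
        (i ∘L ContinuousLinearMap.fst ℂ V V)) 0 :=
    HasStrictFDerivAt.comp (0 : V × V) (he _ (by simp)) hi
  have h2 : HasStrictFDerivAt (fun p : V × V => exp (-(p.1 : Matrix (Fin n) (Fin n) ℂ)))
      ((1 : Matrix (Fin n) (Fin n) ℂ →L[ℂ] Matrix (Fin n) (Fin n) ℂ) ∘L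
        (-(i ∘L ContinuousLinearMap.fst ℂ V V))) 0 :=
    HasStrictFDerivAt.comp (0 : V × V) (he _ (by simp)) hi.neg
  let qc : V × V →L[ℂ] Matrix (Fin n) (Fin n) ℂ :=
    LinearMap.toContinuousLinearMap (V.subtype ∘ₗ q ∘ₗ LinearMap.snd ℂ V V)
  have h3 : HasStrictFDerivAt (fun p : V × V => (x + q p.2 : V).1) qc 0 :=
    qc.hasStrictFDerivAt.const_add x.1
  have h4 := (h1.mul' h3).mul' h2
  refine h4.congr_fderiv ?_
  refine ContinuousLinearMap.ext fun p => ?_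
  change (exp ((0 : V) : Matrix (Fin n) (Fin n) ℂ) * (x.1 + (q 0).1)) * (-p.1.1) +
    (exp ((0 : V) : Matrix (Fin n) (Fin n) ℂ) * (q p.2).1 + p.1.1 * (x.1 + (q 0).1)) *
      exp (-((0 : V) : Matrix (Fin n) (Fin n) ℂ)) = p.1.1 * x.1 - x.1 * p.1.1 + (q p.2).1
  simp
  abel

variable {n : ℕ} {G : Subgroup (GL (Fin n) ℂ)} [IsSimpleAlgebraicGroup G]
  {H : LieSubalgebra ℂ (lieAlg G)} [H.IsCartanSubalgebra]
  (b : (rootSystem H).Base)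

/-- Since [ρ, 𝔤] + H = 𝔤, the map (v, w) ↦ exp(v)(ρ + w)exp(-v) with w in H is a submersion at the
origin. So every element near ρ is conjugate into H, and the conjugate of H centralizes it. -/
theorem eventually_finrank_le_ker_ad : ∀ᶠ y : (lieAlg G).toSubmodule in
    nhds (show (lieAlg G).toSubmodule from ((rhoCheck b : H) : lieAlg G)),
      finrank ℂ H ≤ finrank ℂ (LinearMap.ker (ad ℂ (lieAlg G) y)) := by
  have hG := IsSimpleAlgebraicGroup.isClosed (G := G)
  set V := (lieAlg G).toSubmodule with hV
  let x : V := ((rhoCheck b : H) : lieAlg G)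
  obtain ⟨C, hC⟩ := Submodule.exists_isCompl H.toSubmodule
  let q : V →ₗ[ℂ] V := H.toSubmodule.subtype ∘ₗ H.toSubmodule.projectionOnto C hC
  have hq : ∀ w, q w ∈ H.toSubmodule := fun w => (H.toSubmodule.projectionOnto C hC w).2
  have hq' : ∀ w ∈ H.toSubmodule, q w = w := fun w hw =>
    congrArg Subtype.val (Submodule.projectionOnto_apply_left hC ⟨w, hw⟩)
  obtain ⟨D, hD⟩ := Submodule.exists_isCompl V
  -- The orbit map is matrix-valued with values in V; the projection makes V its target without
  -- changing it.
  let π : Matrix (Fin n) (Fin n) ℂ →L[ℂ] V := LinearMap.toContinuousLinearMap (V.projectionOnto D hD)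
  have hπ : ∀ v : V, π v = v := fun v => Submodule.projectionOnto_apply_left hD v
  have hd := π.hasStrictFDerivAt.comp (0 : V × V) (hasStrictFDerivAt_conj_exp V x q)
  have hs : (π ∘L (LinearMap.toContinuousLinearMap
        (((LinearMap.mulRight ℂ x.1 - LinearMap.mulLeft ℂ x.1) ∘ₗ V.subtype ∘ₗ
          LinearMap.fst ℂ V V) + V.subtype ∘ₗ q ∘ₗ LinearMap.snd ℂ V V))).range = ⊤ := by
    rw [eq_top_iff]
    have htop : (⊤ : Submodule ℂ (lieAlg G)) ≤
        LinearMap.range (ad ℂ (lieAlg G) (rhoCheck b : H)) ⊔ H.toSubmodule := by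
      rw [← iSup_deg b]
      refine iSup_le fun k => ?_
      by_cases hk : k = 0
      · subst hk
        rw [deg_zero]
        exact le_sup_right
      · refine le_trans ?_ le_sup_left
        intro v hv
        refine ⟨(k : ℂ)⁻¹ • v, ?_⟩
        rw [map_smul, ad_apply, mem_deg.1 hv, smul_smul, inv_mul_cancel₀ (by exact_mod_cast hk),
          one_smul]
    intro v _
    obtain ⟨_, ⟨a, rfl⟩, c, hc, hac⟩ := Submodule.mem_sup.1 (htop (show v ∈ ⊤ from trivial))
    refine ⟨((-a : lieAlg G), c), ?_⟩
    have : (LinearMap.toContinuousLinearMap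
        (((LinearMap.mulRight ℂ x.1 - LinearMap.mulLeft ℂ x.1) ∘ₗ V.subtype ∘ₗ
          LinearMap.fst ℂ V V) + V.subtype ∘ₗ q ∘ₗ LinearMap.snd ℂ V V)) ((-a : lieAlg G), c) =
        v.1 := by
      rw [← hac]
      simp only [LinearMap.coe_toContinuousLinearMap', LinearMap.add_apply, LinearMap.comp_apply,
        LinearMap.fst_apply, LinearMap.snd_apply, hq' c hc, LinearMap.sub_apply,
        LinearMap.mulRight_apply, LinearMap.mulLeft_apply, ad_apply]
      change (-a : lieAlg G).1 * x.1 - x.1 * (-a : lieAlg G).1 + c.1 =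
        (⁅((rhoCheck b : H) : lieAlg G), a⁆ + c : lieAlg G).1
      have h5 := lieAlg_lie_coe ((rhoCheck b : H) : lieAlg G) a
      have h6 : (-a : lieAlg G).1 = - a.1 := rfl
      have h7 : (⁅((rhoCheck b : H) : lieAlg G), a⁆ + c : lieAlg G).1 =
        (⁅((rhoCheck b : H) : lieAlg G), a⁆ : lieAlg G).1 + c.1 := rfl
      rw [h7, h5, h6]
      simp only [x]
      noncomm_ring
    change π _ = v
    erw [this]
    exact hπ v
  have hmap := hd.map_nhds_eq_of_surj hs
  have h0 : π (exp ((0 : V × V).1 : Matrix (Fin n) (Fin n) ℂ) * (x + q (0 : V × V).2 : V).1 *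
        exp (-((0 : V × V).1 : Matrix (Fin n) (Fin n) ℂ))) = x := by
    simp [hπ]
  rw [h0] at hmap
  suffices h : ∀ p : V × V, finrank ℂ H ≤ finrank ℂ (LinearMap.ker (ad ℂ (lieAlg G)
      (π (exp (p.1 : Matrix (Fin n) (Fin n) ℂ) * (x + q p.2 : V).1 *
        exp (-(p.1 : Matrix (Fin n) (Fin n) ℂ)))))) by
    have h' := (Filter.eventually_map (P := fun y : V => finrank ℂ H ≤ finrank ℂ
      (LinearMap.ker (ad ℂ (lieAlg G) y)))).2 (Filter.Eventually.of_forall (f := nhds (0 : V × V)) h)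
    exact Filter.Eventually.filter_mono (le_of_eq hmap.symm) h'
  intro p
  let g : G := ⟨expGL p.1.1, expGL_mem hG p.1.2⟩
  let z : lieAlg G := adjointAction hG g (x + q p.2 : V)
  have hz : π (exp (p.1 : Matrix (Fin n) (Fin n) ℂ) * (x + q p.2 : V).1 *
        exp (-(p.1 : Matrix (Fin n) (Fin n) ℂ))) = z := hπ z
  rw [hz]
  let ψ : H →ₗ[ℂ] lieAlg G := (adjointAction hG g : lieAlg G →ₗ[ℂ] lieAlg G) ∘ₗ H.toSubmodule.subtype
  have hψ : Function.Injective ψ :=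
    (adjointAction hG g).injective.comp Subtype.val_injective
  have hr : LinearMap.range ψ ≤ LinearMap.ker (ad ℂ (lieAlg G) z) := by
    rintro _ ⟨h, rfl⟩
    rw [LinearMap.mem_ker, ad_apply]
    change ⁅adjointAction hG g (x + q p.2 : V), adjointAction hG g h.1⁆ = 0
    rw [← LieEquiv.map_lie]
    have h8 : ⁅(show lieAlg G from (x + q p.2 : V)), h.1⁆ = (0 : lieAlg G) := by
      have hm : (x + q p.2 : V) ∈ H := H.add_mem (rhoCheck b).2 (hq _)
      have := trivial_lie_zero H H ⟨_, hm⟩ h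
      exact congrArg Subtype.val this
    erw [h8, map_zero]
  calc finrank ℂ H = finrank ℂ (LinearMap.range ψ) := (LinearMap.finrank_range_of_inj hψ).symm
    _ ≤ _ := Submodule.finrank_mono hr

/-- The centralizer of an element has dimension at least the rank. -/
theorem finrank_cartan_le_ker_ad (b : (rootSystem H).Base) (y : lieAlg G) :
    finrank ℂ H ≤ finrank ℂ (LinearMap.ker (ad ℂ (lieAlg G) y)) := by
  set ρ : lieAlg G := ((rhoCheck b : H) : lieAlg G)
  have hrn : ∀ z : lieAlg G, finrank ℂ (LinearMap.range (ad ℂ (lieAlg G) z)) +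
      finrank ℂ (LinearMap.ker (ad ℂ (lieAlg G) z)) = finrank ℂ (lieAlg G) := fun z =>
    LinearMap.finrank_range_add_finrank_ker _
  have hH : finrank ℂ H ≤ finrank ℂ (lieAlg G) := H.toSubmodule.finrank_le
  have hcont : Continuous fun s : ℂ => (show (lieAlg G).toSubmodule from ρ + s • (y - ρ)) := by
    refine Continuous.subtype_mk (f := fun s : ℂ => ρ.1 + s • (y.1 - ρ.1)) ?_ _
    fun_prop
  have h0 : (show (lieAlg G).toSubmodule from ρ + (0 : ℂ) • (y - ρ)) = ρ := by
    rw [zero_smul, add_zero]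
  have hev := (hcont.tendsto' 0 ρ h0).eventually (eventually_finrank_le_ker_ad b)
  -- The bound near ρ spreads along the line from ρ to y.
  have := finrank_range_add_le (ad ℂ (lieAlg G) ρ) (ad ℂ (lieAlg G) (y - ρ))
    (finrank ℂ (lieAlg G) - finrank ℂ H) (by
      filter_upwards [hev] with s hs
      rw [← map_smul, ← map_add]
      have h1 := hrn (ρ + s • (y - ρ))
      have h2 : finrank ℂ H ≤ finrank ℂ (LinearMap.ker (ad ℂ (lieAlg G) (ρ + s • (y - ρ)))) := hs
      omega)
  rw [← map_add, add_sub_cancel] at this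
  have h1 := hrn y
  omega

end MinimalNullity

end OperConn

namespace OperConn

/-! ### Integrality of weights for sl₂. -/

section Sl2

open Module Module.End

/-- An eigenvector of an inner derivation of a finite dimensional algebra, for a nonzero
eigenvalue, is nilpotent. -/
theorem isNilpotent_of_mul_sub_mul_eq_smul {R : Type*} [Ring R] [Algebra ℂ R]
    [FiniteDimensional ℂ R] {a x : R} {c : ℂ} (hc : c ≠ 0) (h : a * x - x * a = c • x) :
    IsNilpotent x := by
  by_contra hn
  have hpow : ∀ k : ℕ, a * x ^ k - x ^ k * a = (k * c) • x ^ k := by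
    intro k
    induction k with
    | zero => simp
    | succ k ih =>
      have : a * x ^ (k + 1) - x ^ (k + 1) * a =
          (a * x ^ k - x ^ k * a) * x + x ^ k * (a * x - x * a) := by
        rw [pow_succ]; noncomm_ring
      rw [this, ih, h, smul_mul_assoc, mul_smul_comm, ← pow_succ, ← add_smul]
      push_cast
      ring_nf
  let D : End ℂ R := LinearMap.mulLeft ℂ a - LinearMap.mulRight ℂ a
  -- If no power of x vanished, its powers would be eigenvectors of ad a for the infinitely many
  -- eigenvalues kc.
  have hD : ∀ k : ℕ, D.HasEigenvalue (k * c) := by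
    intro k
    refine hasEigenvalue_of_hasEigenvector (x := x ^ k) ⟨mem_eigenspace_iff.2 (hpow k), ?_⟩
    exact fun h0 => hn ⟨k, h0⟩
  have hfin : (Set.range fun k : ℕ => (k * c : ℂ)).Finite :=
    (Module.End.finite_hasEigenvalue D).subset (by rintro _ ⟨k, rfl⟩; exact hD k)
  refine Set.infinite_range_of_injective (f := fun k : ℕ => (k * c : ℂ)) ?_ hfin
  intro k l hkl
  exact_mod_cast mul_right_cancel₀ hc hkl

variable {V : Type*} [AddCommGroup V] [Module ℂ V] {e f h : End ℂ V}

theorem sl2_e_f_pow (hf : h * f - f * h = (-2 : ℂ) • f) (hef : e * f - f * e = h) {v : V}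
    (hv : e v = 0) (k : ℕ) : e ((f ^ (k + 1)) v) = (k + 1 : ℂ) • (f ^ k) (h v - (k : ℂ) • v) := by
  have hfk : ∀ k : ℕ, ∀ w, h ((f ^ k) w) = (f ^ k) (h w) - (2 * k : ℂ) • (f ^ k) w := by
    intro k
    induction k with
    | zero => simp
    | succ k ih =>
      intro w
      have h1 : ∀ u, h (f u) = f (h u) - (2 : ℂ) • f u := fun u => by
        have := LinearMap.congr_fun hf u
        simp only [LinearMap.sub_apply, Module.End.mul_apply, LinearMap.smul_apply] at this
        rw [sub_eq_iff_eq_add.1 this]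
        module
      rw [pow_succ', Module.End.mul_apply, h1, ih, map_sub, map_smul]
      simp only [Module.End.mul_apply]
      push_cast
      module
  have h2 : ∀ u, e (f u) = f (e u) + h u := fun u => by
    have := LinearMap.congr_fun hef u
    simp only [LinearMap.sub_apply, Module.End.mul_apply] at this
    rw [← this]; abel
  induction k with
  | zero => simp [h2, hv]
  | succ k ih =>
    rw [pow_succ', Module.End.mul_apply, h2, ih, hfk]
    simp only [map_smul, map_sub, pow_succ' f k, Module.End.mul_apply]
    push_cast
    module

theorem sl2_e_h (he : h * e - e * h = (2 : ℂ) • e) (u : V) : e (h u) = h (e u) - (2 : ℂ) • e u := by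
  have := LinearMap.congr_fun he u
  simp only [LinearMap.sub_apply, Module.End.mul_apply, LinearMap.smul_apply] at this
  rw [← this]; abel

/-- Iteration of `sl2_e_f_pow`, where v need not be an eigenvector of h. Once f^k = 0, a polynomial
in h with simple natural roots annihilates v. -/
theorem sl2_aeval_prod (he : h * e - e * h = (2 : ℂ) • e) (hf : h * f - f * h = (-2 : ℂ) • f)
    (hef : e * f - f * e = h) (k : ℕ) : ∀ {v : V}, e v = 0 → (e ^ k) ((f ^ k) v) =
      (k.factorial : ℂ) • Polynomial.aeval h (∏ i ∈ Finset.range k,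
        (Polynomial.X - Polynomial.C (i : ℂ))) v := by
  induction k with
  | zero => simp
  | succ k ih =>
    intro v hv
    have h1 : e (h v - (k : ℂ) • v) = 0 := by
      rw [map_sub, sl2_e_h he, map_smul, hv]
      simp
    rw [pow_succ e, Module.End.mul_apply, sl2_e_f_pow hf hef hv, map_smul, ih h1, smul_smul,
      Nat.factorial_succ, Finset.prod_range_succ, map_mul, Module.End.mul_apply]
    congr 1
    · push_cast; ring
    · simp
      exact Nat.cast_smul_eq_nsmul ℂ _ _

/-- On `ker e`, generalized eigenvectors of `h` are eigenvectors with natural eigenvalue. -/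
theorem sl2_highest [FiniteDimensional ℂ V] (he : h * e - e * h = (2 : ℂ) • e) (hf : h * f - f * h = (-2 : ℂ) • f)
    (hef : e * f - f * e = h) {v : V} (hv : e v = 0) (hv0 : v ≠ 0) {μ : ℂ}
    (hμ : h (h v - μ • v) = μ • (h v - μ • v)) : h v = μ • v ∧ ∃ k : ℕ, μ = k := by
  obtain ⟨m, hm⟩ := isNilpotent_of_mul_sub_mul_eq_smul (by norm_num) hf
  have h0 := sl2_aeval_prod he hf hef m hv
  rw [hm, LinearMap.zero_apply, map_zero] at h0
  set p : Polynomial ℂ := ∏ i ∈ Finset.range m, (Polynomial.X - Polynomial.C (i : ℂ)) with hp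
  have h1 : Polynomial.aeval h p v = 0 :=
    (smul_eq_zero.1 h0.symm).resolve_left (by exact_mod_cast m.factorial_ne_zero)
  have hsep : p.Separable := by
    rw [hp, Polynomial.separable_prod_X_sub_C_iff']
    intro i _ j _ hij
    exact_mod_cast hij
  set q : Polynomial ℂ := (Polynomial.X - Polynomial.C μ) ^ 2 with hq
  have h2 : Polynomial.aeval h q v = 0 := by
    rw [hq, map_pow, map_sub, Polynomial.aeval_X, Polynomial.aeval_C, pow_two]
    simp only [Module.End.mul_apply, LinearMap.sub_apply, Module.algebraMap_end_apply]
    rw [hμ, sub_self]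
  have key : ∀ s t : Polynomial ℂ, Polynomial.aeval h (s * p + t * q) v = 0 := by
    intro s t
    simp [Module.End.mul_apply, h1, h2]
  -- Both p, which has simple roots, and (X - μ)² annihilate v; so does their greatest common
  -- divisor, X - μ or 1, and the latter is impossible for v ≠ 0.
  by_cases hroot : p.IsRoot μ
  · obtain ⟨p', hp'⟩ := Polynomial.dvd_iff_isRoot.2 hroot
    have hcop : IsCoprime p' (Polynomial.X - Polynomial.C μ) := by
      rw [hp'] at hsep
      exact hsep.isCoprime.symm
    obtain ⟨s, t, hst⟩ := hcop
    have h3 := key s t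
    have h4 : s * p + t * q = Polynomial.X - Polynomial.C μ := by
      rw [hp', hq]
      linear_combination (Polynomial.X - Polynomial.C μ) * hst
    rw [h4] at h3
    refine ⟨by simpa [sub_eq_zero] using h3, ?_⟩
    rw [Polynomial.IsRoot, hp, Polynomial.eval_prod, Finset.prod_eq_zero_iff] at hroot
    obtain ⟨i, _, hi⟩ := hroot
    exact ⟨i, by simpa [sub_eq_zero] using hi⟩
  · exfalso
    have hcop : IsCoprime p q :=
      (((Polynomial.irreducible_X_sub_C μ).coprime_iff_not_dvd.2 fun hd =>
        hroot (Polynomial.dvd_iff_isRoot.1 hd)).symm).pow_right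
    obtain ⟨s, t, hst⟩ := hcop
    have h3 := key s t
    rw [hst, map_one] at h3
    exact hv0 h3

/-- For `v ≠ 0`, the last nonzero vector among the `e^j v`. -/
theorem exists_last_pow_ne_zero (he : IsNilpotent e) {v : V} (hv : v ≠ 0) :
    ∃ j : ℕ, (e ^ j) v ≠ 0 ∧ e ((e ^ j) v) = 0 := by
  classical
  obtain ⟨m, hm⟩ := he
  have hex : ∃ j, (e ^ j) v = 0 := ⟨m, by simp [hm]⟩
  have h0 : Nat.find hex ≠ 0 := fun h0 => hv (by simpa [h0] using Nat.find_spec hex)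
  refine ⟨Nat.find hex - 1, Nat.find_min hex (by omega), ?_⟩
  have := Nat.find_spec hex
  rwa [← Nat.succ_pred_eq_of_ne_zero h0, Nat.succ_eq_add_one, pow_succ', Module.End.mul_apply] at this

theorem sl2_h_e_pow (he : h * e - e * h = (2 : ℂ) • e) (k : ℕ) :
    ∀ w, h ((e ^ k) w) = (e ^ k) (h w) + (2 * k : ℂ) • (e ^ k) w := by
  induction k with
  | zero => simp
  | succ k ih =>
    intro w
    have h1 : ∀ u, h (e u) = e (h u) + (2 : ℂ) • e u := fun u => by rw [sl2_e_h he]; abel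
    rw [pow_succ', Module.End.mul_apply, h1, ih, map_add, map_smul]
    simp only [Module.End.mul_apply]
    push_cast
    module

/-- In a finite dimensional representation of `sl₂`, `h` is diagonalizable with integral
eigenvalues. -/
theorem sl2_iSup_eigenspace [FiniteDimensional ℂ V] (he : h * e - e * h = (2 : ℂ) • e)
    (hf : h * f - f * h = (-2 : ℂ) • f) (hef : e * f - f * e = h) :
    ⨆ k : ℤ, h.eigenspace (k : ℂ) = ⊤ := by
  have hnil := isNilpotent_of_mul_sub_mul_eq_smul two_ne_zero he
  -- The Casimir operator, equal to μ² + 2μ on a highest weight vector of weight μ.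
  set C : End ℂ V := h * h + (2 : ℂ) • h + (4 : ℂ) • (f * e) with hC
  have he' : h * e = e * h + (2 : ℂ) • e := by rw [← he]; abel
  have hf' : h * f = f * h - (2 : ℂ) • f := by rw [sub_eq_iff_eq_add.1 hf]; module
  have hef' : e * f = f * e + h := by rw [← hef]; abel
  have hCh : Commute C h := by
    change C * h = h * C
    have : h * (f * e) = (f * e) * h := by
      rw [← mul_assoc, hf', sub_mul, mul_assoc, he']
      simp only [mul_add, mul_smul_comm, smul_mul_assoc]
      rw [mul_assoc]; abel
    simp only [hC, add_mul, mul_add, smul_mul_assoc, mul_smul_comm, this, mul_assoc]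
  have hCe : Commute C e := by
    change C * e = e * C
    have h1 : h * h * e = e * h * h + (4 : ℂ) • (e * h) + (4 : ℂ) • e := by
      rw [mul_assoc, he', mul_add, ← mul_assoc, he', add_mul, mul_smul_comm, he', smul_mul_assoc]
      module
    have h2 : e * (f * e) = f * e * e + e * h + (2 : ℂ) • e := by
      rw [← mul_assoc, hef', add_mul, he']; abel
    simp only [hC, add_mul, mul_add, smul_mul_assoc, mul_smul_comm, h1, h2, he', ← mul_assoc]
    module
  have hCa : ∀ {a : V} {μ c : ℂ}, a ≠ 0 → e a = 0 → h a = μ • a → a ∈ C.maxGenEigenspace c →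
      c = μ ^ 2 + 2 * μ := by
    intro a μ c ha hea hha hac
    have h1 : a ∈ C.maxGenEigenspace (μ ^ 2 + 2 * μ) := by
      refine Module.End.mem_maxGenEigenspace .. |>.2 ⟨1, ?_⟩
      simp [hC, hha, hea, Module.End.mul_apply, smul_smul]
      module
    by_contra hne
    exact ha (Submodule.disjoint_def.1
      (C.disjoint_genEigenspace hne ⊤ ⊤) a hac h1)
  have hpowC : ∀ (j : ℕ) {v : V} {c : ℂ}, v ∈ C.maxGenEigenspace c →
      (e ^ j) v ∈ C.maxGenEigenspace c := fun j v c hv =>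
    Module.End.mapsTo_maxGenEigenspace_of_comm (hCe.pow_right j) c hv
  -- If w = (h - μ)v ≠ 0, the last nonzero vectors e^j v and e^i w have natural weights μ + 2j and μ
  -- + 2i and the same Casimir value, so i = j. But e^j v is a true eigenvector, which says e^j w =
  -- 0.
  have hsq : ∀ (μ : ℂ) (c : ℂ) (v : V), v ∈ C.maxGenEigenspace c →
      h (h v - μ • v) = μ • (h v - μ • v) → h v - μ • v = 0 := by
    intro μ c v hvc hv
    by_contra hw
    have hv0 : v ≠ 0 := by rintro rfl; simp at hw
    set w := h v - μ • v with hwdef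
    have hwc : w ∈ C.maxGenEigenspace c :=
      Submodule.sub_mem _ (Module.End.mapsTo_maxGenEigenspace_of_comm hCh c hvc)
        (Submodule.smul_mem _ _ hvc)
    obtain ⟨j, hj0, hj1⟩ := exists_last_pow_ne_zero hnil hv0
    have hew : ∀ k : ℕ, (e ^ k) w = h ((e ^ k) v) - (μ + 2 * k) • (e ^ k) v := by
      intro k
      rw [sl2_h_e_pow he, hwdef, map_sub, map_smul]
      module
    have hew' : ∀ k : ℕ, h ((e ^ k) w) = (μ + 2 * k) • (e ^ k) w := by
      intro k
      rw [sl2_h_e_pow he, hv, map_smul]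
      module
    obtain ⟨ha1, m, ha2⟩ := sl2_highest he hf hef hj1 hj0 (μ := μ + 2 * j) (by
      rw [← hew, hew'])
    have hjw : (e ^ j) w = 0 := by rw [hew, ha1, sub_self]
    obtain ⟨i, hi0, hi1⟩ := exists_last_pow_ne_zero hnil hw
    obtain ⟨hb1, m', hb2⟩ := sl2_highest he hf hef hi1 hi0 (μ := μ + 2 * i) (by
      rw [hew', sub_self, map_zero, smul_zero])
    have hc1 := hCa hj0 hj1 ha1 (hpowC j hvc)
    have hc2 := hCa hi0 hi1 hb1 (hpowC i hwc)
    rw [ha2] at hc1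
    rw [hb2, hc1] at hc2
    have hmm : m = m' := by
      have h5 : m ^ 2 + 2 * m = m' ^ 2 + 2 * m' := by exact_mod_cast hc2
      nlinarith [sq_nonneg ((m : ℤ) - m'), mul_self_nonneg ((m : ℤ) - m')]
    have hij : i = j := by
      have h6 : (2 * i : ℂ) = 2 * j := by
        rw [hmm, ← hb2] at ha2
        linear_combination -ha2
      have h7 : 2 * i = 2 * j := by exact_mod_cast h6
      omega
    exact hi0 (hij ▸ hjw)
  -- The kernel of (h - μ)² is stable under C and splits into its parts in the generalized
  -- eigenspaces of C.
  have hker : ∀ (μ : ℂ) (v : V), h (h v - μ • v) = μ • (h v - μ • v) → h v - μ • v = 0 := by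
    intro μ v hv
    set W : Submodule ℂ V := LinearMap.ker ((h - algebraMap ℂ _ μ) ^ 2) with hW
    have hmem : ∀ u, u ∈ W ↔ h (h u - μ • u) = μ • (h u - μ • u) := by
      intro u
      rw [hW, LinearMap.mem_ker, pow_two, Module.End.mul_apply]
      simp only [LinearMap.sub_apply, Module.algebraMap_end_apply, sub_eq_zero]
    have hcom : Commute C ((h - algebraMap ℂ _ μ) ^ 2) :=
      (hCh.sub_right (Algebra.commutes μ C).symm).pow_right 2
    have hinv : ∀ u ∈ W, C u ∈ W := by
      intro u hu
      rw [hW, LinearMap.mem_ker] at hu ⊢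
      rw [← Module.End.mul_apply, ← hcom.eq, Module.End.mul_apply, hu, map_zero]
    have hsup := Submodule.inf_iSup_genEigenspace (p := W) (f := C) (k := ⊤) hinv
    have htop : ⨆ μ, C.genEigenspace μ ⊤ = ⊤ := Module.End.iSup_maxGenEigenspace_eq_top C
    rw [htop, inf_top_eq] at hsup
    have hvW : v ∈ ⨆ c, W ⊓ C.genEigenspace c ⊤ := by rw [← hsup, hmem]; exact hv
    have hle : ⨆ c, W ⊓ C.genEigenspace c ⊤ ≤ LinearMap.ker (h - algebraMap ℂ _ μ) := by
      refine iSup_le fun c u hu => ?_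
      rw [LinearMap.mem_ker, LinearMap.sub_apply, Module.algebraMap_end_apply]
      exact hsq μ c u hu.2 ((hmem u).1 hu.1)
    simpa [LinearMap.mem_ker] using hle hvW
  rw [eq_top_iff, ← Module.End.iSup_maxGenEigenspace_eq_top h]
  refine iSup_le fun μ => ?_
  have hgen : h.maxGenEigenspace μ ≤ h.eigenspace μ := by
    intro v hv
    obtain ⟨k, hk⟩ := Module.End.mem_maxGenEigenspace .. |>.1 hv
    have : ∀ k : ℕ, ((h - μ • (1 : End ℂ V)) ^ k) v = 0 → h v - μ • v = 0 := by
      intro k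
      induction k with
      | zero => intro h0; simp at h0; simp [h0]
      | succ k ih =>
        rcases k with _ | k
        · intro h0; simpa using h0
        · intro h0
          refine ih ?_
          set u := ((h - μ • (1 : End ℂ V)) ^ k) v
          rw [pow_succ', pow_succ', Module.End.mul_apply, Module.End.mul_apply] at h0
          have h1 := hker μ u (by simpa [sub_eq_zero] using h0)
          rw [pow_succ', Module.End.mul_apply]
          simpa using h1
    rw [mem_eigenspace_iff, ← sub_eq_zero]
    exact this k hk
  refine hgen.trans ?_
  by_cases hbot : h.eigenspace μ = ⊥
  · rw [hbot]; exact bot_le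
  · obtain ⟨v, hv, hv0⟩ := Submodule.exists_mem_ne_zero_of_ne_bot hbot
    rw [mem_eigenspace_iff] at hv
    obtain ⟨j, hj0, hj1⟩ := exists_last_pow_ne_zero hnil hv0
    have hhj : h ((e ^ j) v) = (μ + 2 * j) • (e ^ j) v := by
      rw [sl2_h_e_pow he, hv, map_smul]; module
    obtain ⟨-, m, hm⟩ := sl2_highest he hf hef hj1 hj0 (μ := μ + 2 * j) (by
      rw [hhj, sub_self, map_zero, smul_zero])
    have : μ = ((m - 2 * j : ℤ) : ℂ) := by push_cast; linear_combination hm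
    rw [this]
    exact le_iSup (fun k : ℤ => h.eigenspace (k : ℂ)) _

end Sl2

end OperConn

namespace OperConn

/-! ### Laurent polynomials as functions on ℂˣ. -/

section Laurent

open LaurentPolynomial

/-- The exponential as a unit. -/
noncomputable def expUnit (s : ℂ) : ℂˣ := Units.mk0 (Complex.exp s) (Complex.exp_ne_zero s)

theorem coe_expUnit (s : ℂ) : (expUnit s : ℂ) = Complex.exp s := rfl

theorem expUnit_add (s t : ℂ) : expUnit (s + t) = expUnit s * expUnit t := by
  ext; simp [coe_expUnit, Complex.exp_add]

theorem expUnit_zero : expUnit 0 = 1 := by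
  ext; simp [coe_expUnit]

theorem expUnit_surjective (z : ℂˣ) : ∃ s, expUnit s = z :=
  ⟨Complex.log z, by ext; simp [coe_expUnit, Complex.exp_log z.ne_zero]⟩

theorem evalPoly_C (z : ℂˣ) (a : ℂ) : evalPoly z (C a) = a := by simp [evalPoly]

theorem evalPoly_algebraMap (z : ℂˣ) (a : ℂ) : evalPoly z (algebraMap ℂ ℂ[T;T⁻¹] a) = a := by
  rw [← C_eq_algebraMap, evalPoly_C]

theorem evalPoly_T (z : ℂˣ) (k : ℤ) : evalPoly z (T k) = (z : ℂ) ^ k := by simp [evalPoly]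

/-- A power of T turns the difference into a polynomial with infinitely many zeros. -/
theorem evalPoly_ext {f g : ℂ[T;T⁻¹]} (h : ∀ z, evalPoly z f = evalPoly z g) : f = g := by
  rw [← sub_eq_zero]
  obtain ⟨m, p, hp⟩ := exists_T_pow (f - g)
  have hp0 : p = 0 := by
    apply Polynomial.eq_zero_of_infinite_isRoot
    refine Set.Infinite.mono ?_ (Set.infinite_range_of_injective (f := fun k : ℕ => ((k + 1 : ℕ) : ℂ)) ?_)
    · rintro _ ⟨k, rfl⟩
      have hk : ((k + 1 : ℕ) : ℂ) ≠ 0 := by exact_mod_cast k.succ_ne_zero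
      have h1 := congrArg (evalPoly (Units.mk0 _ hk)) hp
      rw [map_mul, map_sub, h, sub_self, zero_mul, evalPoly, eval₂_toLaurent] at h1
      simpa [Polynomial.IsRoot, Polynomial.eval₂_id] using h1
    · intro k l hkl
      have : ((k + 1 : ℕ) : ℂ) = ((l + 1 : ℕ) : ℂ) := hkl
      rw [Nat.cast_inj] at this
      omega
  rw [hp0, map_zero] at hp
  calc f - g = (f - g) * T m * T (-m) := by rw [mul_T_assoc]; simp
    _ = 0 := by rw [← hp, zero_mul]

theorem coeff_derivPoly (f : ℂ[T;T⁻¹]) (k : ℤ) :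
    (derivPoly f).coeff k = (k + 1) * f.coeff (k + 1) := by
  classical
  rw [derivPoly, Finsupp.sum, AddMonoidAlgebra.coeff_sum, Finsupp.finsetSum_apply]
  have h1 : ∀ j : ℤ, (C ((j : ℂ) * f.coeff j) * T (j - 1) : ℂ[T;T⁻¹]).coeff k =
      if j = k + 1 then (k + 1) * f.coeff (k + 1) else 0 := by
    intro j
    rw [← single_eq_C_mul_T, AddMonoidAlgebra.coeff_single, Finsupp.single_apply]
    by_cases hj : j = k + 1
    · subst hj; simp
    · rw [if_neg (by omega), if_neg hj]
  rw [Finset.sum_congr rfl fun j _ => h1 j, Finset.sum_ite_eq']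
  split_ifs with h
  · rfl
  · rw [Finsupp.notMem_support_iff.1 h, mul_zero]

theorem derivPoly_add (f g : ℂ[T;T⁻¹]) : derivPoly (f + g) = derivPoly f + derivPoly g := by
  ext k
  simp only [coeff_derivPoly, AddMonoidAlgebra.coeff_add, Finsupp.add_apply]
  ring

theorem derivPoly_C_mul_T (a : ℂ) (m : ℤ) : derivPoly (C a * T m) = C (m * a) * T (m - 1) := by
  ext k
  rw [coeff_derivPoly]
  simp only [← single_eq_C_mul_T, AddMonoidAlgebra.coeff_single, Finsupp.single_apply]
  by_cases h : m = k + 1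
  · subst h; simp
  · rw [if_neg h, if_neg (by omega), mul_zero]

/-- Along z = exp s the formal derivative becomes an analytic one, so identities of Laurent
polynomials can be checked by calculus on ℂ. -/
theorem hasDerivAt_evalPoly (f : ℂ[T;T⁻¹]) (s : ℂ) :
    HasDerivAt (fun s => evalPoly (expUnit s) f)
      (Complex.exp s * evalPoly (expUnit s) (derivPoly f)) s := by
  induction f using LaurentPolynomial.induction_on' with
  | add p q hp hq =>
    rw [derivPoly_add]
    simp only [map_add]
    exact (hp.add hq).congr_deriv (by ring)
  | C_mul_T m a =>
    rw [derivPoly_C_mul_T]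
    simp only [map_mul, evalPoly_C, evalPoly_T, coe_expUnit, ← Complex.exp_int_mul]
    have h1 : HasDerivAt (fun s : ℂ => Complex.exp (m * s)) (Complex.exp (m * s) * m) s := by
      simpa using ((hasDerivAt_id s).const_mul (m : ℂ)).cexp
    refine (h1.const_mul a).congr_deriv ?_
    have h2 : Complex.exp (m * s) = Complex.exp s * Complex.exp (((m - 1 : ℤ) : ℂ) * s) := by
      rw [← Complex.exp_add]; congr 1; push_cast; ring
    rw [h2]; ring

variable {n : ℕ}

/-- Evaluation of an invertible matrix of Laurent polynomials. -/
noncomputable def evalGL (z : ℂˣ) : GL (Fin n) ℂ[T;T⁻¹] →* GL (Fin n) ℂ :=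
  Matrix.GeneralLinearGroup.map (evalPoly z)

theorem coe_evalGL (z : ℂˣ) (g : GL (Fin n) ℂ[T;T⁻¹]) : (evalGL z g).1 = g.1.map (evalPoly z) := rfl

theorem matrix_evalPoly_ext {A A' : Matrix (Fin n) (Fin n) ℂ[T;T⁻¹]}
    (h : ∀ z, A.map (evalPoly z) = A'.map (evalPoly z)) : A = A' := by
  ext1 i j
  exact evalPoly_ext fun z => congrFun (congrFun (h z) i) j

theorem matrix_evalPoly_mul (z : ℂˣ) (A A' : Matrix (Fin n) (Fin n) ℂ[T;T⁻¹]) :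
    (A * A').map (evalPoly z) = A.map (evalPoly z) * A'.map (evalPoly z) :=
  map_mul (evalPoly z).mapMatrix A A'

theorem matrix_evalPoly_const (z : ℂˣ) (A : Matrix (Fin n) (Fin n) ℂ) :
    (const ℂ[T;T⁻¹] A).map (evalPoly z) = A := by
  ext i j
  exact evalPoly_algebraMap z _

theorem matrix_evalPoly_smul (z : ℂˣ) (f : ℂ[T;T⁻¹]) (A : Matrix (Fin n) (Fin n) ℂ[T;T⁻¹]) :
    (f • A).map (evalPoly z) = evalPoly z f • A.map (evalPoly z) := by
  ext i j
  simp

theorem mem_points_iff {K : Subgroup (GL (Fin n) ℂ)} (hK : IsZariskiClosed (K : Set (GL (Fin n) ℂ)))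
    {g : GL (Fin n) ℂ[T;T⁻¹]} : g ∈ points K ℂ[T;T⁻¹] ↔ ∀ z, evalGL z g ∈ K := by
  have key : ∀ (z : ℂˣ) (f : MvPolynomial (Fin n × Fin n) ℂ), evalPoly z (MvPolynomial.aeval (coords g) f) =
      MvPolynomial.aeval (coords (evalGL z g)) f := by
    intro z f
    induction f using MvPolynomial.induction_on with
    | C a => rw [MvPolynomial.aeval_C, evalPoly_algebraMap, MvPolynomial.aeval_C]; rfl
    | add p q hp hq => simp only [map_add, hp, hq]
    | mul_X p i hp => simp only [map_mul, hp, MvPolynomial.aeval_X]; rfl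
  constructor
  · intro hg z
    rw [mem_iff_idealOf hK]
    intro f hf
    rw [← key, hg f hf, map_zero]
  · intro h f hf
    refine evalPoly_ext fun z => ?_
    rw [key, map_zero]
    exact (mem_iff_idealOf hK).1 (h z) f hf

/-- Entries along an exponential path. -/
theorem hasDerivAt_evalGL (g : GL (Fin n) ℂ[T;T⁻¹]) (s : ℂ) (i j : Fin n) :
    HasDerivAt (fun s => (evalGL (expUnit s) g).1 i j)
      (Complex.exp s * (g.1.map derivPoly).map (evalPoly (expUnit s)) i j) s :=
  hasDerivAt_evalPoly (g.1 i j) s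

theorem derivPoly_const (X : Matrix (Fin n) (Fin n) ℂ) : (const ℂ[T;T⁻¹] X).map derivPoly = 0 := by
  ext1 i j
  have := derivPoly_C_mul_T (X i j) 0
  rw [T_zero, mul_one, Int.cast_zero, zero_mul, map_zero, zero_mul, C_eq_algebraMap] at this
  exact this

end Laurent

/-! ### Cocharacters as exponentials. -/

section Cocharacter

open LaurentPolynomial
open scoped Matrix.Norms.Operator
open NormedSpace (exp)

variable {n : ℕ}

theorem hasDerivAt_entry_exp (X : Matrix (Fin n) (Fin n) ℂ) (t : ℂ) (i j : Fin n) :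
    HasDerivAt (fun s : ℂ => (expGL (s • X)).1 i j) ((X * (expGL (t • X)).1) i j) t := by
  have h := hasDerivAt_exp_smul_const' (𝕂 := ℂ) X t
  exact hasDerivAt_pi.1 (hasDerivAt_pi.1 h i) j

theorem hasDerivAt_entry_mul {A A' : ℂ → Matrix (Fin n) (Fin n) ℂ} {dA dA' : Matrix (Fin n) (Fin n) ℂ}
    {t : ℂ} (hA : ∀ i j, HasDerivAt (fun s => A s i j) (dA i j) t)
    (hA' : ∀ i j, HasDerivAt (fun s => A' s i j) (dA' i j) t) (i j : Fin n) :
    HasDerivAt (fun s => (A s * A' s) i j) ((dA * A' t + A t * dA') i j) t := by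
  simp only [Matrix.mul_apply, Matrix.add_apply, ← Finset.sum_add_distrib]
  exact HasDerivAt.fun_sum fun k _ => (hA i k).mul (hA' k j)

theorem isCocharacter_of_evalGL_eq {K : Subgroup (GL (Fin n) ℂ)}
    (hK : IsZariskiClosed (K : Set (GL (Fin n) ℂ))) {g : GL (Fin n) ℂ[T;T⁻¹]}
    {X : Matrix (Fin n) (Fin n) ℂ} (hX : X ∈ lieAlg K)
    (h : ∀ s, evalGL (expUnit s) g = expGL (s • X)) : IsCocharacter K g X where
  mem := by
    rw [mem_points_iff hK]
    intro z
    obtain ⟨s, rfl⟩ := expUnit_surjective z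
    rw [h]
    exact (mem_lieAlg_iff hK).1 hX s
  map_mul z w := by
    obtain ⟨s, rfl⟩ := expUnit_surjective z
    obtain ⟨t, rfl⟩ := expUnit_surjective w
    simp only [← coe_evalGL, ← expUnit_add, h, ← Units.val_mul]
    rw [add_smul, expGL_add_of_commute (((Commute.refl X).smul_left s).smul_right t)]
  differential := by
    ext i j
    have h1 := hasDerivAt_evalGL g 0 i j
    have h2 := hasDerivAt_entry_exp X 0 i j
    simp only [h] at h1
    simpa [expUnit_zero, expGL_zero] using h1.unique h2

/-- Multiplicativity propagates the derivative at 1 to the equation g' = gX along s ↦ exp s, so the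
product with exp(-sX) is constant. -/
theorem IsCocharacter.evalGL_eq {K : Subgroup (GL (Fin n) ℂ)} {g : GL (Fin n) ℂ[T;T⁻¹]}
    {X : Matrix (Fin n) (Fin n) ℂ} (hg : IsCocharacter K g X) (s : ℂ) :
    evalGL (expUnit s) g = expGL (s • X) := by
  have hmul : ∀ s t, (evalGL (expUnit (s + t)) g) = evalGL (expUnit s) g * evalGL (expUnit t) g := by
    intro s t
    ext1
    rw [expUnit_add]
    exact hg.map_mul _ _
  have h0 : evalGL (expUnit 0) g = 1 := by
    have := hmul 0 0
    rw [add_zero] at this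
    exact left_eq_mul.1 this
  have hd0 : ∀ i j, HasDerivAt (fun s => (evalGL (expUnit s) g).1 i j) (X i j) 0 := by
    intro i j
    have h1 := hasDerivAt_evalGL g 0 i j
    rw [expUnit_zero, hg.differential, Complex.exp_zero, one_mul] at h1
    exact h1
  have hd : ∀ s i j, HasDerivAt (fun s => (evalGL (expUnit s) g).1 i j)
      (((evalGL (expUnit s) g).1 * X) i j) s := by
    intro s i j
    have h1 : HasDerivAt (fun t => (evalGL (expUnit t) g).1 i j)
      (((evalGL (expUnit s) g).1 * X) i j) (s + 0) := by
      have h2 : HasDerivAt (fun t => (evalGL (expUnit (s + t)) g).1 i j)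
          (((evalGL (expUnit s) g).1 * X) i j) 0 := by
        have h3 := hasDerivAt_entry_mul (A := fun _ => (evalGL (expUnit s) g).1) (dA := 0)
          (fun i j => hasDerivAt_const _ _) hd0 i j
        simpa [hmul] using h3
      have h4 : HasDerivAt (fun t => (evalGL (expUnit (s + (t - s))) g).1 i j)
          (((evalGL (expUnit s) g).1 * X) i j) (s + 0) :=
        HasDerivAt.comp_sub_const (s + 0) s (by simpa using h2)
      have h5 : (fun t => (evalGL (expUnit (s + (t - s))) g).1 i j) =
          fun t => (evalGL (expUnit t) g).1 i j := by
        funext t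
        rw [show s + (t - s) = t by ring]
      rwa [h5] at h4
    simpa using h1
  have hconst : ∀ s, (evalGL (expUnit s) g).1 * (expGL (s • (-X))).1 = 1 := by
    intro s
    ext i j
    have h1 : ∀ s, HasDerivAt (fun s => ((evalGL (expUnit s) g).1 * (expGL (s • (-X))).1) i j) 0 s := by
      intro s
      refine (hasDerivAt_entry_mul (hd s) (hasDerivAt_entry_exp (-X) s) i j).congr_deriv ?_
      simp [mul_assoc]
    have h2 := is_const_of_deriv_eq_zero (fun s => (h1 s).differentiableAt) (fun s => (h1 s).deriv) s 0
    rw [h2, h0, zero_smul, expGL_zero]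
    simp
  ext1
  have h1 := hconst s
  have h2 : expGL (s • (-X)) = (expGL (s • X))⁻¹ := by rw [inv_expGL, smul_neg]
  rw [h2] at h1
  have h3 : evalGL (expUnit s) g * (expGL (s • X))⁻¹ = 1 := by ext1; exact h1
  rw [mul_inv_eq_one.1 h3]

/-- A matrix which is diagonalizable with integral eigenvalues integrates to a Laurent polynomial
one-parameter group. -/
theorem exists_evalGL_eq {X : Matrix (Fin n) (Fin n) ℂ}
    (hX : ⨆ k : ℤ, Module.End.eigenspace (Matrix.toLin' X) (k : ℂ) = ⊤) :
    ∃ g : GL (Fin n) ℂ[T;T⁻¹], ∀ s, evalGL (expUnit s) g = expGL (s • X) := by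
  let S : Set (Fin n → ℂ) := {v | ∃ k : ℤ, X.mulVec v = (k : ℂ) • v}
  have hS : ⊤ ≤ Submodule.span ℂ S := by
    rw [← hX]
    refine iSup_le fun k v hv => Submodule.subset_span ⟨k, ?_⟩
    rwa [Module.End.mem_eigenspace_iff, Matrix.toLin'_apply] at hv
  let b₀ := Module.Basis.ofSpan hS
  have hb₀ : ∀ i, b₀ i ∈ S := fun i => Module.Basis.ofSpan_subset hS ⟨i, rfl⟩
  have := Module.Finite.finite_basis b₀
  have hcard := Module.finrank_eq_nat_card_basis b₀
  rw [Module.finrank_fin_fun] at hcard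
  let b := b₀.reindex (Finite.equivFinOfCardEq hcard.symm)
  have hb : ∀ i, ∃ k : ℤ, X.mulVec (b i) = (k : ℂ) • b i := by
    intro i
    simp only [b, Module.Basis.reindex_apply]
    exact hb₀ _
  choose d hd using hb
  let P := (Pi.basisFun ℂ (Fin n)).toMatrix b
  have hPinv : IsUnit P := by
    have := (Pi.basisFun ℂ (Fin n)).invertibleToMatrix b
    exact isUnit_of_invertible P
  obtain ⟨Q, hQ⟩ := hPinv
  have hPX : X * Q.1 = Q.1 * Matrix.diagonal fun i => (d i : ℂ) := by
    rw [hQ]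
    ext i j
    have := congrFun (hd j) i
    rw [Matrix.mul_diagonal]
    simp only [P, Module.Basis.toMatrix_apply, Pi.basisFun_repr, Matrix.mul_apply]
    rw [mul_comm]
    exact this
  have hXQ : X = Q.1 * (Matrix.diagonal fun i => (d i : ℂ)) * Q⁻¹.1 := by
    rw [← hPX, mul_assoc, Units.mul_inv, mul_one]
  let D : GL (Fin n) ℂ[T;T⁻¹] :=
    { val := Matrix.diagonal fun i => T (d i)
      inv := Matrix.diagonal fun i => T (-d i)
      val_inv := by
        rw [Matrix.diagonal_mul_diagonal, ← Matrix.diagonal_one]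
        congr 1
        funext i
        rw [← T_add]
        simp
      inv_val := by
        rw [Matrix.diagonal_mul_diagonal, ← Matrix.diagonal_one]
        congr 1
        funext i
        rw [← T_add]
        simp }
  let Q' : GL (Fin n) ℂ[T;T⁻¹] := Matrix.GeneralLinearGroup.map (algebraMap ℂ ℂ[T;T⁻¹]) Q
  have hQ' : ∀ z, evalGL z Q' = Q := fun z => by
    ext1
    exact matrix_evalPoly_const z Q.1
  refine ⟨Q' * D * Q'⁻¹, fun s => ?_⟩
  have hs : s • X = Q.1 * (Matrix.diagonal fun i => s * (d i : ℂ)) * Q⁻¹.1 := by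
    have : (Matrix.diagonal fun i => s * (d i : ℂ)) = s • Matrix.diagonal fun i => (d i : ℂ) := by
      ext i j; simp [Matrix.diagonal]
    rw [this]
    nth_rw 1 [hXQ]
    simp
  rw [map_mul, map_mul, map_inv, hQ', hs, expGL_conj]
  congr 2
  ext1
  rw [coe_expGL, Matrix.exp_diagonal, coe_evalGL]
  ext i j
  by_cases hij : i = j
  · subst hij
    simp [D, evalPoly_T, coe_expUnit, ← Complex.exp_int_mul, Pi.coe_exp, ← Complex.exp_eq_exp_ℂ,
      mul_comm]
  · simp [D, hij]

end Cocharacter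

end OperConn

namespace OperConn

/-! ### Gauge transformation of ∇ by a cocharacter. -/

section Gauge

open LaurentPolynomial
open scoped Matrix.Norms.Operator
open NormedSpace (exp)

variable {n : ℕ}

/-- The hypothesis says that A intertwines X + c with X, and intertwining passes to exponentials. -/
theorem exp_smul_mul {X A : Matrix (Fin n) (Fin n) ℂ} {c : ℂ} (hA : X * A - A * X = c • A) (s : ℂ) :
    exp (s • X) * A = Complex.exp (c * s) • (A * exp (s • X)) := by
  have h0 : X * A = c • A + A * X := sub_eq_iff_eq_add.1 hA
  have h1 : SemiconjBy A (s • X + (s * c) • 1) (s • X) := by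
    change A * (s • X + (s * c) • 1) = s • X * A
    rw [smul_mul_assoc, h0]
    simp only [mul_add, mul_smul_comm, mul_one, smul_add, smul_smul]
    abel
  have h2 := h1.exp_right
  have h3 : exp (s • X + (s * c) • (1 : Matrix (Fin n) (Fin n) ℂ)) =
      Complex.exp (c * s) • exp (s • X) := by
    rw [Matrix.exp_add_of_commute _ _ ((Commute.one_right _).smul_right _)]
    have h4 : exp ((s * c) • (1 : Matrix (Fin n) (Fin n) ℂ)) = Complex.exp (c * s) • 1 := by
      have h5 : (s * c) • (1 : Matrix (Fin n) (Fin n) ℂ) = Matrix.diagonal fun _ => s * c := by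
        rw [Matrix.smul_one_eq_diagonal]
      rw [h5, Matrix.exp_diagonal, Matrix.smul_one_eq_diagonal]
      congr 1
      funext i
      rw [Pi.coe_exp, Complex.exp_eq_exp_ℂ, mul_comm]
    rw [h4, mul_smul_comm, mul_one]
  have h6 : SemiconjBy A (Complex.exp (c * s) • exp (s • X)) (exp (s • X)) := h3 ▸ h2
  rw [← mul_smul_comm]
  exact h6.eq.symm

theorem IsCocharacter.mul_const {K : Subgroup (GL (Fin n) ℂ)} {g : GL (Fin n) ℂ[T;T⁻¹]}
    {X : Matrix (Fin n) (Fin n) ℂ} (hg : IsCocharacter K g X) {A : Matrix (Fin n) (Fin n) ℂ} {m : ℤ}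
    (hA : X * A - A * X = (m : ℂ) • A) :
    g.1 * const ℂ[T;T⁻¹] A = (T m : ℂ[T;T⁻¹]) • (const ℂ[T;T⁻¹] A * g.1) := by
  refine matrix_evalPoly_ext fun z => ?_
  obtain ⟨s, rfl⟩ := expUnit_surjective z
  rw [matrix_evalPoly_mul, matrix_evalPoly_smul, matrix_evalPoly_mul, matrix_evalPoly_const,
    ← coe_evalGL, hg.evalGL_eq, evalPoly_T, coe_expUnit, coe_expGL, ← Complex.exp_int_mul]
  exact exp_smul_mul hA s

theorem IsCocharacter.map_deriv {K : Subgroup (GL (Fin n) ℂ)} {g : GL (Fin n) ℂ[T;T⁻¹]}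
    {X : Matrix (Fin n) (Fin n) ℂ} (hg : IsCocharacter K g X) :
    g.1.map derivPoly = (T (-1) : ℂ[T;T⁻¹]) • (const ℂ[T;T⁻¹] X * g.1) := by
  refine matrix_evalPoly_ext fun z => ?_
  obtain ⟨s, rfl⟩ := expUnit_surjective z
  rw [matrix_evalPoly_smul, matrix_evalPoly_mul, matrix_evalPoly_const,
    ← coe_evalGL, hg.evalGL_eq, evalPoly_T, coe_expUnit]
  ext i j
  have h1 := hasDerivAt_evalGL g s i j
  simp only [hg.evalGL_eq] at h1
  have h2 := h1.unique (hasDerivAt_entry_exp X s i j)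
  rw [Matrix.smul_apply, ← h2, smul_eq_mul, zpow_neg_one, inv_mul_cancel_left₀ (Complex.exp_ne_zero s)]

theorem map_eval₂_const (u : (ℂ[T;T⁻¹])ˣ) (A : Matrix (Fin n) (Fin n) ℂ) :
    (const ℂ[T;T⁻¹] A).map (LaurentPolynomial.eval₂ LaurentPolynomial.C u) = const ℂ[T;T⁻¹] A := by
  ext1 i j
  change LaurentPolynomial.eval₂ LaurentPolynomial.C u (algebraMap ℂ ℂ[T;T⁻¹] (A i j)) =
    algebraMap ℂ ℂ[T;T⁻¹] (A i j)
  rw [← C_eq_algebraMap, eval₂_C]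

theorem pullback_nabla (c : ℂˣ) (m : ℤ) (N E : Matrix (Fin n) (Fin n) ℂ) :
    pullback c m (nabla N E) = (T (-1) : ℂ[T;T⁻¹]) • const ℂ[T;T⁻¹] ((m : ℂ) • N) +
      (T (m - 1) : ℂ[T;T⁻¹]) • const ℂ[T;T⁻¹] ((m * c : ℂ) • E) := by
  have h1 : (nabla N E).map (LaurentPolynomial.eval₂ LaurentPolynomial.C (monomialUnit c m)) =
      ((monomialUnit c m)⁻¹ : (ℂ[T;T⁻¹])ˣ).1 • const ℂ[T;T⁻¹] N + const ℂ[T;T⁻¹] E := by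
    rw [nabla, Matrix.map_add _ (map_add _), map_eval₂_const]
    congr 1
    ext1 i j
    have := congrFun (congrFun (map_eval₂_const (monomialUnit c m) N) i) j
    simp only [Matrix.map_apply] at this
    simp only [Matrix.map_apply, Matrix.smul_apply, smul_eq_mul, map_mul, eval₂_T, zpow_neg_one,
      this]
  have h2 : ∀ (a : ℂ) (A : Matrix (Fin n) (Fin n) ℂ), const ℂ[T;T⁻¹] (a • A) =
      (C a : ℂ[T;T⁻¹]) • const ℂ[T;T⁻¹] A := by
    intro a A
    ext1 i j
    simp only [const, Matrix.map_apply, Matrix.smul_apply, smul_eq_mul, map_mul, C_eq_algebraMap]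
  have h3 : ((monomialUnit c m)⁻¹ : (ℂ[T;T⁻¹])ˣ).1 = C ((c⁻¹ : ℂˣ) : ℂ) * T (-m) := rfl
  have h4 : (monomialUnit c m : ℂ[T;T⁻¹]) = C (c : ℂ) * T m := rfl
  rw [pullback, h1, h2, h2, smul_add, smul_smul, smul_smul, smul_smul, h3, h4, derivPoly_C_mul_T]
  congr 2
  · rw [mul_mul_mul_comm, ← map_mul, ← T_add, mul_comm (T (-1)), mul_assoc (m : ℂ), ← Units.val_mul,
      mul_inv_cancel, Units.val_one, mul_one]
    congr 2
    ring
  · rw [mul_comm]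

theorem const_add (A A' : Matrix (Fin n) (Fin n) ℂ) :
    const ℂ[T;T⁻¹] (A + A') = const ℂ[T;T⁻¹] A + const ℂ[T;T⁻¹] A' := by
  ext1 i j
  exact map_add (algebraMap ℂ ℂ[T;T⁻¹]) _ _

/-- Gauging `d + N dt/t + E dt` by a cocharacter after the substitution `t = u^{-m}`. -/
theorem IsCocharacter.gauge_pullback {K : Subgroup (GL (Fin n) ℂ)} {g : GL (Fin n) ℂ[T;T⁻¹]}
    {X : Matrix (Fin n) (Fin n) ℂ} (hg : IsCocharacter K g X) {N E : Matrix (Fin n) (Fin n) ℂ}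
    {a m : ℤ} (hN : X * N - N * X = ((-a : ℤ) : ℂ) • N)
    (hE : X * E - E * X = ((m - a : ℤ) : ℂ) • E) :
    gauge derivPoly g (pullback 1 (-m) (nabla N E)) =
      -((T (-1 - a) : ℂ[T;T⁻¹]) • const ℂ[T;T⁻¹] ((m : ℂ) • (N + E))) -
        (T (-1) : ℂ[T;T⁻¹]) • const ℂ[T;T⁻¹] X := by
  have hgg : g.1 * g⁻¹.1 = 1 := g.mul_inv
  have h1 : X * (((-m : ℤ) : ℂ) • N) - (((-m : ℤ) : ℂ) • N) * X =
      ((-a : ℤ) : ℂ) • (((-m : ℤ) : ℂ) • N) := by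
    rw [mul_smul_comm, smul_mul_assoc, ← smul_sub, hN, smul_comm]
  have h2 : X * ((((-m : ℤ) : ℂ) * ((1 : ℂˣ) : ℂ)) • E) - ((((-m : ℤ) : ℂ) * ((1 : ℂˣ) : ℂ)) • E) * X =
      ((m - a : ℤ) : ℂ) • ((((-m : ℤ) : ℂ) * ((1 : ℂˣ) : ℂ)) • E) := by
    rw [mul_smul_comm, smul_mul_assoc, ← smul_sub, hE, smul_comm]
  have h3 : (m : ℂ) • (N + E) = -((((-m : ℤ) : ℂ) • N) + ((((-m : ℤ) : ℂ) * ((1 : ℂˣ) : ℂ)) • E)) := by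
    push_cast
    module
  have h4 : ∀ A : Matrix (Fin n) (Fin n) ℂ, const ℂ[T;T⁻¹] (-A) = -const ℂ[T;T⁻¹] A := by
    intro A
    ext1 i j
    exact map_neg (algebraMap ℂ ℂ[T;T⁻¹]) _
  rw [gauge, pullback_nabla, mul_add, mul_smul_comm, mul_smul_comm, hg.mul_const h1, hg.mul_const h2,
    hg.map_deriv, h3, h4, const_add]
  simp only [add_mul, smul_mul_assoc, mul_assoc, hgg, mul_one, smul_smul, ← T_add]
  -- The exponents -1 and -m - 1 of the two terms are shifted by -a and m - a and become equal.
  rw [show (-1 + -a : ℤ) = -1 - a by ring, show (-m - 1 + (m - a) : ℤ) = -1 - a by ring]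
  simp only [smul_neg, smul_add, neg_neg]

end Gauge

end OperConn

namespace OperConn

/-! ### Ideals compared through leading terms at the origin. -/

section LocalIdeals

open MvPolynomial

variable {F : Type} [Fintype F]

/-- The linear part of a polynomial. -/
noncomputable def linPart : MvPolynomial F ℂ →ₗ[ℂ] Module.Dual ℂ (F → ℂ) where
  toFun Q := ∑ p, coeff (Finsupp.single p 1) Q • LinearMap.proj p
  map_add' Q Q' := by simp [add_smul, Finset.sum_add_distrib]
  map_smul' c Q := by simp [mul_smul, Finset.smul_sum]

theorem linPart_apply (Q : MvPolynomial F ℂ) (v : F → ℂ) :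
    linPart Q v = ∑ p, coeff (Finsupp.single p 1) Q * v p := by
  simp [linPart, LinearMap.sum_apply]

theorem linPart_X (p : F) : linPart (X p) = LinearMap.proj p := by
  classical
  refine LinearMap.ext fun v => ?_
  rw [linPart_apply, LinearMap.proj_apply]
  simp [coeff_X, Finsupp.single_left_inj]

theorem mem_idealOfVars_iff {Q : MvPolynomial F ℂ} : Q ∈ idealOfVars F ℂ ↔ coeff 0 Q = 0 := by
  rw [← pow_one (idealOfVars F ℂ), mem_pow_idealOfVars_iff']
  constructor
  · intro h
    exact h 0 (by simp)
  · intro h x hx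
    have : x = 0 := by
      rw [← Finsupp.degree_eq_zero_iff]
      omega
    rw [this, h]

theorem mem_sq_idealOfVars {Q : MvPolynomial F ℂ} (h0 : coeff 0 Q = 0) (h1 : linPart Q = 0) :
    Q ∈ idealOfVars F ℂ ^ 2 := by
  classical
  rw [mem_pow_idealOfVars_iff']
  intro x hx
  rcases Nat.lt_succ_iff_lt_or_eq.1 hx with h | h
  · have : x = 0 := by
      rw [← Finsupp.degree_eq_zero_iff]
      omega
    rw [this, h0]
  · obtain ⟨p, rfl⟩ := (Finsupp.sum_eq_one_iff x).1 h
    have := LinearMap.congr_fun h1 (Pi.single p 1)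
    rw [linPart_apply] at this
    simpa [Pi.single_apply] using this

variable {I J : Ideal (MvPolynomial F ℂ)} {W : Submodule ℂ (F → ℂ)}

/-- The double annihilator theorem, for the space of linear parts of elements of I. -/
theorem exists_linPart_eq (hW : ∀ v, (∀ Q ∈ I, linPart Q v = 0) → v ∈ W)
    {l : Module.Dual ℂ (F → ℂ)} (hl : ∀ w ∈ W, l w = 0) : ∃ Q ∈ I, linPart Q = l := by
  let Λ := (I.restrictScalars ℂ).map linPart
  have h1 : Λ.dualCoannihilator ≤ W := by
    intro v hv
    refine hW v fun Q hQ => ?_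
    rw [Submodule.mem_dualCoannihilator] at hv
    exact hv _ (Submodule.mem_map_of_mem hQ)
  have h2 : l ∈ Λ := by
    rw [← Subspace.dualCoannihilator_dualAnnihilator_eq (W := Λ), Submodule.mem_dualAnnihilator]
    exact fun w hw => hl w (h1 hw)
  exact h2

theorem sub_homogeneousComponent_mem {k : ℕ} {Q : MvPolynomial F ℂ}
    (hQ : Q ∈ idealOfVars F ℂ ^ k) : Q - homogeneousComponent k Q ∈ idealOfVars F ℂ ^ (k + 1) := by
  rw [mem_pow_idealOfVars_iff'] at hQ ⊢
  intro x hx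
  rw [coeff_sub, coeff_homogeneousComponent]
  split_ifs with h
  · rw [sub_self]
  · rw [hQ x (by omega), sub_zero]

/-- The key infinitesimal step: an element of `m ^ k` whose leading part vanishes on the tangent
space of `I` lies in `m ^ (k + 1) + I`. -/
theorem mem_pow_succ_sup (hI0 : ∀ Q ∈ I, coeff 0 Q = 0)
    (hW : ∀ v, (∀ Q ∈ I, linPart Q v = 0) → v ∈ W) {k : ℕ} {Q : MvPolynomial F ℂ}
    (hQ : Q ∈ idealOfVars F ℂ ^ k) (h : ∀ w ∈ W, eval w (homogeneousComponent k Q) = 0) :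
    Q ∈ idealOfVars F ℂ ^ (k + 1) ⊔ I := by
  classical
  set m := idealOfVars F ℂ with hm
  obtain ⟨C', hC'⟩ := Submodule.exists_isCompl W
  let π : (F → ℂ) →ₗ[ℂ] (F → ℂ) := W.subtype ∘ₗ W.projectionOnto C' hC'
  have hπ : ∀ v, π v ∈ W := fun v => (W.projectionOnto C' hC' v).2
  have hπ' : ∀ w ∈ W, π w = w := fun w hw =>
    congrArg Subtype.val (Submodule.projectionOnto_apply_left hC' ⟨w, hw⟩)
  -- The substitution s is P ↦ P ∘ π, with π a projection onto W. It kills the leading part of Q. It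
  -- moves each coordinate by a linear form vanishing on W, which is the linear part of an element
  -- of I; hence it moves elements of m^k only within m^{k+1} + I.
  let z : F → MvPolynomial F ℂ := fun p => ∑ q, C (π (Pi.single q 1) p) * X q
  let s : MvPolynomial F ℂ →ₐ[ℂ] MvPolynomial F ℂ := aeval z
  have hz0 : ∀ p, coeff 0 (z p) = 0 := by
    intro p
    simp [z, coeff_sum]
  have hzlin : ∀ p, linPart (z p) = LinearMap.proj p ∘ₗ π := by
    intro p
    refine LinearMap.pi_ext' fun q => LinearMap.ext_ring ?_
    simp only [z, map_sum, ← smul_eq_C_mul, map_smul, linPart_X]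
    simp [Pi.single_apply, LinearMap.sum_apply]
  have hev : ∀ v (P : MvPolynomial F ℂ), eval v (s P) = eval (π v) P := by
    intro v P
    have hzv : ∀ p, eval v (z p) = π v p := by
      intro p
      simp only [z, map_sum, map_mul, eval_C, eval_X]
      conv_rhs => rw [← Finset.univ_sum_single v, map_sum, Finset.sum_apply]
      refine Finset.sum_congr rfl fun q _ => ?_
      have : (Pi.single q (v q) : F → ℂ) = v q • Pi.single q 1 := by
        rw [← Pi.single_smul, smul_eq_mul, mul_one]
      rw [this, map_smul, Pi.smul_apply, smul_eq_mul, mul_comm]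
    induction P using MvPolynomial.induction_on with
    | C a => simp [s]
    | add p q hp hq => simp only [map_add, hp, hq]
    | mul_X p i hp => simp only [map_mul, hp, s, aeval_X, hzv, eval_X]
  have hsm : m.map s ≤ m := by
    rw [hm, Ideal.map_le_iff_le_comap, idealOfVars, Ideal.span_le]
    rintro _ ⟨p, rfl⟩
    change s (X p) ∈ idealOfVars F ℂ
    rw [mem_idealOfVars_iff]
    simp only [s, aeval_X, hz0]
  have hspow : ∀ k P, P ∈ m ^ k → s P ∈ m ^ k := by
    intro k P hP
    have := Ideal.mem_map_of_mem s hP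
    rw [Ideal.map_pow] at this
    exact Ideal.pow_right_mono hsm k this
  have hsc : ∀ P, s P - P ∈ m := by
    intro P
    have h1 : P - C (coeff 0 P) ∈ m := by rw [hm, mem_idealOfVars_iff]; simp
    have h2 := hsm (Ideal.mem_map_of_mem s h1)
    have h3 : s (C (coeff 0 P)) = C (coeff 0 P) := by simp [s]
    rw [map_sub, h3] at h2
    simpa using m.sub_mem h2 h1
  have hsX : ∀ P ∈ m, s P - P ∈ m ^ 2 ⊔ I := by
    intro P hP
    rw [hm, idealOfVars, ← Ideal.submodule_span_eq] at hP
    induction hP using Submodule.span_induction with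
    | mem P hP =>
      obtain ⟨p, rfl⟩ := hP
      obtain ⟨f, hf, hfl⟩ := exists_linPart_eq (I := I) (W := W) hW
        (l := LinearMap.proj p ∘ₗ π - LinearMap.proj p) (fun w hw => by simp [hπ' w hw])
      have h1 : s (X p) - X p = (z p - X p - f) + f := by simp [s]
      rw [h1]
      refine Submodule.add_mem_sup (mem_sq_idealOfVars ?_ ?_) hf
      · simp [hz0, hI0 f hf]
      · simp [hzlin, linPart_X, hfl]
    | zero => simp
    | add P P' _ _ hP hP' =>
      rw [map_add, add_sub_add_comm]
      exact add_mem hP hP'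
    | smul a P hPm hP =>
      have hPm' : P ∈ m := hPm
      have h1 : s (a • P) - a • P = (s a - a) * s P + a * (s P - P) := by
        simp only [smul_eq_mul, map_mul]; ring
      rw [h1]
      refine add_mem (Ideal.mem_sup_left ?_) (Ideal.mul_mem_left _ _ hP)
      rw [pow_two]
      exact Ideal.mul_mem_mul (hsc a) (hsm (Ideal.mem_map_of_mem s hPm'))
  have hmulsup : ∀ (i j : ℕ) (a c : MvPolynomial F ℂ), a ∈ m ^ i ⊔ I → c ∈ m ^ j →
      a * c ∈ m ^ (i + j) ⊔ I := by
    intro i j a c ha hc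
    obtain ⟨a1, ha1, a2, ha2, rfl⟩ := Submodule.mem_sup.1 ha
    rw [add_mul]
    refine Submodule.add_mem_sup ?_ (Ideal.mul_mem_right _ _ ha2)
    rw [pow_add]
    exact Ideal.mul_mem_mul ha1 hc
  have hsk : s Q - Q ∈ m ^ (k + 1) ⊔ I := by
    refine Submodule.pow_induction_on_left' m (C := fun k x _ => s x - x ∈ m ^ (k + 1) ⊔ I)
      ?_ ?_ ?_ hQ
    · intro r
      exact Ideal.mem_sup_left (by simpa using hsc r)
    · intro x y i _ _ hx hy
      rw [map_add, add_sub_add_comm]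
      exact add_mem hx hy
    · intro a ha i x hx hxs
      have h1 : s (a * x) - a * x = (s a - a) * s x + (s x - x) * a := by
        rw [map_mul]; ring
      rw [h1]
      refine add_mem ?_ ?_
      · have := hmulsup 2 i _ _ (hsX a ha) (hspow i x hx)
        rwa [show i.succ + 1 = 2 + i by omega]
      · have := hmulsup (i + 1) 1 _ _ hxs (by rwa [pow_one])
        exact this
  have hsQ : s Q ∈ m ^ (k + 1) := by
    have h1 : s (homogeneousComponent k Q) = 0 := by
      refine MvPolynomial.funext fun v => ?_
      rw [hev, map_zero]
      exact h _ (hπ v)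
    have h2 := hspow _ _ (sub_homogeneousComponent_mem hQ)
    rwa [map_sub, h1, sub_zero] at h2
  have : Q = s Q - (s Q - Q) := by ring
  rw [this]
  exact sub_mem (Ideal.mem_sup_left hsQ) hsk

/-- If `I ≤ J` have, in the sense of leading terms, the same tangent cone at the origin then they
agree near the origin. -/
theorem exists_mul_mem_of_leading (hI0 : ∀ Q ∈ I, coeff 0 Q = 0)
    (hW : ∀ v, (∀ Q ∈ I, linPart Q v = 0) → v ∈ W) (hIJ : I ≤ J)
    (hJ : ∀ Q ∈ J, ∀ k, Q ∈ idealOfVars F ℂ ^ k → ∀ w ∈ W, eval w (homogeneousComponent k Q) = 0)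
    {Q : MvPolynomial F ℂ} (hQ : Q ∈ J) : ∃ a, coeff 0 a = 1 ∧ a * Q ∈ I := by
  have key : ∀ k, Q ∈ idealOfVars F ℂ ^ k ⊔ I := by
    intro k
    induction k with
    | zero => simp
    | succ k ih =>
      obtain ⟨Q', hQ', f, hf, rfl⟩ := Submodule.mem_sup.1 ih
      have h1 : Q' ∈ J := by simpa using J.sub_mem hQ (hIJ hf)
      have h2 := mem_pow_succ_sup hI0 hW hQ' (hJ Q' h1 k hQ')
      exact add_mem h2 (Ideal.mem_sup_right hf)
  -- Krull's intersection theorem: an element of all m^k modulo I is fixed by some r in m, so 1 - r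
  -- kills it.
  have h3 : (Ideal.Quotient.mk I Q) ∈
      (⨅ i : ℕ, idealOfVars F ℂ ^ i • ⊤ : Submodule (MvPolynomial F ℂ) (MvPolynomial F ℂ ⧸ I)) := by
    rw [Submodule.mem_iInf]
    intro i
    obtain ⟨Q', hQ', f, hf, hs⟩ := Submodule.mem_sup.1 (key i)
    have h4 : Ideal.Quotient.mk I Q = Q' • (1 : MvPolynomial F ℂ ⧸ I) := by
      rw [← hs, map_add, Ideal.Quotient.eq_zero_iff_mem.2 hf, add_zero]
      change _ = Ideal.Quotient.mk I (Q' * 1)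
      rw [mul_one]
    rw [h4]
    exact Submodule.smul_mem_smul hQ' trivial
  rw [Ideal.mem_iInf_smul_pow_eq_bot_iff] at h3
  obtain ⟨⟨r, hr⟩, hrQ⟩ := h3
  refine ⟨1 - r, ?_, ?_⟩
  · rw [mem_idealOfVars_iff] at hr
    simp [hr]
  · rw [← Ideal.Quotient.eq_zero_iff_mem, sub_mul, one_mul, map_sub, sub_eq_zero]
    exact hrQ.symm

end LocalIdeals

end OperConn

namespace OperConn

/-! ### A closed subgroup with the full Lie algebra is everything. -/

section OpenSubgroup

open MvPolynomial
open scoped Matrix.Norms.Operator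
open NormedSpace (exp)

variable {n : ℕ} {G K : Subgroup (GL (Fin n) ℂ)}

/-- The polynomials `Q` such that `Q (g - 1) = 0` for all `g` in the group. -/
noncomputable def shiftedIdeal (K : Subgroup (GL (Fin n) ℂ)) :
    Ideal (MvPolynomial (Fin n × Fin n) ℂ) :=
  vanishingIdeal ℂ ((fun g : GL (Fin n) ℂ => fun p : Fin n × Fin n =>
    (g.1 - 1 : Matrix (Fin n) (Fin n) ℂ) p.1 p.2) '' (K : Set (GL (Fin n) ℂ)))

theorem mem_shiftedIdeal {Q : MvPolynomial (Fin n × Fin n) ℂ} :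
    Q ∈ shiftedIdeal K ↔ ∀ g ∈ K, eval (fun p : Fin n × Fin n =>
      (g.1 - 1 : Matrix (Fin n) (Fin n) ℂ) p.1 p.2) Q = 0 := by
  simp [shiftedIdeal, mem_vanishingIdeal_iff]

/-- The substitution `f ↦ (Y ↦ f (g + g Y))`. -/
noncomputable def translate (g : Matrix (Fin n) (Fin n) ℂ) :
    MvPolynomial (Fin n × Fin n) ℂ →ₐ[ℂ] MvPolynomial (Fin n × Fin n) ℂ :=
  aeval fun p => ∑ k, C (g p.1 k) * (C ((1 : Matrix (Fin n) (Fin n) ℂ) k p.2) + X (k, p.2))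

theorem eval_translate (g Y : Matrix (Fin n) (Fin n) ℂ) (f : MvPolynomial (Fin n × Fin n) ℂ) :
    eval (fun p : Fin n × Fin n => Y p.1 p.2) (translate g f) =
      aeval (fun p : Fin n × Fin n => (g * (1 + Y)) p.1 p.2) f := by
  induction f using MvPolynomial.induction_on with
  | C a => simp [translate]
  | add p q hp hq => simp only [map_add, hp, hq]
  | mul_X p i hp =>
    simp only [map_mul, hp, aeval_X]
    congr 1
    simp [translate, Matrix.mul_apply]

theorem hasDerivAt_eval_smul (Y : Matrix (Fin n) (Fin n) ℂ) (Q : MvPolynomial (Fin n × Fin n) ℂ) :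
    HasDerivAt (fun s : ℂ => eval (fun p : Fin n × Fin n => (s • Y) p.1 p.2) Q)
      (linPart Q fun p => Y p.1 p.2) 0 := by
  classical
  rw [linPart_apply]
  induction Q using MvPolynomial.induction_on with
  | C a =>
    have h1 : ∀ p : Fin n × Fin n, coeff (Finsupp.single p 1) (C a : MvPolynomial (Fin n × Fin n) ℂ) = 0 :=
      fun p => coeff_C_of_ne_zero (by simp) a
    simpa [h1] using hasDerivAt_const (0 : ℂ) a
  | add p q hp hq =>
    simp only [map_add, coeff_add, add_mul, Finset.sum_add_distrib]
    exact hp.add hq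
  | mul_X q i hq =>
    have h1 : HasDerivAt (fun s : ℂ => (s • Y) i.1 i.2) (Y i.1 i.2) 0 := by
      simpa using (hasDerivAt_id (0 : ℂ)).mul_const (Y i.1 i.2)
    have h2 := hq.mul h1
    simp only [map_mul, eval_X]
    refine h2.congr_deriv ?_
    have h3 : (fun p : Fin n × Fin n => ((0 : ℂ) • Y) p.1 p.2) = 0 := by
      funext p; simp
    rw [h3, eval_zero]
    have h4 : ∀ p : Fin n × Fin n, coeff (Finsupp.single p 1) (q * X i) =
        if p = i then constantCoeff q else 0 := by
      intro p
      rw [coeff_mul_X']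
      by_cases hp : p = i
      · subst hp; simp [constantCoeff_eq]
      · have : i ∉ (Finsupp.single p 1 : (Fin n × Fin n) →₀ ℕ).support := by
          simp only [Finsupp.mem_support_iff, Finsupp.single_apply, if_neg hp, ne_eq, not_true_eq_false,
            not_false_eq_true]
        rw [if_neg this, if_neg hp]
    simp [h4]

/-- Translation by g in K carries the tangency condition at 1 to every point of K. -/
theorem mem_lieAlg_of_linPart_eq_zero {Y : Matrix (Fin n) (Fin n) ℂ}
    (h : ∀ Q ∈ shiftedIdeal K, linPart Q (fun p => Y p.1 p.2) = 0) : Y ∈ lieAlg K := by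
  intro f hf
  rw [mem_idealOf]
  intro g hg
  have h1 : translate g.1 f ∈ shiftedIdeal K := by
    rw [mem_shiftedIdeal]
    intro k hk
    rw [eval_translate, add_sub_cancel]
    exact mem_idealOf.1 hf (g * k) (K.mul_mem hg hk)
  have h2 := hasDerivAt_eval_smul Y (translate g.1 f)
  rw [h _ h1] at h2
  simp only [eval_translate] at h2
  have h3 : ∀ i j, HasDerivAt (fun s : ℂ => (g.1 * (1 + s • Y)) i j)
      ((g.1 * (1 + (0 : ℂ) • Y) * Y) i j) 0 := by
    intro i j
    have h4 : ∀ s : ℂ, (g.1 * (1 + s • Y)) i j = g.1 i j + s * (g.1 * Y) i j := by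
      intro s
      simp [mul_add]
    simp only [h4]
    simpa using ((hasDerivAt_id (0 : ℂ)).mul_const ((g.1 * Y) i j)).const_add (g.1 i j)
  have h5 := (hasDerivAt_aeval h3 f).unique h2
  have h6 : coords g = fun p : Fin n × Fin n => (g.1 * (1 + (0 : ℂ) • Y)) p.1 p.2 := by
    simp only [zero_smul, add_zero, mul_one]
    rfl
  rw [h6]
  exact h5

theorem eval_smul_homogeneous {F : Type} [Fintype F] (s : ℂ) (v : F → ℂ) {k : ℕ}
    {Q : MvPolynomial F ℂ} (hQ : Q.IsHomogeneous k) :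
    eval (fun p => s * v p) Q = s ^ k * eval v Q := by
  rw [eval_eq', eval_eq', Finset.mul_sum]
  refine Finset.sum_congr rfl fun d hd => ?_
  have : ∑ i, d i = k := by
    have h1 := hQ (mem_support_iff.1 hd)
    rw [← h1, Finsupp.weight_apply, Finsupp.sum_fintype]
    · simp
    · simp
  simp only [mul_pow, Finset.prod_mul_distrib, Finset.prod_pow_eq_pow_sum, this]
  ring

/-- If `Q ∈ m ^ k` vanishes along `exp (s Y) - 1` then its leading part vanishes at `Y`. -/
theorem eval_homogeneousComponent_eq_zero {Y : Matrix (Fin n) (Fin n) ℂ} {k : ℕ}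
    {Q : MvPolynomial (Fin n × Fin n) ℂ} (hQ : Q ∈ idealOfVars (Fin n × Fin n) ℂ ^ k)
    (h : ∀ s : ℂ, eval (fun p : Fin n × Fin n =>
      (exp (s • Y) - 1 : Matrix (Fin n) (Fin n) ℂ) p.1 p.2) Q = 0) :
    eval (fun p : Fin n × Fin n => Y p.1 p.2) (homogeneousComponent k Q) = 0 := by
  let w : ℂ → Fin n × Fin n → ℂ := fun s p =>
    s⁻¹ * (exp (s • Y) - 1 : Matrix (Fin n) (Fin n) ℂ) p.1 p.2
  have hw : Filter.Tendsto w (nhdsWithin 0 {0}ᶜ) (nhds fun p => Y p.1 p.2) := by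
    rw [tendsto_pi_nhds]
    intro p
    have h1 := hasDerivAt_entry_exp Y 0 p.1 p.2
    rw [hasDerivAt_iff_tendsto_slope] at h1
    have h2 : slope (fun s : ℂ => (expGL (s • Y)).1 p.1 p.2) 0 = fun s => w s p := by
      funext s
      simp only [slope_def_field, sub_zero, zero_smul, w, Matrix.sub_apply, coe_expGL,
        NormedSpace.exp_zero]
      rw [div_eq_inv_mul]
    rw [h2] at h1
    simpa [expGL_zero] using h1
  have hcomp : ∀ j, j < k → homogeneousComponent j Q = 0 := by
    intro j hj
    refine homogeneousComponent_eq_zero' _ _ fun d hd hdj => ?_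
    have := (mem_pow_idealOfVars_iff _ _).1 hQ d hd
    omega
  set N := Q.totalDegree + k + 1 with hN
  have hsum : Q = ∑ j ∈ Finset.range (k + (N - k)), homogeneousComponent j Q := by
    conv_lhs => rw [← sum_homogeneousComponent Q]
    refine Finset.sum_subset (fun j hj => ?_) (fun j _ hj => ?_)
    · rw [Finset.mem_range] at hj ⊢; omega
    · refine homogeneousComponent_eq_zero _ _ ?_
      rw [Finset.mem_range] at hj; omega
  have hsum' : Q = ∑ i ∈ Finset.range (N - k), homogeneousComponent (k + i) Q := by
    conv_lhs => rw [hsum, Finset.sum_range_add]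
    rw [Finset.sum_eq_zero (fun j hj => hcomp j (Finset.mem_range.1 hj)), zero_add]
  -- This is Q(exp(sY) - 1) divided by s^k. It is zero for s ≠ 0, and since w s tends to Y it tends
  -- to the leading part at Y.
  let φ : ℂ → ℂ := fun s => ∑ i ∈ Finset.range (N - k), s ^ i * eval (w s) (homogeneousComponent (k + i) Q)
  have hφ0 : ∀ s : ℂ, s ≠ 0 → φ s = 0 := by
    intro s hs
    have h1 := h s
    have h2 : (fun p : Fin n × Fin n => (exp (s • Y) - 1 : Matrix (Fin n) (Fin n) ℂ) p.1 p.2) =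
        fun p => s * w s p := by
      funext p
      simp only [w]
      rw [mul_inv_cancel_left₀ hs]
    rw [h2, hsum', map_sum] at h1
    have h3 : s ^ k * φ s = 0 := by
      rw [← h1, Finset.mul_sum]
      refine Finset.sum_congr rfl fun i _ => ?_
      rw [eval_smul_homogeneous s (w s) (homogeneousComponent_isHomogeneous _ _), pow_add, mul_assoc]
    exact (mul_eq_zero.1 h3).resolve_left (pow_ne_zero k hs)
  have hcont : ∀ P : MvPolynomial (Fin n × Fin n) ℂ, Filter.Tendsto (fun s => eval (w s) P)
      (nhdsWithin 0 {0}ᶜ) (nhds (eval (fun p : Fin n × Fin n => Y p.1 p.2) P)) := fun P =>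
    ((MvPolynomial.continuous_eval P).tendsto _).comp hw
  have hlim : Filter.Tendsto φ (nhdsWithin 0 {0}ᶜ) (nhds (∑ i ∈ Finset.range (N - k),
      (0 : ℂ) ^ i * eval (fun p : Fin n × Fin n => Y p.1 p.2) (homogeneousComponent (k + i) Q))) := by
    refine tendsto_finsetSum _ fun i _ => Filter.Tendsto.mul ?_ (hcont _)
    exact ((continuous_pow i).tendsto 0).mono_left nhdsWithin_le_nhds
  have hlim' : Filter.Tendsto φ (nhdsWithin 0 {0}ᶜ) (nhds 0) := by
    refine tendsto_const_nhds.congr' ?_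
    filter_upwards [self_mem_nhdsWithin] with s hs
    exact (hφ0 s hs).symm
  have := tendsto_nhds_unique hlim hlim'
  rw [Finset.sum_eq_single_of_mem 0 (Finset.mem_range.2 (by omega))] at this
  · simpa using this
  · intro i _ hi
    rw [zero_pow hi, zero_mul]

theorem eval_homogeneousComponent_of_mem (hK : IsZariskiClosed (K : Set (GL (Fin n) ℂ)))
    {Q : MvPolynomial (Fin n × Fin n) ℂ} (hQ : Q ∈ shiftedIdeal K) {Y : Matrix (Fin n) (Fin n) ℂ}
    (hY : Y ∈ lieAlg K) {k : ℕ} (hk : Q ∈ idealOfVars (Fin n × Fin n) ℂ ^ k) :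
    eval (fun p : Fin n × Fin n => Y p.1 p.2) (homogeneousComponent k Q) = 0 := by
  refine eval_homogeneousComponent_eq_zero hk fun s => ?_
  have h := mem_shiftedIdeal.1 hQ (expGL (s • Y)) ((mem_lieAlg_iff hK).1 hY s)
  rwa [coe_expGL] at h

/-- The common zeros of the linear parts for G lie in Lie G, hence in Lie K, where the leading parts
of all polynomials for K vanish through one-parameter groups. So near 1 the two ideals agree. -/
theorem exists_mul_mem_shiftedIdeal (hK : IsZariskiClosed (K : Set (GL (Fin n) ℂ))) (hKG : K ≤ G)
    (hlie : ∀ X ∈ lieAlg G, X ∈ lieAlg K) {Q : MvPolynomial (Fin n × Fin n) ℂ}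
    (hQ : Q ∈ shiftedIdeal K) : ∃ a, coeff 0 a = 1 ∧ a * Q ∈ shiftedIdeal G := by
  have h00 : (fun p : Fin n × Fin n =>
      ((1 : GL (Fin n) ℂ).1 - 1 : Matrix (Fin n) (Fin n) ℂ) p.1 p.2) = 0 := by
    funext p; simp
  let u : (Fin n × Fin n → ℂ) →ₗ[ℂ] Matrix (Fin n) (Fin n) ℂ :=
    { toFun := fun v => Matrix.of fun i j => v (i, j)
      map_add' := fun _ _ => rfl
      map_smul' := fun _ _ => rfl }
  have hu : ∀ v, (fun p : Fin n × Fin n => (u v) p.1 p.2) = v := fun v => rfl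
  refine exists_mul_mem_of_leading (W := (lieAlg G).toSubmodule.comap u) ?_ ?_ ?_ ?_ hQ
  · intro Q hQ
    have := mem_shiftedIdeal.1 hQ 1 G.one_mem
    rwa [h00, eval_zero] at this
  · intro v hv
    refine mem_lieAlg_of_linPart_eq_zero (Y := u v) fun Q hQ => ?_
    rw [hu]
    exact hv Q hQ
  · exact fun Q hQ => mem_shiftedIdeal.2 fun g hg => mem_shiftedIdeal.1 hQ g (hKG hg)
  · intro Q hQ k hk w hw
    have h1 := eval_homogeneousComponent_of_mem hK hQ (hlie _ hw) hk
    rwa [hu] at h1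

/-- A closed subgroup with the same Lie algebra as the connected group `G` is `G`. -/
theorem eq_of_lieAlg_le (hG : IsZariskiConnected (G : Set (GL (Fin n) ℂ)))
    (hGc : IsZariskiClosed (G : Set (GL (Fin n) ℂ)))
    (hK : IsZariskiClosed (K : Set (GL (Fin n) ℂ))) (hKG : K ≤ G)
    (hlie : ∀ X ∈ lieAlg G, X ∈ lieAlg K) : K = G := by
  classical
  -- The ideal is finitely generated, so the product of the multipliers of its generators serves all
  -- elements.
  obtain ⟨b, hb0, hb⟩ : ∃ b, coeff 0 b = 1 ∧ ∀ Q ∈ shiftedIdeal K, b * Q ∈ shiftedIdeal G := by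
    obtain ⟨S, hS⟩ := (inferInstance : IsNoetherianRing (MvPolynomial (Fin n × Fin n) ℂ)).noetherian
      (shiftedIdeal K)
    have hSK : ∀ Q ∈ S, Q ∈ shiftedIdeal K := fun Q hQ => hS ▸ Submodule.subset_span hQ
    choose! a ha using fun Q (hQ : Q ∈ S) => exists_mul_mem_shiftedIdeal hK hKG hlie (hSK Q hQ)
    refine ⟨∏ Q ∈ S, a Q, ?_, ?_⟩
    · rw [← constantCoeff_eq, map_prod]
      exact Finset.prod_eq_one fun Q hQ => (ha Q hQ).1
    · intro Q hQ
      rw [← hS] at hQ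
      induction hQ using Submodule.span_induction with
      | mem Q hQ =>
        rw [← Finset.prod_erase_mul S a hQ, mul_assoc]
        exact Ideal.mul_mem_left _ _ (ha Q hQ).2
      | zero => simp
      | add Q Q' _ _ h h' => rw [mul_add]; exact add_mem h h'
      | smul c Q _ h =>
        rw [smul_eq_mul, mul_left_comm]
        exact Ideal.mul_mem_left _ _ h
  let bv : GL (Fin n) ℂ → ℂ := fun g => eval (fun p : Fin n × Fin n =>
    (g.1 - 1 : Matrix (Fin n) (Fin n) ℂ) p.1 p.2) b
  have hbK : ∀ g ∈ G, bv g ≠ 0 → g ∈ K := by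
    intro g hg hne
    rw [mem_iff_idealOf hK]
    intro f hf
    have h1 : translate 1 f ∈ shiftedIdeal K := by
      rw [mem_shiftedIdeal]
      intro k hk
      rw [eval_translate, one_mul, add_sub_cancel]
      exact mem_idealOf.1 hf k hk
    have h2 := mem_shiftedIdeal.1 (hb _ h1) g hg
    rw [map_mul, eval_translate, one_mul, add_sub_cancel] at h2
    exact (mul_eq_zero.1 h2).resolve_left hne
  have hb1 : bv 1 = 1 := by
    have h00 : (fun p : Fin n × Fin n =>
        ((1 : GL (Fin n) ℂ).1 - 1 : Matrix (Fin n) (Fin n) ℂ) p.1 p.2) = 0 := by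
      funext p; simp
    simp only [bv]
    rw [h00, eval_zero]
    exact hb0
  -- Where b ≠ 0, G lies in K; translates of this neighborhood of 1 cover K. So Z₂ is the complement
  -- of K in G, it is closed, and connectedness of G makes it empty.
  let Z₂ : Set (GL (Fin n) ℂ) := G ∩ {g | ∀ k ∈ K, bv (k⁻¹ * g) = 0}
  have hZ₂ : IsZariskiClosed Z₂ := by
    refine hGc.inter ⟨{f | ∃ k ∈ K, f = aeval (fun p : Fin n × Fin n =>
      ∑ l, C (k⁻¹.1 p.1 l) * X (l, p.2) - C ((1 : Matrix (Fin n) (Fin n) ℂ) p.1 p.2)) b}, ?_⟩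
    have key : ∀ k g : GL (Fin n) ℂ, aeval (coords g) (aeval (fun p : Fin n × Fin n =>
        (∑ l, C (k⁻¹.1 p.1 l) * X (l, p.2) - C ((1 : Matrix (Fin n) (Fin n) ℂ) p.1 p.2) :
          MvPolynomial (Fin n × Fin n) ℂ)) b) = bv (k⁻¹ * g) := by
      intro k g
      simp only [bv]
      generalize b = f
      induction f using MvPolynomial.induction_on with
      | C a => simp
      | add p q hp hq => simp only [map_add, hp, hq]
      | mul_X p i hp =>
        simp only [map_mul, hp, aeval_X, eval_X]
        congr 1
        simp [Matrix.mul_apply, coords]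
    ext g
    constructor
    · rintro h f ⟨k, hk, rfl⟩
      rw [key]
      exact h k hk
    · intro h k hk
      rw [← key]
      exact h _ ⟨k, hk, rfl⟩
  have hun : (K : Set (GL (Fin n) ℂ)) ∪ Z₂ = G := by
    ext g
    constructor
    · rintro (h | h)
      · exact hKG h
      · exact h.1
    · intro hg
      by_cases hgK : g ∈ K
      · exact Or.inl hgK
      · refine Or.inr ⟨hg, fun k hk => ?_⟩
        by_contra hne
        have := hbK _ (G.mul_mem (G.inv_mem (hKG hk)) hg) hne
        exact hgK (by simpa using K.mul_mem hk this)
  have hint : (K : Set (GL (Fin n) ℂ)) ∩ Z₂ = ∅ := by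
    ext g
    simp only [Set.mem_inter_iff, Set.mem_empty_iff_false, iff_false]
    rintro ⟨hg, -, h⟩
    have := h g hg
    rw [inv_mul_cancel, hb1] at this
    exact one_ne_zero this
  rcases hG.2 _ _ hK hZ₂ hun hint with h | h
  · exact absurd h (Set.nonempty_iff_ne_empty.1 ⟨1, K.one_mem⟩)
  · rw [h, Set.union_empty] at hun
    exact SetLike.coe_injective hun

end OpenSubgroup

end OperConn

namespace OperConn

/-! ### Integrality of 2ρ, and of ρ for adjoint groups. -/

section RhoMatrix

open LieAlgebra LieAlgebra.IsKilling Module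
open NormedSpace (exp)

variable {n : ℕ} {G : Subgroup (GL (Fin n) ℂ)} [IsSimpleAlgebraicGroup G]
  {H : LieSubalgebra ℂ (lieAlg G)} [H.IsCartanSubalgebra]
  {b : (rootSystem H).Base} {T : Subgroup (GL (Fin n) ℂ)}
  {x : b.support → lieAlg G}

theorem rho_mul_sub {v : lieAlg G} {k : ℤ} (hv : v ∈ deg b k) :
    (rhoCheck b).1.1 * v.1 - v.1 * (rhoCheck b).1.1 = (k : ℂ) • v.1 := by
  rw [← lieAlg_lie_coe, mem_deg.1 hv]
  rfl

theorem mem_lieAlg_of_mem {𝔨 : Submodule ℂ (lieAlg G)} {K : Subgroup (GL (Fin n) ℂ)}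
    (hK : IsConnectedSubgroupWithLie G K 𝔨) {v : lieAlg G} : v.1 ∈ lieAlg K ↔ v ∈ 𝔨 := by
  have h : v.1 ∈ (lieAlg K).toSubmodule ↔ v ∈ 𝔨 := by
    rw [hK.lie_eq]
    constructor
    · rintro ⟨w, hw, hwv⟩
      rwa [← Subtype.ext hwv]
    · exact fun hv => ⟨v, hv, rfl⟩
  exact h

/-- 2ρ is the middle element of the principal sl₂-triple, whose matrices act on ℂⁿ. -/
theorem iSup_eigenspace_two_rho
    (hx : ∀ i : b.support, x i ∈ rootSpace H (-(i.1.1 : H → ℂ)) ∧ x i ≠ 0) :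
    ⨆ k : ℤ, Module.End.eigenspace (Matrix.toLin' ((2 : ℂ) • (rhoCheck b).1.1)) (k : ℂ) = ⊤ := by
  obtain ⟨e, he, hs⟩ := exists_principal_sl2 hx
  set f := ∑ i, x i
  have h1 := congrArg Subtype.val hs.lie_e_f
  have h2 := congrArg Subtype.val hs.lie_h_e_nsmul
  have h3 := congrArg Subtype.val hs.lie_h_f_nsmul
  rw [lieAlg_lie_coe] at h1 h2 h3
  refine sl2_iSup_eigenspace (e := Matrix.toLin' e.1) (f := Matrix.toLin' f.1) ?_ ?_ ?_
  · have := congrArg Matrix.toLin' h2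
    simp only [map_sub, Matrix.toLin'_mul] at this
    refine this.trans ?_
    have h4 : (2 • e : lieAlg G).1 = (2 : ℂ) • e.1 := by rw [two_smul, two_smul]; rfl
    rw [h4, map_smul]
  · have := congrArg Matrix.toLin' h3
    simp only [map_sub, Matrix.toLin'_mul] at this
    refine this.trans ?_
    have h4 : (-(2 • f) : lieAlg G).1 = (-2 : ℂ) • f.1 := by
      rw [neg_smul, two_smul, two_smul]; rfl
    rw [h4, map_smul]
  · have := congrArg Matrix.toLin' h1
    simp only [map_sub, Matrix.toLin'_mul] at this
    exact this

theorem exists_isCocharacter_two_rho (hT : IsConnectedSubgroupWithLie G T H.toSubmodule)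
    (hx : ∀ i : b.support, x i ∈ rootSpace H (-(i.1.1 : H → ℂ)) ∧ x i ≠ 0) :
    ∃ g, IsCocharacter T g ((2 : ℂ) • (rhoCheck b).1.1) := by
  obtain ⟨g, hg⟩ := exists_evalGL_eq (iSup_eigenspace_two_rho hx)
  refine ⟨g, isCocharacter_of_evalGL_eq hT.isClosed ?_ hg⟩
  exact (lieAlg T).smul_mem 2 ((mem_lieAlg_of_mem hT).2 (rhoCheck b).2)

theorem exp_mulVec {X : Matrix (Fin n) (Fin n) ℂ} {v : Fin n → ℂ} {c : ℂ} (h : X.mulVec v = c • v) :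
    (exp X).mulVec v = Complex.exp c • v := by
  -- The matrix with all columns equal to v turns the eigenvector equation into an intertwining
  -- relation.
  have h1 : SemiconjBy (Matrix.of fun i (_ : Fin n) => v i) (Matrix.diagonal fun _ => c) X := by
    change _ * _ = X * _
    ext i j
    rw [Matrix.mul_diagonal]
    have := congrFun h i
    simp only [Matrix.mulVec, dotProduct, Pi.smul_apply, smul_eq_mul] at this
    simp only [Matrix.mul_apply, Matrix.of_apply, this]
    ring
  open scoped Matrix.Norms.Operator in
  have h2 : (Matrix.of fun i (_ : Fin n) => v i) * exp (Matrix.diagonal fun _ => c) =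
      exp X * Matrix.of fun i (_ : Fin n) => v i := (SemiconjBy.exp_right h1).eq
  rw [Matrix.exp_diagonal] at h2
  funext i
  have h3 := congrFun (congrFun h2 i) i
  rw [Matrix.mul_diagonal] at h3
  simp only [Matrix.mulVec, dotProduct, Pi.smul_apply, smul_eq_mul]
  simp only [Matrix.mul_apply, Matrix.of_apply] at h3
  rw [← h3, Complex.exp_eq_exp_ℂ, mul_comm]
  open scoped Matrix.Norms.Operator in
  rw [Pi.coe_exp]

/-- For a group of adjoint type `ρ` is a cocharacter. -/
theorem exists_isCocharacter_rho (hT : IsConnectedSubgroupWithLie G T H.toSubmodule)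
    (hx : ∀ i : b.support, x i ∈ rootSpace H (-(i.1.1 : H → ℂ)) ∧ x i ≠ 0)
    (hG : IsAdjointType G) : ∃ g, IsCocharacter T g ((rhoCheck b).1.1) := by
  have hGc := IsSimpleAlgebraicGroup.isClosed (G := G)
  set ρ := (rhoCheck b).1.1 with hρ
  have hρG : ρ ∈ lieAlg G := (rhoCheck b).1.2
  set s : ℂ := 2 * Real.pi * Complex.I with hs
  set z : GL (Fin n) ℂ := expGL (s • ρ) with hz
  have hzG : z ∈ G := (mem_lieAlg_iff hGc).1 hρG s
  -- The eigenvalues of ad ρ are integers, so conjugation by exp(2πiρ) is trivial on 𝔤.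
  have hcomm : ∀ v : lieAlg G, v.1 * z.1 = z.1 * v.1 := by
    intro v
    have hv : v ∈ ⨆ k, deg b k := by rw [iSup_deg]; trivial
    induction hv using Submodule.iSup_induction' with
    | mem k v hv =>
      have h1 := exp_smul_mul (rho_mul_sub hv) s
      rw [show (k : ℂ) * s = k * (2 * Real.pi * Complex.I) from rfl, Complex.exp_int_mul_two_pi_mul_I,
        one_smul] at h1
      exact h1.symm
    | zero => simp
    | add v w _ _ hv hw =>
      change (v.1 + w.1) * z.1 = z.1 * (v.1 + w.1)
      rw [add_mul, mul_add, hv, hw]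
  have hKc : IsZariskiClosed ((G ⊓ Subgroup.centralizer {z} : Subgroup _) : Set (GL (Fin n) ℂ)) := by
    rw [Subgroup.coe_inf]
    exact hGc.inter (isZariskiClosed_centralizer z)
  have hK := eq_of_lieAlg_le IsSimpleAlgebraicGroup.isConnected hGc hKc inf_le_left fun X hX =>
    (mem_lieAlg_inf_centralizer hGc).2 ⟨hX, hcomm ⟨X, hX⟩⟩
  have hcent : (⟨z, hzG⟩ : G) ∈ Subgroup.center G := by
    rw [Subgroup.mem_center_iff]
    intro g
    have hg : g.1 ∈ G ⊓ Subgroup.centralizer {z} := by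
      rw [hK]
      exact g.2
    ext1
    exact (Subgroup.mem_centralizer_singleton_iff.1 hg.2)
  rw [hG, Subgroup.mem_bot] at hcent
  have hz1 : exp (s • ρ) = 1 := congrArg (fun g : G => g.1.1) hcent
  -- The eigenvalues of ρ are half-integers k/2 that satisfy exp(2πi k/2) = 1.
  have htop : ⨆ k : ℤ, Module.End.eigenspace (Matrix.toLin' ρ) (k : ℂ) = ⊤ := by
    rw [eq_top_iff, ← iSup_eigenspace_two_rho hx]
    refine iSup_le fun k v hv => ?_
    rw [Module.End.mem_eigenspace_iff, Matrix.toLin'_apply, Matrix.smul_mulVec] at hv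
    by_cases hv0 : v = 0
    · rw [hv0]; exact zero_mem _
    have h1 : ρ.mulVec v = ((k : ℂ) / 2) • v := by
      have := congrArg (fun w => (2 : ℂ)⁻¹ • w) hv
      simp only [smul_smul] at this
      rw [inv_mul_cancel₀ two_ne_zero, one_smul] at this
      rw [this]
      congr 1
      ring
    have h2 : (s • ρ).mulVec v = (s * (k / 2)) • v := by
      rw [Matrix.smul_mulVec, h1, smul_smul]
    have h3 := exp_mulVec h2
    rw [hz1, Matrix.one_mulVec] at h3
    have h4 : Complex.exp (s * (k / 2)) = 1 := by
      have h5 : (Complex.exp (s * (k / 2)) - 1) • v = 0 := by rw [sub_smul, one_smul, ← h3, sub_self]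
      exact sub_eq_zero.1 ((smul_eq_zero.1 h5).resolve_right hv0)
    obtain ⟨m, hm⟩ := Complex.exp_eq_one_iff.1 h4
    have h5 : (k : ℂ) / 2 = m := by
      have hs0 : s ≠ 0 := Complex.two_pi_I_ne_zero
      apply mul_left_cancel₀ hs0
      rw [hm, hs]; ring
    refine Submodule.mem_iSup_of_mem m ?_
    rw [Module.End.mem_eigenspace_iff, Matrix.toLin'_apply, h1, h5]
  obtain ⟨g, hg⟩ := exists_evalGL_eq htop
  exact ⟨g, isCocharacter_of_evalGL_eq hT.isClosed ((mem_lieAlg_of_mem hT).2 (rhoCheck b).2) hg⟩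

end RhoMatrix

end OperConn

namespace OperConn

/-! ### Connections over Laurent series in terms of u d/du. -/

section Series

variable {n : ℕ}

/-- The Euler operator `u d/du`. -/
noncomputable def euler (f : LaurentSeries ℂ) : LaurentSeries ℂ :=
  HahnSeries.single 1 1 * derivSeries f

theorem coeff_euler (f : LaurentSeries ℂ) (k : ℤ) : (euler f).coeff k = k * f.coeff k := by
  rw [euler, HahnSeries.coeff_single_mul, derivSeries, LaurentSeries.derivative_apply,
    LaurentSeries.hasseDeriv_coeff]
  simp

theorem support_euler (f : LaurentSeries ℂ) : (euler f).support ⊆ f.support := by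
  intro k hk hk'
  rw [HahnSeries.mem_support, coeff_euler] at hk
  exact hk (by rw [hk', mul_zero])

theorem euler_mul (f g : LaurentSeries ℂ) : euler (f * g) = euler f * g + f * euler g := by
  ext k
  rw [coeff_euler, HahnSeries.coeff_add, HahnSeries.coeff_mul,
    HahnSeries.coeff_mul_left' f.isPWO_support (support_euler f),
    HahnSeries.coeff_mul_right' g.isPWO_support (support_euler g), ← Finset.sum_add_distrib,
    Finset.mul_sum]
  refine Finset.sum_congr rfl fun p hp => ?_
  rw [coeff_euler, coeff_euler]
  have h : p.1 + p.2 = k := (Finset.mem_antidiagonal.1 hp).2.2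
  rw [← h]
  push_cast
  ring

/-- The substitution `u ↦ u ^ m`. -/
noncomputable def ramify (m : ℕ) (hm : 0 < m) : LaurentSeries ℂ →+* LaurentSeries ℂ :=
  HahnSeries.embDomainRingHom (AddMonoidHom.mulLeft (m : ℤ))
    (fun a b h => mul_left_cancel₀ (by exact_mod_cast hm.ne') h)
    (fun a b => by
      have : (0 : ℤ) < m := by exact_mod_cast hm
      exact mul_le_mul_iff_right₀ this)

theorem coeff_ramify_mul {m : ℕ} (hm : 0 < m) (f : LaurentSeries ℂ) (k : ℤ) :
    (ramify m hm f).coeff (m * k) = f.coeff k :=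
  HahnSeries.embDomain_coeff (f := ⟨⟨_, _⟩, _⟩)

theorem coeff_ramify_of_not_dvd {m : ℕ} (hm : 0 < m) (f : LaurentSeries ℂ) {k : ℤ}
    (hk : ¬ (m : ℤ) ∣ k) : (ramify m hm f).coeff k = 0 := by
  refine HahnSeries.embDomain_of_notMem_range (f := ⟨⟨_, _⟩, _⟩) ?_
  rintro ⟨l, rfl⟩
  exact hk ⟨l, rfl⟩

theorem euler_ramify {m : ℕ} (hm : 0 < m) (f : LaurentSeries ℂ) :
    euler (ramify m hm f) = HahnSeries.single 0 (m : ℂ) * ramify m hm (euler f) := by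
  ext k
  rw [coeff_euler, HahnSeries.coeff_single_mul, sub_zero]
  by_cases hk : (m : ℤ) ∣ k
  · obtain ⟨l, rfl⟩ := hk
    rw [coeff_ramify_mul, coeff_ramify_mul, coeff_euler]
    push_cast
    ring
  · rw [coeff_ramify_of_not_dvd hm f hk, coeff_ramify_of_not_dvd hm _ hk, mul_zero, mul_zero]

/-- A matrix of Laurent series is divisible by `u ^ k`. -/
def HasOrder (M : Matrix (Fin n) (Fin n) (LaurentSeries ℂ)) (k : ℤ) : Prop :=
  ∀ l < k, coeffSeries M l = 0

variable {M N : Matrix (Fin n) (Fin n) (LaurentSeries ℂ)} {k l : ℤ}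

theorem HasOrder.mono (h : HasOrder M k) (hl : l ≤ k) : HasOrder M l :=
  fun j hj => h j (hj.trans_le hl)

theorem coeffSeries_add (k : ℤ) : coeffSeries (M + N) k = coeffSeries M k + coeffSeries N k := by
  ext i j
  simp [coeffSeries]

theorem HasOrder.add (hM : HasOrder M k) (hN : HasOrder N k) : HasOrder (M + N) k := fun j hj => by
  rw [coeffSeries_add, hM j hj, hN j hj, add_zero]

theorem coeffSeries_single_smul (a k : ℤ) (c : ℂ) :
    coeffSeries ((HahnSeries.single a c : LaurentSeries ℂ) • M) k = c • coeffSeries M (k - a) := by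
  ext i j
  simp [coeffSeries, HahnSeries.coeff_single_mul]

theorem HasOrder.single_smul (h : HasOrder M k) (a : ℤ) (c : ℂ) :
    HasOrder ((HahnSeries.single a c : LaurentSeries ℂ) • M) (k + a) := fun j hj => by
  rw [coeffSeries_single_smul, h _ (by omega), smul_zero]

theorem coeffSeries_euler (k : ℤ) : coeffSeries (M.map euler) k = (k : ℂ) • coeffSeries M k := by
  ext i j
  simp [coeffSeries, coeff_euler]

theorem HasOrder.euler (h : HasOrder M k) : HasOrder (M.map euler) k := fun j hj => by
  rw [coeffSeries_euler, h j hj, smul_zero]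

theorem coeff_mul_of_le {f g : LaurentSeries ℂ} (hf : ∀ j < k, f.coeff j = 0)
    (hg : ∀ j < l, g.coeff j = 0) {j : ℤ} (hj : j ≤ k + l) :
    (f * g).coeff j = if j = k + l then f.coeff k * g.coeff l else 0 := by
  have hk : ∀ p : ℤ × ℤ, f.coeff p.1 ≠ 0 → k ≤ p.1 := fun p hp => by
    by_contra! h
    exact hp (hf _ h)
  have hl : ∀ p : ℤ × ℤ, g.coeff p.2 ≠ 0 → l ≤ p.2 := fun p hp => by
    by_contra! h
    exact hp (hg _ h)
  rw [HahnSeries.coeff_mul]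
  split_ifs with h
  · rw [Finset.sum_eq_single (k, l)]
    · intro p hp hne
      by_contra h0
      have h1 := hk p (left_ne_zero_of_mul h0)
      have h2 := hl p (right_ne_zero_of_mul h0)
      have h3 : p.1 + p.2 = j := (Finset.mem_antidiagonal.1 hp).2.2
      exact hne (Prod.ext (by omega) (by omega))
    · intro hp
      by_contra h0
      refine hp (Finset.mem_antidiagonal.2 ⟨left_ne_zero_of_mul h0, right_ne_zero_of_mul h0, h.symm⟩)
  · refine Finset.sum_eq_zero fun p hp => ?_
    by_contra h0
    have h1 := hk p (left_ne_zero_of_mul h0)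
    have h2 := hl p (right_ne_zero_of_mul h0)
    have h3 : p.1 + p.2 = j := (Finset.mem_antidiagonal.1 hp).2.2
    omega

theorem HasOrder.coeff (h : HasOrder M k) (i j : Fin n) : ∀ l < k, (M i j).coeff l = 0 :=
  fun l hl => congrFun (congrFun (h l hl) i) j

theorem HasOrder.mul (hM : HasOrder M k) (hN : HasOrder N l) : HasOrder (M * N) (k + l) := by
  intro j hj
  ext a c
  simp only [coeffSeries, Matrix.map_apply, Matrix.mul_apply, HahnSeries.coeff_sum]
  exact Finset.sum_eq_zero fun i _ => by
    rw [coeff_mul_of_le (hM.coeff a i) (hN.coeff i c) hj.le, if_neg hj.ne]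

theorem HasOrder.coeffSeries_mul (hM : HasOrder M k) (hN : HasOrder N l) :
    coeffSeries (M * N) (k + l) = coeffSeries M k * coeffSeries N l := by
  ext a c
  simp only [coeffSeries, Matrix.map_apply, Matrix.mul_apply, HahnSeries.coeff_sum]
  exact Finset.sum_congr rfl fun i _ => by
    rw [coeff_mul_of_le (hM.coeff a i) (hN.coeff i c) le_rfl, if_pos rfl]

theorem exists_hasOrder (M : Matrix (Fin n) (Fin n) (LaurentSeries ℂ)) : ∃ k, HasOrder M k := by
  have : ∃ k : ℤ, ∀ p ∈ (Finset.univ : Finset (Fin n × Fin n)), k ≤ (M p.1 p.2).order := by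
    obtain ⟨k, hk⟩ := (Finset.univ.image fun p : Fin n × Fin n => (M p.1 p.2).order).bddBelow
    exact ⟨k, fun p hp => hk (by simp)⟩
  obtain ⟨k, hk⟩ := this
  refine ⟨k, fun l hl => ?_⟩
  ext i j
  exact HahnSeries.coeff_eq_zero_of_lt_order (hl.trans_le (hk (i, j) (Finset.mem_univ _)))

theorem matrix_euler_mul : (M * N).map euler = M.map euler * N + M * N.map euler := by
  have hsum : ∀ (s : Finset (Fin n)) (f : Fin n → LaurentSeries ℂ),
      euler (∑ i ∈ s, f i) = ∑ i ∈ s, euler (f i) := by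
    intro s f
    ext k
    simp [coeff_euler, HahnSeries.coeff_sum, Finset.mul_sum]
  ext1 a c
  simp only [Matrix.map_apply, Matrix.mul_apply, Matrix.add_apply, hsum, euler_mul,
    Finset.sum_add_distrib]

/-- A connection `u d/du + A` with a pole of order `a ≥ 1` which is equivalent to one with a pole
of smaller order has nilpotent leading coefficient. -/
theorem isNilpotent_of_gauge {A A' : Matrix (Fin n) (Fin n) (LaurentSeries ℂ)}
    {g : GL (Fin n) (LaurentSeries ℂ)} (hg : g.1 * A - g.1.map euler = A' * g.1) {a : ℤ} (ha : 0 < a)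
    (hA : HasOrder A (-a)) (hA' : HasOrder A' (1 - a)) : IsNilpotent (coeffSeries A (-a)) := by
  -- D A is u^a times the covariant derivative. Iterated on 1 it has constant term L^k, with L the
  -- leading coefficient. The gauge transformation carries this to the iterates of D A' on g, each
  -- of which gains a power of u.
  let D : Matrix (Fin n) (Fin n) (LaurentSeries ℂ) → Matrix (Fin n) (Fin n) (LaurentSeries ℂ) →
      Matrix (Fin n) (Fin n) (LaurentSeries ℂ) := fun A M =>
    (HahnSeries.single a 1 : LaurentSeries ℂ) • (M.map euler + A * M)
  have hM : ∀ k : ℕ, HasOrder ((D A)^[k] 1) 0 ∧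
      coeffSeries ((D A)^[k] 1) 0 = coeffSeries A (-a) ^ k := by
    intro k
    induction k with
    | zero =>
      have h1 : ∀ l : ℤ, coeffSeries (1 : Matrix (Fin n) (Fin n) (LaurentSeries ℂ)) l =
          if l = 0 then 1 else 0 := by
        intro l
        ext i j
        simp only [coeffSeries, Matrix.map_apply, Matrix.one_apply]
        by_cases hij : i = j <;> by_cases hl : l = 0 <;>
          simp [hij, hl, HahnSeries.coeff_one, Matrix.one_apply]
      exact ⟨fun l hl => by simp [h1, hl.ne], by simp [h1]⟩
    | succ k ih =>
      rw [Function.iterate_succ_apply']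
      set M := (D A)^[k] 1
      have h1 : HasOrder (A * M) (-a) := by simpa using hA.mul ih.1
      have h2 : HasOrder (M.map euler + A * M) (-a) := (ih.1.euler.mono (by omega)).add h1
      refine ⟨by simpa using h2.single_smul a 1, ?_⟩
      rw [coeffSeries_single_smul, one_smul, coeffSeries_add, coeffSeries_euler, zero_sub,
        ih.1 _ (by omega), smul_zero, zero_add, pow_succ', ← ih.2]
      simpa using hA.coeffSeries_mul ih.1
  have hgM : ∀ k : ℕ, g.1 * (D A)^[k] 1 = (D A')^[k] g.1 := by
    intro k
    induction k with
    | zero => simp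
    | succ k ih =>
      rw [Function.iterate_succ_apply', Function.iterate_succ_apply', ← ih]
      set M := (D A)^[k] 1
      have hD : ∀ (f : LaurentSeries ℂ) (P Q : Matrix (Fin n) (Fin n) (LaurentSeries ℂ)),
          P * f • Q = f • (P * Q) := fun f P Q => Matrix.mul_smul P f Q
      simp only [D, hD, matrix_euler_mul]
      congr 1
      rw [← mul_assoc A', ← hg]
      rw [sub_mul, mul_add, mul_assoc]
      abel
  obtain ⟨ν, hν⟩ := exists_hasOrder g.1
  obtain ⟨μ, hμ⟩ := exists_hasOrder g⁻¹.1
  have hN : ∀ k : ℕ, HasOrder ((D A')^[k] g.1) (ν + k) := by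
    intro k
    induction k with
    | zero => simpa using hν
    | succ k ih =>
      rw [Function.iterate_succ_apply']
      set M := (D A')^[k] g.1
      have h1 : HasOrder (A' * M) (1 - a + (ν + k)) := hA'.mul ih
      have h2 : HasOrder (M.map euler + A' * M) (1 - a + (ν + k)) := (ih.euler.mono (by omega)).add h1
      have h3 := h2.single_smul a 1
      push_cast
      exact h3.mono (by omega)
  -- With ν and μ bounding the orders of g and g⁻¹, for this k the order μ + ν + k is positive, so
  -- the constant term L^k vanishes.
  refine ⟨(-(μ + ν)).toNat + 1, ?_⟩
  set k := (-(μ + ν)).toNat + 1 with hk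
  have h1 : (D A)^[k] 1 = g⁻¹.1 * (D A')^[k] g.1 := by
    rw [← hgM, ← mul_assoc, Units.inv_mul, one_mul]
  have h2 : HasOrder ((D A)^[k] 1) (μ + (ν + k)) := h1 ▸ hμ.mul (hN k)
  rw [← (hM k).2]
  exact h2 0 (by omega)

end Series

end OperConn

namespace OperConn

/-! ### Ramification and comparison of slopes. -/

section Slope

open LaurentPolynomial

variable {n : ℕ}

theorem algebraMap_series (a : ℂ) : algebraMap ℂ (LaurentSeries ℂ) a = HahnSeries.single 0 a := by
  rw [HahnSeries.algebraMap_apply', PowerSeries.algebraMap_apply, HahnSeries.ofPowerSeries_C]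
  rfl

theorem single_pow_one (m : ℕ) (k : ℤ) :
    (HahnSeries.single k 1 : LaurentSeries ℂ) ^ m = HahnSeries.single (m * k : ℤ) 1 := by
  rw [HahnSeries.single_pow, one_pow, nsmul_eq_mul]

theorem series_smul_mul (f : LaurentSeries ℂ) (P Q : Matrix (Fin n) (Fin n) (LaurentSeries ℂ)) :
    (f • P) * Q = f • (P * Q) := Matrix.smul_mul f P Q

theorem series_mul_smul (f : LaurentSeries ℂ) (P Q : Matrix (Fin n) (Fin n) (LaurentSeries ℂ)) :
    P * f • Q = f • (P * Q) := Matrix.mul_smul P f Q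

theorem series_smul_add (f : LaurentSeries ℂ) (P Q : Matrix (Fin n) (Fin n) (LaurentSeries ℂ)) :
    f • (P + Q) = f • P + f • Q := smul_add f P Q

theorem series_smul_sub (f : LaurentSeries ℂ) (P Q : Matrix (Fin n) (Fin n) (LaurentSeries ℂ)) :
    f • (P - Q) = f • P - f • Q := smul_sub f P Q

theorem series_smul_smul (f g : LaurentSeries ℂ) (P : Matrix (Fin n) (Fin n) (LaurentSeries ℂ)) :
    f • g • P = (f * g) • P := smul_smul f g P

/-- The variable of `ℂ((u))`, as a unit. -/
noncomputable def seriesVar : (LaurentSeries ℂ)ˣ :=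
  ⟨HahnSeries.single 1 1, HahnSeries.single (-1) 1,
    by rw [HahnSeries.single_mul_single]; simp, by rw [HahnSeries.single_mul_single]; simp⟩

theorem toSeries_T (k : ℤ) : toSeries (T k) = HahnSeries.single k 1 := by
  have h : toSeries = LaurentPolynomial.eval₂ (algebraMap ℂ (LaurentSeries ℂ)) seriesVar := by
    rw [toSeries, seriesVar]
  have h1 : toSeries (T 1) = HahnSeries.single 1 1 := by
    rw [h, eval₂_T, zpow_one]
    rfl
  have h2 : toSeries (T (-1)) = HahnSeries.single (-1) 1 := by
    rw [h, eval₂_T, zpow_neg_one]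
    rfl
  obtain ⟨m, rfl | rfl⟩ := k.eq_nat_or_neg
  · rw [← mul_one (m : ℤ), ← T_pow, map_pow, h1, single_pow_one]
  · rw [← mul_neg_one (m : ℤ), ← T_pow, map_pow, h2, single_pow_one]

theorem toSeries_algebraMap (a : ℂ) :
    toSeries (algebraMap ℂ ℂ[T;T⁻¹] a) = algebraMap ℂ (LaurentSeries ℂ) a := by
  rw [← C_eq_algebraMap, toSeries, eval₂_C]

theorem map_toSeries_smul_const (k : ℤ) (X : Matrix (Fin n) (Fin n) ℂ) :
    ((T k : ℂ[T;T⁻¹]) • const ℂ[T;T⁻¹] X).map toSeries =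
      (HahnSeries.single k 1 : LaurentSeries ℂ) • const (LaurentSeries ℂ) X := by
  ext1 i j
  rw [Matrix.map_apply, Matrix.smul_apply, Matrix.smul_apply, smul_eq_mul, smul_eq_mul, map_mul,
    toSeries_T]
  exact congrArg _ (toSeries_algebraMap _)

theorem coeffSeries_single_smul_const (k l : ℤ) (X : Matrix (Fin n) (Fin n) ℂ) :
    coeffSeries ((HahnSeries.single k 1 : LaurentSeries ℂ) • const (LaurentSeries ℂ) X) l =
      if l = k then X else 0 := by
  ext i j
  change (HahnSeries.single k 1 * algebraMap ℂ (LaurentSeries ℂ) (X i j)).coeff l = _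
  rw [HahnSeries.coeff_single_mul, algebraMap_series, one_mul]
  split_ifs with h
  · subst h
    simp
  · rw [HahnSeries.coeff_single_of_ne (sub_ne_zero.2 h)]
    rfl

theorem ramify_single {m : ℕ} (hm : 0 < m) (k : ℤ) (a : ℂ) :
    ramify m hm (HahnSeries.single k a) = HahnSeries.single (m * k) a :=
  HahnSeries.embDomain_single (f := ⟨⟨_, _⟩, _⟩)

theorem coeffSeries_ramify {m : ℕ} (hm : 0 < m) (M : Matrix (Fin n) (Fin n) (LaurentSeries ℂ)) (k : ℤ) :
    coeffSeries (M.map (ramify m hm)) (m * k) = coeffSeries M k := by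
  ext i j
  exact coeff_ramify_mul hm _ _

theorem HasOrder.ramify {m : ℕ} (hm : 0 < m) {M : Matrix (Fin n) (Fin n) (LaurentSeries ℂ)} {k : ℤ}
    (h : HasOrder M k) : HasOrder (M.map (ramify m hm)) (m * k) := by
  intro l hl
  ext i j
  by_cases hd : (m : ℤ) ∣ l
  · obtain ⟨p, rfl⟩ := hd
    have hp : p < k := lt_of_mul_lt_mul_left hl (by positivity)
    exact (coeff_ramify_mul hm _ _).trans (h.coeff i j p hp)
  · exact coeff_ramify_of_not_dvd hm _ hd

/-- The connection `u d/du + B'` is the gauge transform by `g` of `u d/du + B`. -/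
def EulerGauge (g : GL (Fin n) (LaurentSeries ℂ)) (B B' : Matrix (Fin n) (Fin n) (LaurentSeries ℂ)) :
    Prop :=
  g.1 * B - g.1.map euler = B' * g.1

theorem eulerGauge_gauge (g : GL (Fin n) (LaurentSeries ℂ))
    (A : Matrix (Fin n) (Fin n) (LaurentSeries ℂ)) :
    EulerGauge g ((HahnSeries.single 1 1 : LaurentSeries ℂ) • A)
      ((HahnSeries.single 1 1 : LaurentSeries ℂ) • gauge derivSeries g A) := by
  have h : g.1.map euler = (HahnSeries.single 1 1 : LaurentSeries ℂ) • g.1.map derivSeries := rfl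
  have hg : g⁻¹.1 * g.1 = 1 := g.inv_mul
  rw [EulerGauge, h, gauge, series_smul_mul, series_mul_smul, ← series_smul_sub, sub_mul, mul_assoc, hg,
    mul_assoc (g.1.map _), hg, mul_one, mul_one]

theorem EulerGauge.ramify {g : GL (Fin n) (LaurentSeries ℂ)}
    {B B' : Matrix (Fin n) (Fin n) (LaurentSeries ℂ)} (h : EulerGauge g B B') {m : ℕ} (hm : 0 < m) :
    EulerGauge (Matrix.GeneralLinearGroup.map (ramify m hm) g) ((HahnSeries.single 0 (m : ℂ) : LaurentSeries ℂ) • B.map (ramify m hm))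
      ((HahnSeries.single 0 (m : ℂ) : LaurentSeries ℂ) • B'.map (ramify m hm)) := by
  have h1 : (Matrix.GeneralLinearGroup.map (OperConn.ramify m hm) g).1 =
    g.1.map (OperConn.ramify m hm) := rfl
  have h2 : (g.1.map (OperConn.ramify m hm)).map euler =
      (HahnSeries.single 0 (m : ℂ) : LaurentSeries ℂ) • (g.1.map euler).map (OperConn.ramify m hm) := by
    ext1 i j
    exact euler_ramify hm _
  rw [EulerGauge, h1, h2, series_smul_mul, series_mul_smul, ← series_smul_sub, ← Matrix.map_mul,
    ← Matrix.map_mul, ← h, Matrix.map_sub _ (map_sub _)]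

theorem EulerGauge.mul_inv {g g' : GL (Fin n) (LaurentSeries ℂ)}
    {B B₁ B₂ : Matrix (Fin n) (Fin n) (LaurentSeries ℂ)} (h : EulerGauge g B B₁)
    (h' : EulerGauge g' B B₂) : EulerGauge (g' * g⁻¹) B₁ B₂ := by
  have hg : (g' * g⁻¹).1 * g.1 = g'.1 := by
    rw [← Units.val_mul, inv_mul_cancel_right]
  have h1 := matrix_euler_mul (M := (g' * g⁻¹).1) (N := g.1)
  rw [hg] at h1
  rw [EulerGauge] at h h' ⊢
  apply (Units.mul_left_inj g).1
  rw [mul_assoc B₂, hg, ← h', h1, sub_mul, mul_assoc _ B₁, ← h, mul_sub, ← mul_assoc, hg]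
  abel

theorem const_smul (a : ℂ) (X : Matrix (Fin n) (Fin n) ℂ) :
    const (LaurentSeries ℂ) (a • X) =
      (HahnSeries.single 0 a : LaurentSeries ℂ) • const (LaurentSeries ℂ) X := by
  ext1 i j
  change algebraMap ℂ (LaurentSeries ℂ) (a * X i j) =
    HahnSeries.single 0 a * algebraMap ℂ (LaurentSeries ℂ) (X i j)
  rw [map_mul, algebraMap_series a]

theorem map_ramify_smul {k : ℕ} (hk : 0 < k) (f : LaurentSeries ℂ)
    (M : Matrix (Fin n) (Fin n) (LaurentSeries ℂ)) :
    (f • M).map (ramify k hk) = ramify k hk f • M.map (ramify k hk) := by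
  ext1 i j
  exact map_mul (ramify k hk) _ _

theorem map_ramify_const {k : ℕ} (hk : 0 < k) (X : Matrix (Fin n) (Fin n) ℂ) :
    (const (LaurentSeries ℂ) X).map (ramify k hk) = const (LaurentSeries ℂ) X := by
  ext1 i j
  change ramify k hk (algebraMap ℂ (LaurentSeries ℂ) (X i j)) = algebraMap ℂ (LaurentSeries ℂ) (X i j)
  rw [algebraMap_series, ramify_single, mul_zero]

theorem euler_pullback_nabla (N E : Matrix (Fin n) (Fin n) ℂ) (m : ℕ) :
    (HahnSeries.single 1 1 : LaurentSeries ℂ) • (pullback 1 (-(m : ℤ)) (nabla N E)).map toSeries =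
      (HahnSeries.single 0 (-m : ℂ) : LaurentSeries ℂ) • const (LaurentSeries ℂ) N +
        (HahnSeries.single (-m : ℤ) (-m : ℂ) : LaurentSeries ℂ) • const (LaurentSeries ℂ) E := by
  rw [pullback_nabla, Matrix.map_add _ (map_add _), map_toSeries_smul_const,
    map_toSeries_smul_const, const_smul, const_smul]
  simp only [series_smul_add, series_smul_smul, HahnSeries.single_mul_single]
  congr 3
  · push_cast
    ring
  · congr 1
    push_cast
    ring
  · push_cast
    simp

theorem ramify_pullback_nabla (N E : Matrix (Fin n) (Fin n) ℂ) (m : ℕ) {k : ℕ} (hk : 0 < k) :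
    (HahnSeries.single 0 (k : ℂ) : LaurentSeries ℂ) • ((HahnSeries.single 1 1 : LaurentSeries ℂ) •
      (pullback 1 (-(m : ℤ)) (nabla N E)).map toSeries).map (ramify k hk) =
    (HahnSeries.single 1 1 : LaurentSeries ℂ) •
      (pullback 1 (-((m * k : ℕ) : ℤ)) (nabla N E)).map toSeries := by
  rw [euler_pullback_nabla, euler_pullback_nabla, Matrix.map_add _ (map_add _), map_ramify_smul,
    map_ramify_smul, map_ramify_const, map_ramify_const]
  simp only [series_smul_add, series_smul_smul, HahnSeries.single_mul_single, ramify_single]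
  congr 3
  · push_cast
    ring
  · congr 1
    push_cast
    ring
  · push_cast
    ring

/-- Among the trivializations of the ramified pull-backs of `d + N dt/t + E dt` at infinity, those
with a non-nilpotent leading coefficient have the least slope. -/
theorem isNilpotent_leading {N E : Matrix (Fin n) (Fin n) ℂ} {a₁ a₂ m₁ m₂ : ℕ} (h₁ : 0 < m₁)
    (h₂ : 0 < m₂) (ha : a₂ * m₁ < a₁ * m₂) {g₁ g₂ : GL (Fin n) (LaurentSeries ℂ)}
    (hg₁ : HasOrder (gauge derivSeries g₁ ((pullback 1 (-(m₁ : ℤ)) (nabla N E)).map toSeries))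
      (-((a₁ + 1 : ℕ) : ℤ)))
    (hg₂ : HasOrder (gauge derivSeries g₂ ((pullback 1 (-(m₂ : ℤ)) (nabla N E)).map toSeries))
      (-((a₂ + 1 : ℕ) : ℤ))) :
    IsNilpotent (coeffSeries
      (gauge derivSeries g₁ ((pullback 1 (-(m₁ : ℤ)) (nabla N E)).map toSeries))
      (-((a₁ + 1 : ℕ) : ℤ))) := by
  -- Both trivializations are pulled back to the common ramification m₁ m₂, where they are gauge
  -- equivalent to each other.
  have e₁ := (eulerGauge_gauge g₁ ((pullback 1 (-(m₁ : ℤ)) (nabla N E)).map toSeries)).ramify h₂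
  have e₂ := (eulerGauge_gauge g₂ ((pullback 1 (-(m₂ : ℤ)) (nabla N E)).map toSeries)).ramify h₁
  rw [ramify_pullback_nabla] at e₁ e₂
  rw [mul_comm m₂ m₁] at e₂
  have o₁ := ((hg₁.single_smul 1 1).ramify h₂).single_smul 0 (m₂ : ℂ)
  have o₂ := ((hg₂.single_smul 1 1).ramify h₁).single_smul 0 (m₁ : ℂ)
  -- The factor u lowers the pole order a + 1 to a, and ramification multiplies it.
  have k₁ : (m₂ : ℤ) * (-((a₁ + 1 : ℕ) : ℤ) + 1) = -((a₁ * m₂ : ℕ) : ℤ) := by push_cast; ring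
  have k₂ : (m₁ : ℤ) * (-((a₂ + 1 : ℕ) : ℤ) + 1) = -((a₂ * m₁ : ℕ) : ℤ) := by push_cast; ring
  rw [k₁, add_zero] at o₁
  rw [k₂, add_zero] at o₂
  have key := isNilpotent_of_gauge (e₁.mul_inv e₂) (a := ((a₁ * m₂ : ℕ) : ℤ)) (by omega) o₁
    (o₂.mono (by omega))
  rw [← k₁, coeffSeries_single_smul, sub_zero, coeffSeries_ramify, coeffSeries_single_smul,
    add_sub_cancel_right, one_smul] at key
  obtain ⟨p, hp⟩ := key
  refine ⟨p, ?_⟩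
  rw [smul_pow] at hp
  exact (smul_eq_zero.1 hp).resolve_left (pow_ne_zero _ (by exact_mod_cast h₂.ne'))

/-- Gauge transformations by Laurent polynomials, over Laurent series. -/
theorem gauge_map_toSeries (g : GL (Fin n) ℂ[T;T⁻¹]) (A : Matrix (Fin n) (Fin n) ℂ[T;T⁻¹]) :
    gauge derivSeries (Matrix.GeneralLinearGroup.map toSeries g) (A.map toSeries) =
      (gauge derivPoly g A).map toSeries := by
  have hd : ∀ f : ℂ[T;T⁻¹], derivSeries (toSeries f) = toSeries (derivPoly f) := by
    intro f
    have hs : ∀ (k : ℤ) (a : ℂ), toSeries (C a * T k) = HahnSeries.single k a := by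
      intro k a
      rw [map_mul, toSeries_T, C_eq_algebraMap, toSeries_algebraMap, algebraMap_series,
        HahnSeries.single_mul_single]
      simp
    induction f using LaurentPolynomial.induction_on' with
    | add p q hp hq =>
      rw [derivPoly_add, map_add, map_add, ← hp, ← hq]
      exact map_add (LaurentSeries.derivative ℂ) _ _
    | C_mul_T k a =>
      rw [derivPoly_C_mul_T, hs, hs]
      ext l
      rw [derivSeries, LaurentSeries.derivative_apply, LaurentSeries.hasseDeriv_coeff]
      by_cases h : l = k - 1
      · subst h
        simp
      · rw [HahnSeries.coeff_single_of_ne h]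
        have : l + 1 ≠ k := fun h' => h (by omega)
        simp [HahnSeries.coeff_single_of_ne this]
  have h1 : (Matrix.GeneralLinearGroup.map toSeries g).1 = g.1.map toSeries := rfl
  have h2 : (Matrix.GeneralLinearGroup.map toSeries g)⁻¹.1 = g⁻¹.1.map toSeries := by
    rw [← map_inv]
    rfl
  have h3 : (g.1.map toSeries).map derivSeries = (g.1.map derivPoly).map toSeries := by
    ext1 i j
    exact hd _
  rw [gauge, gauge, h1, h2, h3, Matrix.map_sub _ (map_sub _), Matrix.map_mul, Matrix.map_mul,
    Matrix.map_mul]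

theorem map_toSeries_mem_points {G K : Subgroup (GL (Fin n) ℂ)} (h : K ≤ G)
    {g : GL (Fin n) ℂ[T;T⁻¹]} (hg : g ∈ points K ℂ[T;T⁻¹]) :
    Matrix.GeneralLinearGroup.map toSeries g ∈ points G (LaurentSeries ℂ) := by
  intro f hf
  have hf' : f ∈ idealOf K := fun p hp => by
    obtain ⟨k, hk, rfl⟩ := hp
    exact hf _ ⟨k, h hk, rfl⟩
  have h0 := hg f hf'
  let φ : ℂ[T;T⁻¹] →ₐ[ℂ] LaurentSeries ℂ := { toSeries with commutes' := toSeries_algebraMap }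
  have h1 : MvPolynomial.aeval (coords (Matrix.GeneralLinearGroup.map toSeries g)) f =
      φ (MvPolynomial.aeval (coords g) f) := by
    exact (MvPolynomial.comp_aeval_apply (coords g) φ f).symm
  rw [h1, h0, map_zero]

end Slope

end OperConn

namespace OperConn

/-! ### The fundamental solution at a nilpotent residue. -/

section Frobenius

variable {𝔸 : Type*} [NormedRing 𝔸] [NormedAlgebra ℂ 𝔸] {N F : 𝔸}

/-- Absence of resonances: ad N is nilpotent, so c + ad N is invertible for every c ≠ 0. -/
theorem exists_smul_add_commutator_eq (hN : IsNilpotent N) {c : ℂ} (hc : c ≠ 0) (y : 𝔸) :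
    ∃ x, c • x + (N * x - x * N) = y := by
  have h1 : IsNilpotent (LieAlgebra.ad ℂ 𝔸 N) := LieAlgebra.ad_nilpotent_of_nilpotent (R := ℂ) hN
  have h2 : IsUnit (algebraMap ℂ (Module.End ℂ 𝔸) c + LieAlgebra.ad ℂ 𝔸 N) :=
    h1.isUnit_add_left_of_commute ((isUnit_iff_ne_zero.2 hc).map _) (Algebra.commutes _ _).symm
  obtain ⟨x, hx⟩ := ((Module.End.isUnit_iff _).1 h2).2 y
  exact ⟨x, hx⟩

/-- With D = ad N, membership of D^j(cx + Dx) gives D^j x from D^{j+1} x, downwards from D^d = 0. -/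
theorem mem_of_smul_add_commutator_mem (hN : IsNilpotent N) {c : ℂ} (hc : c ≠ 0)
    {𝔰 : Submodule ℂ 𝔸} (hs : ∀ x ∈ 𝔰, N * x - x * N ∈ 𝔰) {x : 𝔸}
    (hx : c • x + (N * x - x * N) ∈ 𝔰) : x ∈ 𝔰 := by
  obtain ⟨d, hd⟩ := LieAlgebra.ad_nilpotent_of_nilpotent (R := ℂ) hN
  set D := LieAlgebra.ad ℂ 𝔸 N with hD
  have hD' : ∀ x, D x = N * x - x * N := fun x => rfl
  have h1 : ∀ j, (D ^ j) (c • x + D x) ∈ 𝔰 := by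
    intro j
    induction j with
    | zero => exact hx
    | succ j ih =>
      rw [pow_succ']
      exact hs _ ih
  have h2 : ∀ j ≤ d, (D ^ (d - j)) x ∈ 𝔰 := by
    intro j
    induction j with
    | zero => intro _; rw [Nat.sub_zero, hd]; exact 𝔰.zero_mem
    | succ j ih =>
      intro hj
      have h3 := h1 (d - (j + 1))
      rw [map_add, map_smul, ← Module.End.mul_apply, ← pow_succ,
        show d - (j + 1) + 1 = d - j by omega] at h3
      have h4 := (𝔰.add_mem_iff_left (ih (by omega))).1 h3
      exact (𝔰.smul_mem_iff hc).1 h4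
  simpa using h2 d le_rfl

/-- A sequence whose ratios tend to zero. -/
def IsEntire (a : ℕ → 𝔸) : Prop :=
  ∀ ε > (0 : ℝ), ∀ᶠ k in Filter.atTop, ‖a (k + 1)‖ ≤ ε * ‖a k‖

theorem IsEntire.summable {a : ℕ → 𝔸} (ha : IsEntire a) (ρ : ℝ) :
    Summable fun k => ‖a k‖ * ρ ^ k := by
  refine summable_of_ratio_norm_eventually_le (r := 1 / 2) (by norm_num) ?_
  filter_upwards [ha (1 / (2 * (|ρ| + 1))) (by positivity)] with k hk
  rw [norm_mul, norm_mul, norm_norm, norm_norm, norm_pow, norm_pow, Real.norm_eq_abs, pow_succ]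
  have h1 : |ρ| / (2 * (|ρ| + 1)) ≤ 1 / 2 := by
    rw [div_le_div_iff₀ (by positivity) (by norm_num)]
    linarith
  calc ‖a (k + 1)‖ * (|ρ| ^ k * |ρ|) ≤ (1 / (2 * (|ρ| + 1)) * ‖a k‖) * (|ρ| ^ k * |ρ|) := by gcongr
    _ = (|ρ| / (2 * (|ρ| + 1))) * (‖a k‖ * |ρ| ^ k) := by ring
    _ ≤ 1 / 2 * (‖a k‖ * |ρ| ^ k) := by gcongr

theorem IsEntire.summable_smul {a : ℕ → 𝔸} (ha : IsEntire a) (z : ℂ) :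
    Summable fun k => ‖z ^ k • a k‖ := by
  simpa [norm_smul, mul_comm] using ha.summable ‖z‖

/-- For large k the factor k + 1 dominates the bounded operator ad N. -/
theorem isEntire_of_recursion {a : ℕ → 𝔸} {C : ℝ}
    (h : ∀ k : ℕ, ‖((k + 1 : ℕ) : ℂ) • a (k + 1) + (N * a (k + 1) - a (k + 1) * N)‖ ≤ C * ‖a k‖) :
    IsEntire a := by
  intro ε hε
  filter_upwards [Filter.eventually_ge_atTop ⌈2 * ‖N‖ + (|C| + 1) / ε⌉₊] with k hk
  have h1 : 2 * ‖N‖ + (|C| + 1) / ε ≤ (k + 1 : ℕ) := (Nat.ceil_le.1 hk).trans (by push_cast; linarith)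
  have h2 : ‖((k + 1 : ℕ) : ℂ) • a (k + 1)‖ ≤
      ‖((k + 1 : ℕ) : ℂ) • a (k + 1) + (N * a (k + 1) - a (k + 1) * N)‖ +
        ‖N * a (k + 1) - a (k + 1) * N‖ := by
    have := norm_sub_le (((k + 1 : ℕ) : ℂ) • a (k + 1) + (N * a (k + 1) - a (k + 1) * N))
      (N * a (k + 1) - a (k + 1) * N)
    rwa [add_sub_cancel_right] at this
  have h3 : ‖N * a (k + 1) - a (k + 1) * N‖ ≤ 2 * ‖N‖ * ‖a (k + 1)‖ := by
    refine (norm_sub_le _ _).trans ?_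
    have := norm_mul_le N (a (k + 1))
    have := norm_mul_le (a (k + 1)) N
    linarith
  rw [norm_smul, Complex.norm_natCast] at h2
  have h4 : C * ‖a k‖ ≤ (|C| + 1) * ‖a k‖ := by
    gcongr
    linarith [le_abs_self C]
  have h5 := mul_le_mul_of_nonneg_right h1 (norm_nonneg (a (k + 1)))
  have h6 : (|C| + 1) / ε * ‖a (k + 1)‖ ≤ (|C| + 1) * ‖a k‖ := by linarith [h k]
  rw [div_mul_eq_mul_div, div_le_iff₀ hε, mul_assoc] at h6
  have := le_of_mul_le_mul_left h6 (by positivity)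
  linarith

theorem IsEntire.hasDerivAt [CompleteSpace 𝔸] {a : ℕ → 𝔸} (ha : IsEntire a) (z : ℂ) :
    HasDerivAt (fun z : ℂ => ∑' k, z ^ k • a k) (∑' k : ℕ, ((k : ℂ) * z ^ (k - 1)) • a k) z := by
  have hρ := ha.summable (2 * (‖z‖ + 2))
  refine hasDerivAt_tsum_of_isPreconnected (g := fun (k : ℕ) (z : ℂ) => z ^ k • a k)
    (g' := fun (k : ℕ) (z : ℂ) => ((k : ℂ) * z ^ (k - 1)) • a k) hρ
    (Metric.isOpen_ball (x := z) (ε := 1)) (convex_ball z 1).isPreconnected ?_ ?_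
    (Metric.mem_ball_self one_pos) (ha.summable_smul z).of_norm (Metric.mem_ball_self one_pos)
  · intro k y _
    exact (hasDerivAt_pow k y).smul_const _
  · intro k y hy
    have hy' : ‖y‖ ≤ ‖z‖ + 2 := by
      have h1 := norm_sub_norm_le y z
      have h2 : ‖y - z‖ < 1 := by simpa [dist_eq_norm] using hy
      linarith
    rw [norm_smul, norm_mul, norm_pow, Complex.norm_natCast, mul_comm, mul_pow]
    have h3 : (k : ℝ) ≤ 2 ^ k := by exact_mod_cast (Nat.lt_two_pow_self).le
    have h4 : ‖y‖ ^ (k - 1) ≤ (‖z‖ + 2) ^ k :=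
      (pow_le_pow_left₀ (norm_nonneg _) hy' _).trans
        (pow_le_pow_right₀ (by linarith [norm_nonneg z]) (Nat.sub_le _ _))
    gcongr

/-- The coefficients of the product `P X R` of power series. -/
def conjCoeff (P R : ℕ → 𝔸) (k : ℕ) (x : 𝔸) : 𝔸 :=
  ∑ p ∈ Finset.HasAntidiagonal.antidiagonal k, P p.1 * x * R p.2

/-- The coefficientwise form of z (PxR)' = P[N, x]R - [N + zF, PxR]. -/
theorem conjCoeff_recursion {P R : ℕ → 𝔸} (hP0 : P 0 = 1) (hR0 : R 0 = 1)
    (hP : ∀ k : ℕ, ((k + 1 : ℕ) : ℂ) • P (k + 1) + (N * P (k + 1) - P (k + 1) * N) = -(F * P k))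
    (hR : ∀ k : ℕ, ((k + 1 : ℕ) : ℂ) • R (k + 1) + (N * R (k + 1) - R (k + 1) * N) = R k * F)
    (k : ℕ) (x : 𝔸) :
    ((k + 1 : ℕ) : ℂ) • conjCoeff P R (k + 1) x +
        (N * conjCoeff P R (k + 1) x - conjCoeff P R (k + 1) x * N) =
      conjCoeff P R (k + 1) (N * x - x * N) -
        (F * conjCoeff P R k x - conjCoeff P R k x * F) := by
  let P' : ℕ → 𝔸 := fun i => if i = 0 then 0 else P (i - 1)
  let R' : ℕ → 𝔸 := fun i => if i = 0 then 0 else R (i - 1)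
  have hP' : ∀ i : ℕ, (i : ℂ) • P i = P i * N - N * P i - F * P' i := by
    intro i
    rcases i with _ | i
    · simp [P', hP0]
    · have := hP i
      simp only [P', Nat.succ_ne_zero, if_false, Nat.add_sub_cancel]
      rw [eq_sub_iff_add_eq, eq_sub_iff_add_eq, ← sub_eq_zero, ← sub_eq_zero.2 this]
      abel
  have hR' : ∀ i : ℕ, (i : ℂ) • R i = R i * N - N * R i + R' i * F := by
    intro i
    rcases i with _ | i
    · simp [R', hR0]
    · have := hR i
      simp only [R', Nat.succ_ne_zero, if_false, Nat.add_sub_cancel]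
      rw [← this]
      abel
  have h1 : ∑ p ∈ Finset.HasAntidiagonal.antidiagonal (k + 1), P' p.1 * x * R p.2 = conjCoeff P R k x := by
    rw [Finset.Nat.sum_antidiagonal_succ]
    simp [P', conjCoeff]
  have h2 : ∑ p ∈ Finset.HasAntidiagonal.antidiagonal (k + 1), P p.1 * x * R' p.2 = conjCoeff P R k x := by
    rw [Finset.Nat.sum_antidiagonal_succ']
    simp [R', conjCoeff]
  rw [← h1]
  nth_rw 2 [h1]
  rw [← h2]
  simp only [conjCoeff, Finset.smul_sum, Finset.mul_sum, Finset.sum_mul, ← Finset.sum_sub_distrib,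
    ← Finset.sum_add_distrib]
  refine Finset.sum_congr rfl fun p hp => ?_
  have h3 : ((k + 1 : ℕ) : ℂ) = p.1 + p.2 := by
    rw [← Finset.HasAntidiagonal.mem_antidiagonal.1 hp]
    push_cast
    rfl
  have h4 : ((k + 1 : ℕ) : ℂ) • (P p.1 * x * R p.2) =
      ((p.1 : ℂ) • P p.1) * x * R p.2 + P p.1 * x * ((p.2 : ℂ) • R p.2) := by
    rw [h3, add_smul, smul_mul_assoc, smul_mul_assoc, mul_smul_comm]
  rw [h4, hP', hR']
  simp only [mul_sub, sub_mul, mul_add, mul_assoc]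
  abel

/-- Induction on k, and for fixed k descending induction on the power of ad N applied to x: the
recursion expresses the coefficient at x through the one at [N, x] and through lower k. -/
theorem conjCoeff_mem {P R : ℕ → 𝔸} (hN : IsNilpotent N) (hP0 : P 0 = 1) (hR0 : R 0 = 1)
    (hP : ∀ k : ℕ, ((k + 1 : ℕ) : ℂ) • P (k + 1) + (N * P (k + 1) - P (k + 1) * N) = -(F * P k))
    (hR : ∀ k : ℕ, ((k + 1 : ℕ) : ℂ) • R (k + 1) + (N * R (k + 1) - R (k + 1) * N) = R k * F)
    {𝔰 : Submodule ℂ 𝔸} (hs : ∀ x ∈ 𝔰, N * x - x * N ∈ 𝔰) (hF : ∀ x ∈ 𝔰, F * x - x * F ∈ 𝔰)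
    (k : ℕ) {x : 𝔸} (hx : x ∈ 𝔰) : conjCoeff P R k x ∈ 𝔰 := by
  induction k generalizing x with
  | zero => simpa [conjCoeff, hP0, hR0] using hx
  | succ k ih =>
    obtain ⟨d, hd⟩ := LieAlgebra.ad_nilpotent_of_nilpotent (R := ℂ) hN
    set D := LieAlgebra.ad ℂ 𝔸 N with hD
    have h1 : ∀ j, (D ^ j) x ∈ 𝔰 := by
      intro j
      induction j with
      | zero => exact hx
      | succ j ih =>
        rw [pow_succ']
        exact hs _ ih
    have h2 : ∀ j ≤ d, conjCoeff P R (k + 1) ((D ^ (d - j)) x) ∈ 𝔰 := by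
      intro j
      induction j with
      | zero =>
        intro _
        rw [Nat.sub_zero, hd]
        simp [conjCoeff]
      | succ j ih' =>
        intro hj
        refine mem_of_smul_add_commutator_mem hN (c := ((k + 1 : ℕ) : ℂ))
          (by exact_mod_cast k.succ_ne_zero) hs ?_
        rw [conjCoeff_recursion hP0 hR0 hP hR]
        have h3 : N * (D ^ (d - (j + 1))) x - (D ^ (d - (j + 1))) x * N = (D ^ (d - j)) x := by
          rw [show d - j = d - (j + 1) + 1 by omega, pow_succ']
          rfl
        rw [h3]
        exact 𝔰.sub_mem (ih' (by omega)) (hF _ (ih (h1 _)))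
    simpa using h2 d le_rfl

/-- Fundamental solution of `z dP/dz = P N - (N + z F) P`, for `N` nilpotent. -/
theorem exists_frobenius [CompleteSpace 𝔸] (F : 𝔸) (hN : IsNilpotent N) :
    ∃ P R : ℂ → 𝔸, (∀ z, ∃ dP, HasDerivAt P dP z ∧ z • dP = P z * N - N * P z - z • (F * P z)) ∧
      (∀ z, P z * R z = 1) ∧
      ∀ 𝔰 : Submodule ℂ 𝔸, IsClosed (𝔰 : Set 𝔸) → (∀ x ∈ 𝔰, N * x - x * N ∈ 𝔰) →
        (∀ x ∈ 𝔰, F * x - x * F ∈ 𝔰) → ∀ z, ∀ x ∈ 𝔰, P z * x * R z ∈ 𝔰 := by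
  have hk : ∀ k : ℕ, ((k + 1 : ℕ) : ℂ) ≠ 0 := fun k => by exact_mod_cast k.succ_ne_zero
  choose S hS using fun (k : ℕ) (y : 𝔸) => exists_smul_add_commutator_eq hN (hk k) y
  -- The coefficients of P and, below, of its inverse R, solved from the recursions with initial
  -- term 1.
  let a : ℕ → 𝔸 := fun k => Nat.rec 1 (fun k p => S k (-(F * p))) k
  let c : ℕ → 𝔸 := fun k => Nat.rec 1 (fun k p => S k (p * F)) k
  have ha : ∀ k : ℕ, ((k + 1 : ℕ) : ℂ) • a (k + 1) + (N * a (k + 1) - a (k + 1) * N) = -(F * a k) :=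
    fun k => hS k _
  have hc : ∀ k : ℕ, ((k + 1 : ℕ) : ℂ) • c (k + 1) + (N * c (k + 1) - c (k + 1) * N) = c k * F :=
    fun k => hS k _
  have ea : IsEntire a := isEntire_of_recursion (N := N) (C := ‖F‖) fun k => by
    rw [ha, norm_neg]
    exact norm_mul_le _ _
  have ec : IsEntire c := isEntire_of_recursion (N := N) (C := ‖F‖) fun k => by
    rw [hc, mul_comm ‖F‖]
    exact norm_mul_le _ _
  have hconj : ∀ (z : ℂ) (x : 𝔸), HasSum (fun k => z ^ k • conjCoeff a c k x)
      ((∑' k, z ^ k • a k) * x * ∑' k, z ^ k • c k) := by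
    intro z x
    have s1 : Summable fun k => ‖z ^ k • a k * x‖ :=
      Summable.of_nonneg_of_le (fun _ => norm_nonneg _) (fun k => norm_mul_le _ _)
        ((ea.summable_smul z).mul_right ‖x‖)
    have s2 := ec.summable_smul z
    have h1 := tsum_mul_tsum_eq_tsum_sum_antidiagonal_of_summable_norm s1 s2
    have h2 := (summable_norm_sum_mul_antidiagonal_of_summable_norm s1 s2).of_norm.hasSum
    rw [← h1, (ea.summable_smul z).of_norm.tsum_mul_right] at h2
    refine h2.congr_fun fun k => ?_
    rw [conjCoeff, Finset.smul_sum]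
    refine Finset.sum_congr rfl fun p hp => ?_
    rw [← Finset.HasAntidiagonal.mem_antidiagonal.1 hp, pow_add, smul_mul_assoc, smul_mul_assoc, mul_smul_comm,
      smul_smul]
  refine ⟨fun z => ∑' k, z ^ k • a k, fun z => ∑' k, z ^ k • c k, fun z => ⟨_, ea.hasDerivAt z, ?_⟩,
    fun z => ?_, fun 𝔰 hcl hs hF z x hx => ?_⟩
  · have h0 := (ea.summable_smul z).of_norm
    have h1 : Summable fun k => z ^ (k + 1) • a (k + 1) := (summable_nat_add_iff 1).2 h0
    have h2 : z • (F * ∑' k, z ^ k • a k) = ∑' k, z ^ (k + 1) • (F * a k) := by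
      rw [← h0.tsum_mul_left, ← (h0.mul_left F).tsum_const_smul]
      refine tsum_congr fun k => ?_
      rw [mul_smul_comm, smul_smul, pow_succ']
    have h2' : Summable fun k => z ^ (k + 1) • (F * a k) := by
      refine ((h0.mul_left F).const_smul z).congr fun k => ?_
      rw [mul_smul_comm, smul_smul, pow_succ']
    have h3 : (∑' k, z ^ k • a k) * N - N * ∑' k, z ^ k • a k =
        ∑' k, z ^ (k + 1) • (a (k + 1) * N - N * a (k + 1)) := by
      rw [← h0.tsum_mul_left, ← h0.tsum_mul_right, ← (h0.mul_right N).tsum_sub (h0.mul_left N),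
        ((h0.mul_right N).sub (h0.mul_left N)).tsum_eq_zero_add]
      have : z ^ 0 • a 0 * N - N * z ^ 0 • a 0 = 0 := by
        simp [a]
      rw [this, zero_add]
      refine tsum_congr fun k => ?_
      rw [mul_smul_comm, smul_mul_assoc, smul_sub]
    have h3' : Summable fun k => z ^ (k + 1) • (a (k + 1) * N - N * a (k + 1)) := by
      refine ((h1.mul_right N).sub (h1.mul_left N)).congr fun k => ?_
      rw [mul_smul_comm, smul_mul_assoc, smul_sub]
    have h4 : Summable fun k : ℕ => ((k : ℂ) * z ^ (k - 1)) • a k := by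
      have := ea.summable (2 * (‖z‖ + 1))
      refine Summable.of_norm_bounded this fun k => ?_
      rw [norm_smul, norm_mul, norm_pow, Complex.norm_natCast, mul_comm, mul_pow]
      have h3 : (k : ℝ) ≤ 2 ^ k := by exact_mod_cast (Nat.lt_two_pow_self).le
      have h4 : ‖z‖ ^ (k - 1) ≤ (‖z‖ + 1) ^ k :=
        (pow_le_pow_left₀ (norm_nonneg _) (by linarith) _).trans
          (pow_le_pow_right₀ (by linarith [norm_nonneg z]) (Nat.sub_le _ _))
      gcongr
    rw [h3, h2, ← h3'.tsum_sub h2', h4.tsum_eq_zero_add]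
    simp only [Nat.cast_zero, zero_mul, zero_smul, zero_add]
    rw [← ((summable_nat_add_iff 1).2 h4).tsum_const_smul]
    refine tsum_congr fun k => ?_
    rw [smul_smul, Nat.add_sub_cancel, mul_left_comm, ← pow_succ', ← smul_sub, mul_comm, mul_smul]
    congr 1
    have := ha k
    rw [eq_sub_iff_add_eq, eq_sub_iff_add_eq, ← sub_eq_zero, ← sub_eq_zero.2 this]
    abel
  -- For x = 1 the recursion becomes homogeneous, since the previous coefficient commutes with F;
  -- invertibility of k + 1 + ad N leaves only the constant term.
  · have h1 : ∀ k, conjCoeff a c (k + 1) 1 = 0 := by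
      intro k
      have h2 : conjCoeff a c k 1 = (if k = 0 then 1 else 0) ∧ conjCoeff a c (k + 1) 1 = 0 := by
        induction k with
        | zero =>
          have h0 : conjCoeff a c 0 1 = 1 := by simp [conjCoeff, a, c]
          refine ⟨by rw [h0, if_pos rfl], ?_⟩
          have := mem_of_smul_add_commutator_mem hN (hk 0) (𝔰 := ⊥) (x := conjCoeff a c 1 1)
            (by rintro x rfl; simp)
            (by
              rw [conjCoeff_recursion rfl rfl ha hc, h0]
              simp [conjCoeff])
          exact this
        | succ k ih =>
          refine ⟨by rw [ih.2, if_neg k.succ_ne_zero], ?_⟩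
          have := mem_of_smul_add_commutator_mem hN (hk (k + 1)) (𝔰 := ⊥)
            (x := conjCoeff a c (k + 2) 1) (by rintro x rfl; simp)
            (by
              rw [conjCoeff_recursion rfl rfl ha hc, ih.2]
              simp [conjCoeff])
          exact this
      exact h2.2
    have h2 := hconj z 1
    rw [mul_one] at h2
    refine h2.unique ?_
    convert hasSum_single (f := fun k => z ^ k • conjCoeff a c k 1) 0 ?_ using 1
    · simp [conjCoeff, a, c]
    · intro k hk
      obtain ⟨j, rfl⟩ := Nat.exists_eq_succ_of_ne_zero hk
      simp only [Nat.succ_eq_add_one, h1, smul_zero]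
  · exact hcl.mem_of_tendsto (hconj z x) (Filter.Eventually.of_forall fun s =>
      𝔰.sum_mem fun k _ => 𝔰.smul_mem _ (conjCoeff_mem hN rfl rfl ha hc hs hF k hx))

end Frobenius

end OperConn

namespace OperConn

/-! ### Exponentials of nilpotent matrices. -/

section NilpotentExp

open scoped Matrix.Norms.Operator
open NormedSpace (exp)
open Polynomial (aeval)

variable {n : ℕ}

theorem exists_exp_eq {ν : Matrix (Fin n) (Fin n) ℂ} (hν : IsNilpotent ν) :
    ∃ q : Polynomial ℂ, exp ν = aeval ν (1 + Polynomial.X * (1 + Polynomial.X * q)) := by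
  obtain ⟨d, hd⟩ := hν
  refine ⟨∑ i ∈ Finset.range d, Polynomial.C (((i + 2).factorial : ℂ)⁻¹) * Polynomial.X ^ i, ?_⟩
  have h1 : exp ν = ∑ i ∈ Finset.range (d + 2), ((i.factorial : ℂ)⁻¹) • ν ^ i := by
    rw [NormedSpace.exp_eq_tsum ℂ]
    refine tsum_eq_sum fun i hi => ?_
    rw [Finset.mem_range, not_lt] at hi
    rw [pow_eq_zero_of_le (by omega) hd, smul_zero]
  rw [h1, Finset.sum_range_succ', Finset.sum_range_succ']
  simp only [map_add, map_one, map_mul, Polynomial.aeval_X, map_sum, map_pow, Polynomial.aeval_C,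
    Finset.mul_sum, mul_add, mul_one]
  rw [add_comm, add_comm (Finset.sum _ _)]
  congr 1
  · simp
  · congr 1
    · simp
    · refine Finset.sum_congr rfl fun i _ => ?_
      rw [Algebra.algebraMap_eq_smul_one, smul_one_mul, mul_smul_comm, mul_smul_comm, pow_succ',
        pow_succ']

theorem isNilpotent_exp_sub_one {ν : Matrix (Fin n) (Fin n) ℂ} (hν : IsNilpotent ν) :
    IsNilpotent (exp ν - 1) := by
  obtain ⟨q, hq⟩ := exists_exp_eq hν
  rw [hq, map_add, map_one, add_sub_cancel_left, map_mul, Polynomial.aeval_X]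
  refine Commute.isNilpotent_mul_right ?_ hν
  have := Commute.map (Commute.all (Polynomial.X : Polynomial ℂ) (1 + Polynomial.X * q)) (aeval ν)
  rwa [Polynomial.aeval_X] at this

/-- Modulo higher powers of ν, ν^i is (exp ν - 1)^i. So commutation with X descends from the
vanishing powers to ν itself. -/
theorem commute_of_commute_exp {ν X : Matrix (Fin n) (Fin n) ℂ} (hν : IsNilpotent ν)
    (h : Commute X (exp ν)) : Commute X ν := by
  obtain ⟨q, hq⟩ := exists_exp_eq hν
  obtain ⟨d, hd⟩ := hν
  have hu : Commute X (aeval ν (Polynomial.X * (1 + Polynomial.X * q))) := by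
    have h1 := h.sub_right (Commute.one_right X)
    rwa [hq, map_add, map_one, add_sub_cancel_left] at h1
  have key : ∀ j, ∀ i, d ≤ i + j → Commute X (ν ^ i) := by
    intro j
    induction j with
    | zero =>
      intro i hi
      rw [pow_eq_zero_of_le (by omega) hd]
      exact Commute.zero_right X
    | succ j ih =>
      intro i hi
      have hdvd : (Polynomial.X : Polynomial ℂ) ∣ (1 + Polynomial.X * q) ^ i - 1 := by
        have := sub_dvd_pow_sub_pow (1 + Polynomial.X * q) 1 i
        rw [one_pow, add_sub_cancel_left] at this
        exact (dvd_mul_right _ _).trans this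
      obtain ⟨r, hr⟩ := hdvd
      have h2 : ν ^ i = (aeval ν (Polynomial.X * (1 + Polynomial.X * q))) ^ i -
          aeval ν (Polynomial.X ^ (i + 1) * r) := by
        rw [← map_pow, ← map_sub, mul_pow, sub_eq_iff_eq_add.1 hr, pow_succ, mul_assoc, mul_add,
          mul_one, add_sub_cancel_left, map_pow, Polynomial.aeval_X]
      rw [h2]
      refine (hu.pow_right i).sub_right ?_
      rw [Polynomial.aeval_eq_sum_range]
      refine Commute.sum_right _ _ _ fun k _ => ?_
      by_cases hk : i + 1 ≤ k
      · exact (ih k (by omega)).smul_right _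
      · rw [Polynomial.coeff_X_pow_mul', if_neg hk, zero_smul]
        exact Commute.zero_right X
  simpa using key d 1 (by omega)

end NilpotentExp

/-! ### The monodromy around 0. -/

section Monodromy

open scoped Matrix.Norms.Operator
open NormedSpace (exp)
open LaurentPolynomial

variable {n : ℕ} {G : Subgroup (GL (Fin n) ℂ)}

theorem nabla_map_evalPoly (N F : Matrix (Fin n) (Fin n) ℂ) (z : ℂˣ) :
    (nabla N F).map (evalPoly z) = (z : ℂ)⁻¹ • N + F := by
  rw [nabla, Matrix.map_add _ (map_add _), matrix_evalPoly_smul, matrix_evalPoly_const,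
    matrix_evalPoly_const, evalPoly_T, zpow_neg_one]

/-- The solution P(t) t^{-N} along t = t₀ exp(2πis), normalized at s = 0; P returns to its value, so
only exp(-2πiN) remains. -/
theorem isMonodromy_nabla {N F : Matrix (Fin n) (Fin n) ℂ} {P : ℂ → Matrix (Fin n) (Fin n) ℂ}
    (hP : ∀ z, ∃ dP, HasDerivAt P dP z ∧ z • dP = P z * N - N * P z - z • (F * P z))
    (t₀ : ℂˣ) {Q : Matrix (Fin n) (Fin n) ℂ} (hQ : P t₀ * Q = 1) {M : GL (Fin n) ℂ}
    (hM : M.1 = P t₀ * (expGL ((-(2 * Real.pi * Complex.I) : ℂ) • N)).1 * Q) :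
    IsMonodromy (nabla N F) t₀ M := by
  set ω : ℂ := 2 * Real.pi * Complex.I with hω
  have hexp : Complex.exp ω = 1 := Complex.exp_two_pi_mul_I
  let t : ℂ → ℂ := fun s => t₀ * Complex.exp (ω * s)
  let Y : ℂ → Matrix (Fin n) (Fin n) ℂ := fun s => P (t s) * (expGL (s • ((-ω) • N))).1 * Q
  refine ⟨fun s => Y s, ?_, ?_, fun s i j => ?_⟩
  · simp [Y, t, expGL_zero, hQ]
  · simp [Y, t, hexp, hM]
  · obtain ⟨dP, hdP, hdP'⟩ := hP (t s)
    have ht : HasDerivAt t (ω * t s) s := by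
      have h1 := ((hasDerivAt_id (s : ℂ)).const_mul ω).cexp.const_mul (t₀ : ℂ)
      refine h1.congr_deriv ?_
      change t₀ * (Complex.exp (ω * s) * (ω * 1)) = ω * (t₀ * Complex.exp (ω * s))
      ring
    have h1 : ∀ i j, HasDerivAt (fun s => P (t s) i j) (((ω * t s) • dP) i j) s := by
      have h2 := hdP.scomp (s : ℂ) ht
      intro i j
      exact hasDerivAt_pi.1 (hasDerivAt_pi.1 h2 i) j
    have h2 := hasDerivAt_entry_mul h1 (hasDerivAt_entry_exp ((-ω) • N) s)
    have h3 := hasDerivAt_entry_mul (A' := fun _ => Q) (dA' := 0) h2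
      (fun i j => hasDerivAt_const (s : ℂ) (Q i j))
    have h4 := (h3 i j).comp_ofReal
    have hz : (loopPoint t₀ s : ℂ) = t s := rfl
    have hz0 : t s ≠ 0 := by rw [← hz]; exact (loopPoint t₀ s).ne_zero
    refine h4.congr_deriv ?_
    rw [nabla_map_evalPoly, hz]
    have h5 : (ω * t s) • dP = ω • (P (t s) * N - N * P (t s) - t s • (F * P (t s))) := by
      rw [← hdP', smul_smul]
    rw [h5, mul_zero, add_zero]
    symm
    change -(ω * t s) * (((t s)⁻¹ • N + F) * Y s) i j = _
    rw [← smul_eq_mul, ← Matrix.smul_apply]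
    refine congrFun (congrFun ?_ i) j
    simp only [Y]
    have h6 : -(ω * t s) • ((t s)⁻¹ • N + F) = -(ω • N) - (ω * t s) • F := by
      rw [smul_add, smul_smul, neg_mul, mul_assoc, mul_inv_cancel₀ hz0, mul_one]
      module
    rw [← smul_mul_assoc, h6]
    simp only [mul_assoc, sub_mul, add_mul, smul_sub, smul_mul_assoc, mul_smul_comm, neg_mul,
      smul_smul, neg_smul, mul_neg]
    abel

/-- Conjugation by P(t₀) preserves Lie G because ad N and ad F do, so the monodromy exp ν, with ν =
P(t₀)(-2πiN)P(t₀)⁻¹ in Lie G, lies in G without P(t₀) being known to do so. Its centralizer in Lie G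
is that of ν, the conjugate of the centralizer of N. -/
theorem hasPrincipalUnipotentMonodromy_nabla (hG : IsZariskiClosed (G : Set (GL (Fin n) ℂ)))
    (N F : lieAlg G) (hN : IsNilpotent N.1) {r : ℕ}
    (hr : Module.finrank ℂ (LinearMap.ker (LieAlgebra.ad ℂ (lieAlg G) N)) = r) :
    HasPrincipalUnipotentMonodromy G r (nabla N.1 F.1) := by
  intro t₀
  obtain ⟨P, R, hP, hPR, hmem⟩ := exists_frobenius F.1 hN
  set p := P t₀
  set q := R t₀
  have hpq : p * q = 1 := hPR t₀
  have hqp : q * p = 1 := mul_eq_one_comm.1 hpq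
  have hconj : ∀ X : lieAlg G, p * X.1 * q ∈ lieAlg G := fun X =>
    hmem (lieAlg G).toSubmodule (Submodule.closed_of_finiteDimensional _)
      (fun x hx => (lieAlg G).lie_mem N.2 hx) (fun x hx => (lieAlg G).lie_mem F.2 hx) t₀ X.1 X.2
  let φ : lieAlg G →ₗ[ℂ] lieAlg G :=
    { toFun := fun X => ⟨p * X.1 * q, hconj X⟩
      map_add' := fun X Y => by ext1; simp [mul_add, add_mul]
      map_smul' := fun c X => by ext1; simp }
  have hqpq : ∀ X : Matrix (Fin n) (Fin n) ℂ, q * (p * X * q) * p = X := by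
    intro X
    calc q * (p * X * q) * p = (q * p) * X * (q * p) := by simp only [mul_assoc]
      _ = X := by rw [hqp, one_mul, mul_one]
  have hmul : ∀ X Y : Matrix (Fin n) (Fin n) ℂ, p * (X * Y) * q = (p * X * q) * (p * Y * q) := by
    intro X Y
    calc p * (X * Y) * q = p * X * 1 * Y * q := by simp only [mul_assoc, one_mul]
      _ = _ := by rw [← hqp]; simp only [mul_assoc]
  have hinj : Function.Injective φ := by
    intro X Y h
    ext1
    have h1 : p * X.1 * q = p * Y.1 * q := congrArg Subtype.val h
    rw [← hqpq X.1, h1, hqpq]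
  let e := LinearEquiv.ofInjectiveEndo φ hinj
  have he : ∀ X : lieAlg G, (e X).1 = p * X.1 * q := fun X => rfl
  set ω : ℂ := -(2 * Real.pi * Complex.I) with hω
  have hω0 : ω ≠ 0 := by
    rw [hω]
    exact neg_ne_zero.2 Complex.two_pi_I_ne_zero
  set ν := e (ω • N) with hν
  let g : GL (Fin n) ℂ := ⟨p, q, hpq, hqp⟩
  have hνc : ν.1 = g.1 * (ω • N.1) * g⁻¹.1 := rfl
  have hνn : IsNilpotent ν.1 := by
    obtain ⟨d, hd⟩ := hN
    refine ⟨d, ?_⟩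
    rw [hνc, Units.conj_pow, smul_pow, hd, smul_zero, mul_zero, zero_mul]
  refine ⟨expGL ν.1, isMonodromy_nabla hP t₀ hpq ?_, expGL_mem hG ν.2, isNilpotent_exp_sub_one hνn, ?_⟩
  · rw [hνc, expGL_conj]
    rfl
  · rw [← hr]
    have hcomm : ∀ X : lieAlg G, X ∈ LinearMap.ker (LieAlgebra.ad ℂ (lieAlg G) N) ↔
        (e X).1 * ν.1 = ν.1 * (e X).1 := by
      intro X
      have h1 : (e X).1 * ν.1 = ω • (p * (X.1 * N.1) * q) := by
        rw [hmul, he, he]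
        simp
      have h2 : ν.1 * (e X).1 = ω • (p * (N.1 * X.1) * q) := by
        rw [hmul, he, he]
        simp
      rw [h1, h2, LinearMap.mem_ker, LieAlgebra.ad_apply, ← Subtype.coe_inj, lieAlg_lie_coe]
      constructor
      · intro h
        rw [sub_eq_zero.1 h]
      · intro h
        have h3 := smul_right_injective _ hω0 h
        have h3 : p * (X.1 * N.1) * q = p * (N.1 * X.1) * q := h3
        rw [← hqpq (N.1 * X.1), ← hqpq (X.1 * N.1), h3, sub_self]
        rfl
    have hmem' : ∀ X : Matrix (Fin n) (Fin n) ℂ,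
        X ∈ lieAlg (G ⊓ Subgroup.centralizer {expGL ν.1}) ↔ X ∈ lieAlg G ∧ X * ν.1 = ν.1 * X := by
      intro X
      rw [mem_lieAlg_inf_centralizer hG]
      refine and_congr_right fun _ => ⟨fun h => commute_of_commute_exp hνn h, fun h => ?_⟩
      exact Commute.exp_right (show Commute X ν.1 from h)
    have heq : (lieAlg (G ⊓ Subgroup.centralizer {expGL ν.1})).toSubmodule =
        ((LinearMap.ker (LieAlgebra.ad ℂ (lieAlg G) N)).map e.toLinearMap).map
          (lieAlg G).toSubmodule.subtype := by
      ext X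
      rw [LieSubalgebra.mem_toSubmodule, hmem', Submodule.mem_map]
      constructor
      · rintro ⟨h1, h2⟩
        refine ⟨⟨X, h1⟩, ⟨e.symm ⟨X, h1⟩, (hcomm _).2 ?_, e.apply_symm_apply _⟩, rfl⟩
        rw [e.apply_symm_apply]
        exact h2
      · rintro ⟨_, ⟨Y, hY, rfl⟩, rfl⟩
        exact ⟨(e Y).2, (hcomm Y).1 hY⟩
    change Module.finrank ℂ (lieAlg (G ⊓ Subgroup.centralizer {expGL ν.1})).toSubmodule = _
    rw [heq, Submodule.finrank_map_subtype_eq]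
    exact LinearEquiv.finrank_map_eq e _

end Monodromy

end OperConn

namespace OperConn

/-! ### Conjugation by the exponential of a nilpotent matrix. -/

section ExpConj

open scoped Matrix.Norms.Operator
open NormedSpace (exp)

variable {n : ℕ}

theorem exp_eq_sum_of_pow_eq_zero {z : Matrix (Fin n) (Fin n) ℂ} {d : ℕ} (hd : z ^ d = 0) :
    exp z = ∑ i ∈ Finset.range d, ((i.factorial : ℂ)⁻¹) • z ^ i := by
  rw [NormedSpace.exp_eq_tsum ℂ]
  refine tsum_eq_sum fun i hi => ?_
  rw [Finset.mem_range, not_lt] at hi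
  rw [pow_eq_zero_of_le hi hd, smul_zero]

/-- Left multiplication is ad z plus right multiplication, and these commute and are nilpotent, so
their exponentials multiply. -/
theorem exp_mul_eq {z : Matrix (Fin n) (Fin n) ℂ} {d : ℕ} (hd : z ^ d = 0)
    (hd' : LieAlgebra.ad ℂ (Matrix (Fin n) (Fin n) ℂ) z ^ d = 0) (v : Matrix (Fin n) (Fin n) ℂ) :
    exp z * v * exp (-z) = ∑ i ∈ Finset.range d,
      ((i.factorial : ℂ)⁻¹) • (LieAlgebra.ad ℂ (Matrix (Fin n) (Fin n) ℂ) z ^ i) v := by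
  set D := LieAlgebra.ad ℂ (Matrix (Fin n) (Fin n) ℂ) z with hD
  set R := LinearMap.mulRight ℂ z with hR
  set L := LinearMap.mulLeft ℂ z with hL
  have hsum : D + R = L := by
    rw [hD, congrFun (LieAlgebra.ad_eq_lmul_left_sub_lmul_right (R := ℂ) _) z]
    simp [hL, hR]
  have hRd : R ^ d = 0 := by rw [hR, LinearMap.pow_mulRight, hd, LinearMap.mulRight_zero_eq_zero]
  have hLd : L ^ d = 0 := by rw [hL, LinearMap.pow_mulLeft, hd, LinearMap.mulLeft_zero_eq_zero]
  have hcomm : Commute D R := by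
    have : D = L - R := by rw [← hsum, add_sub_cancel_right]
    rw [this]
    exact (LinearMap.commute_mulLeft_right z z).sub_left (Commute.refl R)
  have h1 := IsNilpotent.exp_add_of_commute hcomm ⟨d, hd'⟩ ⟨d, hRd⟩
  have hcomm' : Commute (IsNilpotent.exp D) (IsNilpotent.exp R) := by
    rw [IsNilpotent.exp_eq_sum hd', IsNilpotent.exp_eq_sum hRd]
    refine Commute.sum_left _ _ _ fun i _ => Commute.sum_right _ _ _ fun j _ => ?_
    exact ((hcomm.pow_pow i j).smul_left _).smul_right _
  have hq : ∀ (i : ℕ) (w : Matrix (Fin n) (Fin n) ℂ),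
      ((i.factorial : ℚ)⁻¹) • w = ((i.factorial : ℂ)⁻¹) • w := by
    intro i w
    rw [← Rat.cast_smul_eq_qsmul ℂ]
    push_cast
    rfl
  have happ : ∀ (S : Module.End ℂ (Matrix (Fin n) (Fin n) ℂ)), S ^ d = 0 → ∀ w,
      IsNilpotent.exp S w = ∑ i ∈ Finset.range d, ((i.factorial : ℂ)⁻¹) • (S ^ i) w := by
    intro S hS w
    rw [IsNilpotent.exp_eq_sum hS, LinearMap.sum_apply]
    refine Finset.sum_congr rfl fun i _ => ?_
    rw [← hq, LinearMap.smul_apply]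
  rw [hsum, hcomm'.eq] at h1
  have h2 := LinearMap.congr_fun h1 v
  rw [Module.End.mul_apply, happ L hLd, happ R hRd] at h2
  simp only [hL, hR, LinearMap.pow_mulLeft, LinearMap.pow_mulRight, LinearMap.mulLeft_apply,
    LinearMap.mulRight_apply] at h2
  rw [← happ D hd']
  have h3 : exp z * v = IsNilpotent.exp D v * exp z := by
    rw [exp_eq_sum_of_pow_eq_zero hd, Finset.sum_mul, Finset.mul_sum]
    simp only [smul_mul_assoc, mul_smul_comm]
    exact h2
  rw [h3, mul_assoc]
  have h4 := (expGL z).mul_inv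
  change exp z * exp (-z) = 1 at h4
  rw [h4, mul_one]

/-- The first terms of the adjoint action of an exponential. -/
theorem exp_conj_sub_mem {z : Matrix (Fin n) (Fin n) ℂ} (hz : IsNilpotent z)
    {𝔰 : Submodule ℂ (Matrix (Fin n) (Fin n) ℂ)} (hs : ∀ y ∈ 𝔰, z * y - y * z ∈ 𝔰)
    {v : Matrix (Fin n) (Fin n) ℂ} (hv : z * (z * v - v * z) - (z * v - v * z) * z ∈ 𝔰) :
    exp z * v * exp (-z) - v - (z * v - v * z) ∈ 𝔰 := by
  obtain ⟨d₁, h₁⟩ := hz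
  obtain ⟨d₂, h₂⟩ := LieAlgebra.ad_nilpotent_of_nilpotent (R := ℂ) ⟨d₁, h₁⟩
  rw [exp_mul_eq (d := d₁ + d₂ + 2) (pow_eq_zero_of_le (by omega) h₁)
    (pow_eq_zero_of_le (by omega) h₂), Finset.sum_range_succ', Finset.sum_range_succ']
  have h3 : ∀ i, (LieAlgebra.ad ℂ (Matrix (Fin n) (Fin n) ℂ) z ^ (i + 2)) v ∈ 𝔰 := by
    intro i
    induction i with
    | zero => exact hv
    | succ i ih =>
      rw [show i + 1 + 2 = (i + 2) + 1 by ring, pow_succ']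
      exact hs _ ih
  have h4 : (LieAlgebra.ad ℂ (Matrix (Fin n) (Fin n) ℂ) z) v = z * v - v * z := rfl
  simp only [zero_add, Nat.factorial_zero, Nat.factorial_one, Nat.cast_one, inv_one, one_smul,
    pow_zero, pow_one, Module.End.one_apply, h4]
  rw [add_sub_cancel_right, add_sub_cancel_right]
  exact 𝔰.sum_mem fun i _ => 𝔰.smul_mem _ (h3 i)

end ExpConj

/-! ### Normal form of nilpotent elements of N + 𝔟 under B. -/

section Normalization

open LieAlgebra LieAlgebra.IsKilling Module

variable {n : ℕ} {G : Subgroup (GL (Fin n) ℂ)} [IsSimpleAlgebraicGroup G]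
  {H : LieSubalgebra ℂ (lieAlg G)} [H.IsCartanSubalgebra]
  (b : (rootSystem H).Base)

/-- Elements whose adjoint action is unipotent with respect to the filtration by height. -/
def IsFiltUnipotent (g : GL (Fin n) ℂ) : Prop :=
  ∀ (j : ℤ) (v : lieAlg G), v ∈ filt b j → ∃ w ∈ filt b (j + 1), g.1 * v.1 * g⁻¹.1 = v.1 + w.1

variable {b}

theorem IsFiltUnipotent.mul {g g' : GL (Fin n) ℂ} (h : IsFiltUnipotent b g)
    (h' : IsFiltUnipotent b g') : IsFiltUnipotent b (g * g') := by
  intro j v hv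
  obtain ⟨w', hw', e'⟩ := h' j v hv
  obtain ⟨w, hw, e⟩ := h j (v + w') (add_mem hv (filt_anti b (by omega) hw'))
  refine ⟨w' + w, add_mem hw' hw, ?_⟩
  calc (g * g').1 * v.1 * (g * g')⁻¹.1 = g.1 * (g'.1 * v.1 * g'⁻¹.1) * g⁻¹.1 := by
        rw [mul_inv_rev, Units.val_mul, Units.val_mul]
        simp only [mul_assoc]
    _ = g.1 * (v + w').1 * g⁻¹.1 := by rw [e']; rfl
    _ = v.1 + (w' + w).1 := by
        rw [e]
        change v.1 + w'.1 + w.1 = v.1 + (w'.1 + w.1)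
        abel

theorem isFiltUnipotent_one : IsFiltUnipotent b (1 : GL (Fin n) ℂ) :=
  fun j v _ => ⟨0, zero_mem _, by simp⟩

theorem exp_conj_sub_mem_filt {z v : lieAlg G} {k j : ℤ} (hk : 0 < k) (hz : z ∈ deg b k)
    (hv : ⁅z, ⁅z, v⁆⁆ ∈ filt b j) :
    ∃ w ∈ filt b j, (expGL z.1).1 * v.1 * (expGL z.1)⁻¹.1 = v.1 + ⁅z, v⁆.1 + w.1 := by
  have hnil : IsNilpotent z.1 := isNilpotent_of_mul_sub_mul_eq_smul
    (by exact_mod_cast hk.ne') (rho_mul_sub hz)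
  have h := exp_conj_sub_mem hnil (v := v.1) (𝔰 := (filt b j).map (lieAlg G).toSubmodule.subtype)
    (by
      rintro _ ⟨y, hy, rfl⟩
      let y' : lieAlg G := y
      have hy' : y' ∈ filt b j := hy
      let u : lieAlg G := ⁅z, y'⁆
      have hu : u ∈ filt b j := lie_mem_filt (deg_le_filt b le_rfl hz) hy' (by omega)
      exact ⟨u, hu, lieAlg_lie_coe z y'⟩)
    ⟨_, hv, by
      change ⁅z, ⁅z, v⁆⁆.1 = _
      rw [lieAlg_lie_coe, lieAlg_lie_coe]⟩
  obtain ⟨w, hw, e⟩ := h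
  refine ⟨w, hw, ?_⟩
  have e' : w.1 = _ := e
  rw [e', lieAlg_lie_coe]
  change NormedSpace.exp z.1 * v.1 * NormedSpace.exp (-z.1) = _
  abel

theorem isFiltUnipotent_expGL {z : lieAlg G} {k : ℤ} (hk : 0 < k) (hz : z ∈ deg b k) :
    IsFiltUnipotent b (expGL z.1) := by
  intro j v hv
  have hz' : z ∈ filt b 1 := deg_le_filt b (by omega) hz
  have h1 : ⁅z, v⁆ ∈ filt b (j + 1) := lie_mem_filt hz' hv (by omega)
  have h2 : ⁅z, ⁅z, v⁆⁆ ∈ filt b (j + 1) := filt_anti b (by omega) (lie_mem_filt hz' h1 le_rfl)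
  obtain ⟨w, hw, e⟩ := exp_conj_sub_mem_filt hk hz h2
  exact ⟨⁅z, v⁆ + w, add_mem h1 hw, by rw [e, add_assoc]; rfl⟩

/-- The elements `ρ + 𝔫` are conjugate to `ρ` under the unipotent radical of `B`. -/
theorem exists_conj_rho {B : Subgroup (GL (Fin n) ℂ)}
    (hB : IsConnectedSubgroupWithLie G B (borelSubspace b)) {m : lieAlg G} (hm : m ∈ filt b 1) :
    ∃ g ∈ B, IsFiltUnipotent b g ∧
      g.1 * ((rhoCheck b).1 + m).1 * g⁻¹.1 = (rhoCheck b).1.1 := by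
  have key : ∀ k : ℕ, ∃ g ∈ B, IsFiltUnipotent b g ∧ ∃ w ∈ filt b (1 + k),
      g.1 * ((rhoCheck b).1 + m).1 * g⁻¹.1 = ((rhoCheck b).1 + w).1 := by
    intro k
    induction k with
    | zero => exact ⟨1, B.one_mem, isFiltUnipotent_one, m, by simpa using hm, by simp⟩
    | succ k ih =>
      obtain ⟨g, hg, hgu, w, hw, e⟩ := ih
      rw [filt_succ, Submodule.mem_sup] at hw
      obtain ⟨y, hy, w', hw', rfl⟩ := hw
      have hk : (0 : ℤ) < 1 + k := by positivity
      have hk' : ((1 + k : ℤ) : ℂ) ≠ 0 := by exact_mod_cast hk.ne'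
      -- Chosen so that [z, ρ] = -y; conjugation by exp z then removes the lowest term y and leaves
      -- an error of higher degree.
      set z := ((1 + k : ℤ) : ℂ)⁻¹ • y with hzdef
      have hz : z ∈ deg b (1 + k) := Submodule.smul_mem _ _ hy
      have hzB : z.1 ∈ lieAlg B := by
        rw [mem_lieAlg_of_mem hB, borelSubspace_eq]
        exact deg_le_filt b hk.le hz
      have h1 : ⁅z, (rhoCheck b).1⁆ = -y := by
        rw [← lie_skew, mem_deg.1 hz, hzdef, smul_smul, mul_inv_cancel₀ hk', one_smul]
      have hzf : z ∈ filt b (1 + k) := deg_le_filt b le_rfl hz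
      have h2 : ⁅z, y + w'⁆ ∈ filt b (1 + k + 1) :=
        lie_mem_filt hzf (add_mem (deg_le_filt b le_rfl hy) (filt_anti b (by omega) hw'))
          (by omega)
      have h3 : ⁅z, (rhoCheck b).1 + (y + w')⁆ = -y + ⁅z, y + w'⁆ := by
        rw [lie_add, h1]
      have h4 : ⁅z, ⁅z, (rhoCheck b).1 + (y + w')⁆⁆ ∈ filt b (1 + k + 1) := by
        rw [h3, lie_add]
        refine add_mem ?_ (filt_anti b (by omega) (lie_mem_filt hzf h2 le_rfl))
        exact lie_mem_filt hzf (neg_mem (deg_le_filt b le_rfl hy)) (by omega)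
      obtain ⟨u, hu, e'⟩ := exp_conj_sub_mem_filt hk hz h4
      refine ⟨expGL z.1 * g, B.mul_mem (expGL_mem hB.isClosed hzB) hg,
        (isFiltUnipotent_expGL hk hz).mul hgu, w' + ⁅z, y + w'⁆ + u, ?_, ?_⟩
      · push_cast
        rw [← add_assoc]
        exact add_mem (add_mem hw' h2) hu
      · calc (expGL z.1 * g).1 * ((rhoCheck b).1 + m).1 * (expGL z.1 * g)⁻¹.1
            = (expGL z.1).1 * (g.1 * ((rhoCheck b).1 + m).1 * g⁻¹.1) * (expGL z.1)⁻¹.1 := by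
              rw [mul_inv_rev, Units.val_mul, Units.val_mul]
              simp only [mul_assoc]
          _ = _ := by
              rw [e, e', h3]
              have : (rhoCheck b).1 + (y + w') + (-y + ⁅z, y + w'⁆) + u =
                (rhoCheck b).1 + (w' + ⁅z, y + w'⁆ + u) := by abel
              exact congrArg Subtype.val this
  obtain ⟨K, hK⟩ := exists_filt_eq_bot b
  obtain ⟨g, hg, hgu, w, hw, e⟩ := key K.toNat
  refine ⟨g, hg, hgu, ?_⟩
  have hw0 : w ∈ filt b K := filt_anti b (by omega) hw
  rw [hK, Submodule.mem_bot] at hw0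
  rw [e, hw0, add_zero]

theorem IsMaximalRoot.filt_eq_bot {θ : H.root} (hθ : IsMaximalRoot b θ) :
    filt b (b.height θ + 1) = ⊥ := by
  rw [eq_bot_iff]
  refine iSup_le fun j => ?_
  have h1 := j.2
  have h2 := hθ.height_pos
  rw [hθ.deg_eq_bot]
  rw [abs_of_pos] <;> omega

/-- A negative principal element plus an element of `𝔟`, if nilpotent, is conjugate under `B` to
the negative principal element, by a conjugation that fixes the highest root space. -/
theorem exists_conj_principal {B : Subgroup (GL (Fin n) ℂ)}
    (hB : IsConnectedSubgroupWithLie G B (borelSubspace b)) {x : b.support → lieAlg G}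
    (hx : ∀ i : b.support, x i ∈ rootSpace H (-(i.1.1 : H → ℂ)) ∧ x i ≠ 0)
    {θ : H.root} (hθ : IsMaximalRoot b θ) {w : lieAlg G} (hw : w ∈ filt b 0)
    (hnil : IsNilpotent (∑ i, x i + w).1) :
    ∃ g ∈ B, g.1 * (∑ i, x i + w).1 * g⁻¹.1 = (∑ i, x i).1 ∧
      ∀ F ∈ rootSpace H (θ.1 : H → ℂ), g.1 * F.1 * g⁻¹.1 = F.1 := by
  have hN := isPrincipalNegative_sum hx
  set y := ∑ i, x i + w with hy
  have hyN : y - ∑ i, x i ∈ filt b 0 := by rwa [hy, add_sub_cancel_left]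
  have hnil' : IsNilpotent (ad ℂ (lieAlg G) y) :=
    LieSubalgebra.isNilpotent_ad_of_isNilpotent_ad (lieAlg G)
      (LieAlgebra.ad_nilpotent_of_nilpotent (R := ℂ) hnil)
  obtain ⟨m, hm, hlie⟩ := exists_lie_eq_neg_of_isNilpotent hN hyN hnil' (finrank_cartan_le_ker_ad b y)
  obtain ⟨g, hg, hgu, e⟩ := exists_conj_rho hB hm
  have hyf : y ∈ filt b (-1) :=
    add_mem (deg_le_filt b le_rfl hN.mem) (filt_anti b (by norm_num) hw)
  refine ⟨g, hg, ?_, fun F hF => ?_⟩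
  -- The conjugate y + u satisfies [ρ, y + u] = -(y + u), so it has degree -1. It differs from ∑ xᵢ
  -- by w + u of degree ≥ 0, which must vanish.
  · obtain ⟨u, hu, eu⟩ := hgu (-1) y hyf
    have hu0 : w + u ∈ filt b 0 := add_mem hw (by simpa using hu)
    have hinv := g.inv_mul
    have h1 : ⁅(rhoCheck b).1, y + u⁆ = -(y + u) := by
      ext1
      rw [lieAlg_lie_coe]
      change (rhoCheck b).1.1 * (y.1 + u.1) - (y.1 + u.1) * (rhoCheck b).1.1 = -(y.1 + u.1)
      rw [← eu, ← e]
      have h2 : ∀ A A' : Matrix (Fin n) (Fin n) ℂ, (g.1 * A * g⁻¹.1) * (g.1 * A' * g⁻¹.1) =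
          g.1 * (A * A') * g⁻¹.1 := by
        intro A A'
        calc _ = g.1 * A * (g⁻¹.1 * g.1) * A' * g⁻¹.1 := by simp only [mul_assoc]
          _ = _ := by rw [hinv]; simp only [mul_assoc, one_mul]
      rw [h2, h2, ← sub_mul, ← mul_sub, ← lieAlg_lie_coe, hlie]
      change g.1 * (-y.1) * g⁻¹.1 = _
      rw [mul_neg, neg_mul]
    have h3 : y + u ∈ deg b (-1) := by
      rw [mem_deg, h1]
      push_cast
      rw [neg_one_smul]
    have h4 : w + u ∈ deg b (-1) := by
      have : w + u = (y + u) - ∑ i, x i := by rw [hy]; abel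
      rw [this]
      exact sub_mem h3 hN.mem
    have h5 := (Submodule.disjoint_def.1 (deg_disjoint_filt b (by norm_num : (-1 : ℤ) < 0))) _ h4 hu0
    rw [eu]
    have h6 : y + u = ∑ i, x i := by rw [hy, add_assoc, h5, add_zero]
    exact congrArg Subtype.val h6
  · obtain ⟨u, hu, eu⟩ := hgu (b.height θ) F (deg_le_filt b le_rfl (rootSpace_le_deg b θ hF))
    rw [hθ.filt_eq_bot, Submodule.mem_bot] at hu
    rw [eu, hu]
    exact add_zero _

end Normalization

end OperConn

namespace OperConn

/-! ### Composition of gauge transformations. -/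

section GaugeComp

open LaurentPolynomial

variable {n : ℕ}

theorem derivPoly_mul (f g : ℂ[T;T⁻¹]) :
    derivPoly (f * g) = derivPoly f * g + f * derivPoly g := by
  refine evalPoly_ext fun z => ?_
  obtain ⟨s, rfl⟩ := expUnit_surjective z
  have h1 := (hasDerivAt_evalPoly f s).mul (hasDerivAt_evalPoly g s)
  have h2 := hasDerivAt_evalPoly (f * g) s
  simp only [map_mul] at h2
  have h3 := h2.unique h1
  apply mul_left_cancel₀ (Complex.exp_ne_zero s)
  rw [h3, map_add, map_mul, map_mul]
  ring

theorem matrix_derivPoly_mul (A A' : Matrix (Fin n) (Fin n) ℂ[T;T⁻¹]) :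
    (A * A').map derivPoly = A.map derivPoly * A' + A * A'.map derivPoly := by
  have hsum : ∀ (s : Finset (Fin n)) (f : Fin n → ℂ[T;T⁻¹]),
      derivPoly (∑ i ∈ s, f i) = ∑ i ∈ s, derivPoly (f i) := by
    intro s f
    exact map_sum (AddMonoidHom.mk' derivPoly derivPoly_add) f s
  ext1 a c
  simp only [Matrix.map_apply, Matrix.mul_apply, Matrix.add_apply, hsum, derivPoly_mul,
    Finset.sum_add_distrib]

theorem gauge_mul (g g' : GL (Fin n) ℂ[T;T⁻¹]) (A : Matrix (Fin n) (Fin n) ℂ[T;T⁻¹]) :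
    gauge derivPoly (g * g') A = gauge derivPoly g (gauge derivPoly g' A) := by
  have h : g'.1 * g'⁻¹.1 = 1 := g'.mul_inv
  rw [gauge, gauge, gauge, mul_inv_rev, Units.val_mul, Units.val_mul, matrix_derivPoly_mul]
  simp only [mul_sub, sub_mul, add_mul, mul_assoc]
  rw [← mul_assoc g'.1 g'⁻¹.1, h, one_mul]
  abel

theorem mul_mem_points {K : Subgroup (GL (Fin n) ℂ)} (hK : IsZariskiClosed (K : Set (GL (Fin n) ℂ)))
    {g g' : GL (Fin n) ℂ[T;T⁻¹]} (hg : g ∈ points K ℂ[T;T⁻¹]) (hg' : g' ∈ points K ℂ[T;T⁻¹]) :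
    g * g' ∈ points K ℂ[T;T⁻¹] := by
  rw [mem_points_iff hK] at *
  intro z
  rw [map_mul]
  exact K.mul_mem (hg z) (hg' z)

theorem OperEquiv.trans {K : Subgroup (GL (Fin n) ℂ)} (hK : IsZariskiClosed (K : Set (GL (Fin n) ℂ)))
    {A A' A'' : Matrix (Fin n) (Fin n) ℂ[T;T⁻¹]} (h : OperEquiv K A A') (h' : OperEquiv K A' A'') :
    OperEquiv K A A'' := by
  obtain ⟨g, hg, rfl⟩ := h
  obtain ⟨g', hg', rfl⟩ := h'
  exact ⟨g' * g, mul_mem_points hK hg' hg, gauge_mul g' g A⟩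

theorem const_mul (A A' : Matrix (Fin n) (Fin n) ℂ) :
    const ℂ[T;T⁻¹] (A * A') = const ℂ[T;T⁻¹] A * const ℂ[T;T⁻¹] A' :=
  Matrix.map_mul (f := algebraMap ℂ ℂ[T;T⁻¹])

/-- Constant gauge transformations of connections with two terms. -/
theorem operEquiv_conj {K : Subgroup (GL (Fin n) ℂ)} (hK : IsZariskiClosed (K : Set (GL (Fin n) ℂ)))
    {g : GL (Fin n) ℂ} (hg : g ∈ K) (N F : Matrix (Fin n) (Fin n) ℂ) :
    OperEquiv K (nabla N F) (nabla (g.1 * N * g⁻¹.1) (g.1 * F * g⁻¹.1)) := by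
  refine ⟨Matrix.GeneralLinearGroup.map (algebraMap ℂ ℂ[T;T⁻¹]) g, ?_, ?_⟩
  · rw [mem_points_iff hK]
    intro z
    have : evalGL z (Matrix.GeneralLinearGroup.map (algebraMap ℂ ℂ[T;T⁻¹]) g) = g := by
      ext i j
      exact evalPoly_algebraMap z (g.1 i j)
    rwa [this]
  · have h1 : (Matrix.GeneralLinearGroup.map (algebraMap ℂ ℂ[T;T⁻¹]) g).1 = const ℂ[T;T⁻¹] g.1 := rfl
    have h2 : (Matrix.GeneralLinearGroup.map (algebraMap ℂ ℂ[T;T⁻¹]) g)⁻¹.1 =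
        const ℂ[T;T⁻¹] g⁻¹.1 := by
      rw [← map_inv]
      rfl
    rw [gauge, h1, h2, derivPoly_const, zero_mul, sub_zero, nabla, nabla, const_mul, const_mul,
      const_mul, const_mul, mul_add, add_mul, mul_smul_comm, smul_mul_assoc]

end GaugeComp

/-! ### Coefficients of connections. -/

section Coefficients

open LaurentPolynomial

variable {n : ℕ}

theorem coeffPoly_add (A A' : Matrix (Fin n) (Fin n) ℂ[T;T⁻¹]) (k : ℤ) :
    coeffPoly (A + A') k = coeffPoly A k + coeffPoly A' k := by
  ext i j
  simp [coeffPoly]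

theorem coeffPoly_ext {A A' : Matrix (Fin n) (Fin n) ℂ[T;T⁻¹]}
    (h : ∀ k, coeffPoly A k = coeffPoly A' k) : A = A' := by
  ext i j k
  exact congrFun (congrFun (h k) i) j

theorem coeffPoly_T_smul_const (m k : ℤ) (X : Matrix (Fin n) (Fin n) ℂ) :
    coeffPoly ((T m : ℂ[T;T⁻¹]) • const ℂ[T;T⁻¹] X) k = if k = m then X else 0 := by
  ext i j
  have h : (T m : ℂ[T;T⁻¹]) * algebraMap ℂ ℂ[T;T⁻¹] (X i j) = C (X i j) * T m := by
    rw [← C_eq_algebraMap, mul_comm]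
  have h2 : (C (X i j) * T m : ℂ[T;T⁻¹]).coeff k = if k = m then X i j else 0 := by
    classical
    rw [← single_eq_C_mul_T, AddMonoidAlgebra.coeff_single, Finsupp.single_apply]
    exact if_congr eq_comm rfl rfl
  rw [coeffPoly, Matrix.map_apply, Matrix.smul_apply, smul_eq_mul]
  refine (congrArg (fun f : ℂ[T;T⁻¹] => f.coeff k) h).trans (h2.trans ?_)
  split_ifs <;> rfl

theorem coeffPoly_nabla (N F : Matrix (Fin n) (Fin n) ℂ) (k : ℤ) :
    coeffPoly (nabla N F) k = (if k = -1 then N else 0) + if k = 0 then F else 0 := by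
  have h : const ℂ[T;T⁻¹] F = (T 0 : ℂ[T;T⁻¹]) • const ℂ[T;T⁻¹] F := by rw [T_zero, one_smul]
  rw [nabla, h, coeffPoly_add, coeffPoly_T_smul_const, coeffPoly_T_smul_const]

theorem pullback_one_nabla (c : ℂˣ) (N E : Matrix (Fin n) (Fin n) ℂ) :
    pullback c 1 (nabla N E) = nabla N ((c : ℂ) • E) := by
  rw [pullback_nabla, nabla, sub_self, T_zero, one_smul, Int.cast_one, one_smul, one_mul]

theorem const_sum {ι : Type*} [Fintype ι] (f : ι → Matrix (Fin n) (Fin n) ℂ) :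
    const ℂ[T;T⁻¹] (∑ i, f i) = ∑ i, const ℂ[T;T⁻¹] (f i) :=
  map_sum (AddMonoidHom.mk' (const ℂ[T;T⁻¹]) const_add) f Finset.univ

theorem monomialUnit_smul_const (c : ℂˣ) (m : ℤ) (X : Matrix (Fin n) (Fin n) ℂ) :
    (monomialUnit c m : ℂ[T;T⁻¹]) • const ℂ[T;T⁻¹] X =
      (T m : ℂ[T;T⁻¹]) • const ℂ[T;T⁻¹] ((c : ℂ) • X) := by
  ext1 i j
  change C (c : ℂ) * T m * algebraMap ℂ ℂ[T;T⁻¹] (X i j) =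
    T m * algebraMap ℂ ℂ[T;T⁻¹] ((c : ℂ) * X i j)
  rw [map_mul, C_eq_algebraMap]
  ring

theorem sum_monomialUnit_smul_const {ι : Type*} [Fintype ι] (c : ι → ℂˣ) (m : ℤ)
    (x : ι → Matrix (Fin n) (Fin n) ℂ) :
    ∑ i, (monomialUnit (c i) m : ℂ[T;T⁻¹]) • const ℂ[T;T⁻¹] (x i) =
      (T m : ℂ[T;T⁻¹]) • const ℂ[T;T⁻¹] (∑ i, (c i : ℂ) • x i) := by
  simp only [monomialUnit_smul_const, const_sum, Finset.smul_sum]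

end Coefficients

/-! ### Opers satisfying the local conditions. -/

section Opers

open LieAlgebra LieAlgebra.IsKilling Module LaurentPolynomial

variable {n : ℕ} {G : Subgroup (GL (Fin n) ℂ)} [IsSimpleAlgebraicGroup G]
  {H : LieSubalgebra ℂ (lieAlg G)} [H.IsCartanSubalgebra]
  {b : (rootSystem H).Base} {B : Subgroup (GL (Fin n) ℂ)}
  {x : b.support → lieAlg G} {θ : H.root} {E : lieAlg G}

theorem coe_sum_lieAlg {ι : Type*} [Fintype ι] (x : ι → lieAlg G) : (∑ i, x i).1 = ∑ i, (x i).1 :=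
  map_sum (lieAlg G).toSubmodule.subtype x Finset.univ

/-- The simple roots are a basis of the dual of H, so prescribed values are attained. -/
theorem exists_simple_apply_eq (c : b.support → ℂ) :
    ∃ h : H, ∀ i : b.support, (i.1.1 : H → ℂ) h = c i := by
  let f : H →ₗ[ℂ] b.support → ℂ := LinearMap.pi fun i => (rootSystem H).root i.1
  have hf : Function.Injective f := by
    rw [← LinearMap.ker_eq_bot, LinearMap.ker_eq_bot']
    exact fun a ha => eq_zero_of_simple_apply_eq_zero b fun i => congrFun ha i
  have hfin : finrank ℂ H = finrank ℂ (b.support → ℂ) := by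
    rw [← Subspace.dual_finrank_eq, Module.finrank_eq_card_basis b.toWeightBasis,
      Module.finrank_fintype_fun_eq_card]
  obtain ⟨h, hh⟩ := (LinearMap.injective_iff_surjective_of_finrank_eq_finrank hfin).1 hf c
  exact ⟨h, fun i => congrFun hh i⟩

theorem exp_torus_conj {h : H} {v : lieAlg G} {c : ℂ} (hv : ⁅(h : lieAlg G), v⁆ = c • v) :
    (expGL h.1.1).1 * v.1 * (expGL h.1.1)⁻¹.1 = Complex.exp c • v.1 := by
  have h1 : h.1.1 * v.1 - v.1 * h.1.1 = c • v.1 := by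
    rw [← lieAlg_lie_coe, hv]
    rfl
  have h2 := exp_smul_mul h1 1
  rw [one_smul, mul_one, ← coe_expGL] at h2
  have h3 := (expGL h.1.1).mul_inv
  rw [h2, smul_mul_assoc, mul_assoc]
  change Complex.exp c • (v.1 * ((expGL h.1.1).1 * (expGL h.1.1)⁻¹.1)) = _
  rw [h3, mul_one]

theorem isNilpotent_of_mem_deg {v : lieAlg G} {k : ℤ} (hk : k ≠ 0) (hv : v ∈ deg b k) :
    IsNilpotent v.1 :=
  isNilpotent_of_mul_sub_mul_eq_smul (by exact_mod_cast hk) (rho_mul_sub hv)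

theorem finrank_ker_ad_sum (hx : ∀ i : b.support, x i ∈ rootSpace H (-(i.1.1 : H → ℂ)) ∧ x i ≠ 0) :
    finrank ℂ (LinearMap.ker (ad ℂ (lieAlg G) (∑ i, x i))) = finrank ℂ H :=
  le_antisymm (finrank_ker_ad_le (isPrincipalNegative_sum hx) (by rw [sub_self]; exact zero_mem _))
    (finrank_cartan_le_ker_ad b _)

theorem hasPrincipalUnipotentMonodromy_sum
    (hx : ∀ i : b.support, x i ∈ rootSpace H (-(i.1.1 : H → ℂ)) ∧ x i ≠ 0) (F : lieAlg G) :
    HasPrincipalUnipotentMonodromy G (finrank ℂ H) (nabla (∑ i, x i).1 F.1) :=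
  hasPrincipalUnipotentMonodromy_nabla IsSimpleAlgebraicGroup.isClosed _ F
    (isNilpotent_of_mem_deg (by norm_num) (sum_mem_deg hx)) (finrank_ker_ad_sum hx)

theorem nabla_eq_sum (F : Matrix (Fin n) (Fin n) ℂ) :
    nabla (∑ i, x i).1 F = ∑ i, (monomialUnit 1 (-1) : ℂ[T;T⁻¹]) • const ℂ[T;T⁻¹] (x i).1 +
      const ℂ[T;T⁻¹] F := by
  rw [sum_monomialUnit_smul_const (fun _ => 1) (-1) (fun i => (x i).1), nabla, coe_sum_lieAlg]
  simp

theorem isValuedIn_const {W : Submodule ℂ (Matrix (Fin n) (Fin n) ℂ)} {F : Matrix (Fin n) (Fin n) ℂ}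
    (hF : F ∈ W) : IsValuedIn W (const ℂ[T;T⁻¹] F) := by
  intro k
  have h : const ℂ[T;T⁻¹] F = (T 0 : ℂ[T;T⁻¹]) • const ℂ[T;T⁻¹] F := by rw [T_zero, one_smul]
  rw [h, coeffPoly_T_smul_const]
  split_ifs
  · exact hF
  · exact zero_mem _

theorem mem_lieAlg_of_mem_rootSpace (hB : IsConnectedSubgroupWithLie G B (borelSubspace b))
    (hθ : IsMaximalRoot b θ) (hE : E ∈ rootSpace H (θ.1 : H → ℂ)) : E.1 ∈ lieAlg B := by
  rw [mem_lieAlg_of_mem hB, borelSubspace_eq]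
  exact deg_le_filt b hθ.height_pos.le (rootSpace_le_deg b θ hE)

theorem isOper_nabla (hB : IsConnectedSubgroupWithLie G B (borelSubspace b))
    (hθ : IsMaximalRoot b θ) (hE : E ∈ rootSpace H (θ.1 : H → ℂ)) :
    IsOper B (fun i => (x i).1) (nabla (∑ i, x i).1 E.1) :=
  ⟨fun _ => monomialUnit 1 (-1), const ℂ[T;T⁻¹] E.1,
    isValuedIn_const (mem_lieAlg_of_mem_rootSpace hB hθ hE), nabla_eq_sum E.1⟩

theorem satisfiesLocalConditions_nabla (hB : IsConnectedSubgroupWithLie G B (borelSubspace b))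
    (hx : ∀ i : b.support, x i ∈ rootSpace H (-(i.1.1 : H → ℂ)) ∧ x i ≠ 0)
    (hθ : IsMaximalRoot b θ) (hE : E ∈ rootSpace H (θ.1 : H → ℂ)) (hE0 : E ≠ 0) :
    SatisfiesLocalConditions G B (finrank ℂ H) (fun i => (x i).1)
      ((rootSpace H (θ.1 : H → ℂ)).toSubmodule.map (lieAlg G).toSubmodule.subtype)
      (nabla (∑ i, x i).1 E.1) := by
  have hc : ∀ k, coeffPoly (const ℂ[T;T⁻¹] E.1) k = if k = 0 then E.1 else 0 := by
    intro k
    have h : const ℂ[T;T⁻¹] E.1 = (T 0 : ℂ[T;T⁻¹]) • const ℂ[T;T⁻¹] E.1 := by rw [T_zero, one_smul]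
    rw [h, coeffPoly_T_smul_const]
  refine ⟨fun _ => 1, const ℂ[T;T⁻¹] E.1, isValuedIn_const (mem_lieAlg_of_mem_rootSpace hB hθ hE),
    nabla_eq_sum E.1, fun k hk => ?_, ?_, hasPrincipalUnipotentMonodromy_sum hx E, fun k hk => ?_, ?_, ?_⟩
  · rw [hc, if_neg (by omega)]
  · rw [coeffPoly_nabla, if_pos rfl, if_neg (by norm_num), add_zero]
    exact isNilpotent_of_mem_deg (by norm_num) (sum_mem_deg hx)
  · rw [hc, if_neg (by omega)]
  · rw [hc, if_pos rfl]
    exact ⟨E, hE, rfl⟩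
  · rw [hc, if_pos rfl]
    exact fun h => hE0 (Subtype.ext h)

/-- The pole bounds at 0 and ∞ leave only the coefficients of t⁻¹ and t⁰ in v. -/
theorem eq_nabla_of_satisfiesLocalConditions
    (hB : IsConnectedSubgroupWithLie G B (borelSubspace b)) {r : ℕ}
    {A : Matrix (Fin n) (Fin n) ℂ[T;T⁻¹]}
    (hA : SatisfiesLocalConditions G B r (fun i => (x i).1)
      ((rootSpace H (θ.1 : H → ℂ)).toSubmodule.map (lieAlg G).toSubmodule.subtype) A) :
    ∃ (c : b.support → ℂˣ) (w F : lieAlg G), w ∈ filt b 0 ∧ F ∈ rootSpace H (θ.1 : H → ℂ) ∧ F ≠ 0 ∧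
      IsNilpotent (∑ i, (c i : ℂ) • x i + w).1 ∧ A = nabla (∑ i, (c i : ℂ) • x i + w).1 F.1 := by
  obtain ⟨c, v, hvB, hA, hv0, hnil, -, hv1, ⟨F, hF, hFv⟩, hvne⟩ := hA
  have hFv : F.1 = coeffPoly v 0 := hFv
  have hv : v = (T (-1) : ℂ[T;T⁻¹]) • const ℂ[T;T⁻¹] (coeffPoly v (-1)) + const ℂ[T;T⁻¹] F.1 := by
    refine coeffPoly_ext fun k => ?_
    change _ = coeffPoly (nabla _ _) k
    rw [coeffPoly_nabla]
    rcases lt_trichotomy k (-1) with hk | rfl | hk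
    · rw [hv0 k hk, if_neg hk.ne, if_neg (by omega), add_zero]
    · rw [if_pos rfl, if_neg (by norm_num), add_zero]
    · rcases (show 0 ≤ k by omega).eq_or_lt with rfl | hk'
      · rw [if_neg (by norm_num), if_pos rfl, zero_add, hFv]
      · rw [hv1 k hk', if_neg hk.ne', if_neg hk'.ne', add_zero]
  have hwB : coeffPoly v (-1) ∈ (lieAlg B).toSubmodule := hvB (-1)
  rw [hB.lie_eq] at hwB
  obtain ⟨w, hw, hwv⟩ := hwB
  have hw : w ∈ filt b 0 := by rw [← borelSubspace_eq]; exact hw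
  have hwv : w.1 = coeffPoly v (-1) := hwv
  have hA' : A = nabla (∑ i, (c i : ℂ) • x i + w).1 F.1 := by
    have h1 : (∑ i, (c i : ℂ) • x i + w).1 = ∑ i, (c i : ℂ) • (x i).1 + coeffPoly v (-1) := by
      rw [← hwv]
      exact congrArg (· + w.1) (coe_sum_lieAlg fun i => (c i : ℂ) • x i)
    rw [hA, sum_monomialUnit_smul_const c (-1) (fun i => (x i).1), nabla, h1, const_add, smul_add,
      add_assoc, ← hv]
  refine ⟨c, w, F, hw, hF, ?_, ?_, hA'⟩
  · rintro rfl
    exact hvne hFv.symm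
  · rw [hA', coeffPoly_nabla, if_pos rfl, if_neg (by norm_num), add_zero] at hnil
    exact hnil

theorem exists_torus_conj
    (hx : ∀ i : b.support, x i ∈ rootSpace H (-(i.1.1 : H → ℂ)) ∧ x i ≠ 0) (c : b.support → ℂˣ)
    {F : lieAlg G} (hF : F ∈ rootSpace H (θ.1 : H → ℂ)) :
    ∃ (h : H) (a : ℂˣ), (expGL h.1.1).1 * (∑ i, (c i : ℂ) • x i).1 * (expGL h.1.1)⁻¹.1 =
      (∑ i, x i).1 ∧ (expGL h.1.1).1 * F.1 * (expGL h.1.1)⁻¹.1 = (a : ℂ) • F.1 := by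
  -- exp h scales the root space of -αᵢ by cᵢ⁻¹, which undoes the coefficient.
  obtain ⟨h, hh⟩ := exists_simple_apply_eq (b := b) fun i => Complex.log (c i)
  refine ⟨h, Units.mk0 (Complex.exp ((θ.1 : H → ℂ) h)) (Complex.exp_ne_zero _), ?_,
    exp_torus_conj (lie_eq_smul_of_mem_rootSpace hF h)⟩
  rw [coe_sum_lieAlg, coe_sum_lieAlg, Finset.mul_sum, Finset.sum_mul]
  refine Finset.sum_congr rfl fun i _ => ?_
  have h1 := lie_eq_smul_of_mem_rootSpace (Submodule.smul_mem _ (c i : ℂ) (hx i).1) h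
  rw [exp_torus_conj h1, Pi.neg_apply, hh, Complex.exp_neg, Complex.exp_log (c i).ne_zero]
  change (c i : ℂ)⁻¹ • (c i : ℂ) • (x i).1 = _
  rw [smul_smul, inv_mul_cancel₀ (c i).ne_zero, one_smul]

/-- Two constant gauge transformations: a unipotent one that reduces the residue to ∑ cᵢ xᵢ and
fixes the top root space, then a toral one that normalizes the cᵢ. The constant term stays in the
line spanned by E. -/
theorem operEquiv_nabla_of_satisfiesLocalConditions
    (hB : IsConnectedSubgroupWithLie G B (borelSubspace b))
    (hx : ∀ i : b.support, x i ∈ rootSpace H (-(i.1.1 : H → ℂ)) ∧ x i ≠ 0)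
    (hθ : IsMaximalRoot b θ) (hE : E ∈ rootSpace H (θ.1 : H → ℂ) ∧ E ≠ 0) {r : ℕ}
    {A : Matrix (Fin n) (Fin n) ℂ[T;T⁻¹]}
    (hA : SatisfiesLocalConditions G B r (fun i => (x i).1)
      ((rootSpace H (θ.1 : H → ℂ)).toSubmodule.map (lieAlg G).toSubmodule.subtype) A) :
    ∃ c : ℂˣ, OperEquiv B A (nabla (∑ i, x i).1 ((c : ℂ) • E.1)) := by
  obtain ⟨c, w, F, hw, hF, hF0, hnil, rfl⟩ := eq_nabla_of_satisfiesLocalConditions hB hA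
  have hx' : ∀ i : b.support, (c i : ℂ) • x i ∈ rootSpace H (-(i.1.1 : H → ℂ)) ∧ (c i : ℂ) • x i ≠ 0 :=
    fun i => ⟨Submodule.smul_mem _ _ (hx i).1, smul_ne_zero (c i).ne_zero (hx i).2⟩
  obtain ⟨g, hg, e₁, e₂⟩ := exists_conj_principal hB hx' hθ hw hnil
  have step1 := operEquiv_conj hB.isClosed hg (∑ i, (c i : ℂ) • x i + w).1 F.1
  rw [e₁, e₂ F hF] at step1
  obtain ⟨h, a, e₃, e₄⟩ := exists_torus_conj hx c hF
  have hhB : h.1.1 ∈ lieAlg B := by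
    rw [mem_lieAlg_of_mem hB]
    exact Submodule.mem_sup_left h.2
  have step2 := operEquiv_conj hB.isClosed (expGL_mem hB.isClosed hhB) (∑ i, (c i : ℂ) • x i).1 F.1
  rw [e₃, e₄] at step2
  have hθ0 : (θ.1 : LieModule.Weight ℂ H (lieAlg G)).IsNonZero := LieSubalgebra.isNonZero_coe_root θ
  obtain ⟨d, hd⟩ := Submodule.mem_span_singleton.1 (rootSpace_le_span hθ0 hE.1 hE.2 hF)
  have hd0 : d ≠ 0 := by
    rintro rfl
    exact hF0 (by rw [← hd, zero_smul])
  have hFE : (a : ℂ) • F.1 = ((a * Units.mk0 d hd0 : ℂˣ) : ℂ) • E.1 := by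
    rw [← hd, Units.val_mul, Units.val_mk0, mul_smul]
    rfl
  rw [hFE] at step2
  exact ⟨_, step1.trans hB.isClosed step2⟩

end Opers

end OperConn

namespace OperConn

/-! ### Pole orders in the given trivialization. -/

section Poles

open LaurentPolynomial

variable {n : ℕ}

theorem coeffSeries_two_terms (j k l : ℤ) (X Y : Matrix (Fin n) (Fin n) ℂ) :
    coeffSeries (((T j : ℂ[T;T⁻¹]) • const ℂ[T;T⁻¹] X +
      (T k : ℂ[T;T⁻¹]) • const ℂ[T;T⁻¹] Y).map toSeries) l =
      (if l = j then X else 0) + if l = k then Y else 0 := by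
  rw [Matrix.map_add _ (map_add _), map_toSeries_smul_const, map_toSeries_smul_const, coeffSeries_add,
    coeffSeries_single_smul_const, coeffSeries_single_smul_const]

theorem hasPole_two_terms {m : ℕ} {k : ℤ} (hk : -(m : ℤ) < k) {X Y : Matrix (Fin n) (Fin n) ℂ}
    (hX : X ≠ 0) : HasPole (((T (-(m : ℤ)) : ℂ[T;T⁻¹]) • const ℂ[T;T⁻¹] X +
      (T k : ℂ[T;T⁻¹]) • const ℂ[T;T⁻¹] Y).map toSeries) m X := by
  refine ⟨fun l hl => ?_, ?_, hX⟩
  · rw [coeffSeries_two_terms, if_neg hl.ne, if_neg (by omega), add_zero]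
  · rw [coeffSeries_two_terms, if_pos rfl, if_neg hk.ne, add_zero]

theorem nabla_eq_two_terms (N E : Matrix (Fin n) (Fin n) ℂ) :
    nabla N E = (T (-((1 : ℕ) : ℤ)) : ℂ[T;T⁻¹]) • const ℂ[T;T⁻¹] N +
      (T 0 : ℂ[T;T⁻¹]) • const ℂ[T;T⁻¹] E := by
  rw [T_zero, one_smul, nabla, Nat.cast_one]

theorem pullback_neg_one_nabla (N E : Matrix (Fin n) (Fin n) ℂ) :
    pullback 1 (-1) (nabla N E) = (T (-((2 : ℕ) : ℤ)) : ℂ[T;T⁻¹]) • const ℂ[T;T⁻¹] (-E) +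
      (T (-1) : ℂ[T;T⁻¹]) • const ℂ[T;T⁻¹] (-N) := by
  rw [pullback_nabla, add_comm]
  norm_num

theorem gauge_one (A : Matrix (Fin n) (Fin n) (LaurentSeries ℂ)) : gauge derivSeries 1 A = A := by
  have h : ((1 : GL (Fin n) (LaurentSeries ℂ)).1).map derivSeries = 0 := by
    ext1 i j
    rw [Matrix.map_apply, Units.val_one, Matrix.one_apply]
    split_ifs
    · ext k
      rw [derivSeries, LaurentSeries.derivative_apply, LaurentSeries.hasseDeriv_coeff]
      by_cases hk : k + 1 = 0
      · have hk' : (k : ℂ) + 1 = 0 := by exact_mod_cast hk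
        simp [hk']
      · simp [hk]
    · exact map_zero (LaurentSeries.derivative ℂ)
  rw [gauge, h, inv_one, Units.val_one, one_mul, mul_one, zero_mul, sub_zero]

theorem one_mem_points (G : Subgroup (GL (Fin n) ℂ)) (R : Type) [CommRing R] [Algebra ℂ R] :
    (1 : GL (Fin n) R) ∈ points G R := by
  intro f hf
  have h1 := mem_idealOf.1 hf 1 G.one_mem
  have h2 : coords (1 : GL (Fin n) R) = fun p => algebraMap ℂ R (coords (1 : GL (Fin n) ℂ) p) := by
    funext p
    simp only [coords, Units.val_one, Matrix.one_apply]
    split_ifs <;> simp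
  have h3 := (MvPolynomial.comp_aeval_apply (coords (1 : GL (Fin n) ℂ)) (Algebra.ofId ℂ R) f).symm
  rw [h2]
  refine Eq.trans h3 ?_
  rw [h1, map_zero]

theorem isRegularSingular_nabla (G : Subgroup (GL (Fin n) ℂ)) (N E : Matrix (Fin n) (Fin n) ℂ) :
    IsRegularSingular G ((nabla N E).map toSeries) := by
  refine ⟨1, one_mem_points G _, fun k hk => ?_⟩
  rw [gauge_one, nabla_eq_two_terms, coeffSeries_two_terms, if_neg, if_neg, add_zero] <;>
    push_cast <;> omega

end Poles

/-! ### The singularity at infinity. -/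

section Infinity

open LieAlgebra LieAlgebra.IsKilling Module LaurentPolynomial

variable {n : ℕ} {G : Subgroup (GL (Fin n) ℂ)} [IsSimpleAlgebraicGroup G]
  {H : LieSubalgebra ℂ (lieAlg G)} [H.IsCartanSubalgebra]
  {b : (rootSystem H).Base} {T' : Subgroup (GL (Fin n) ℂ)}
  {x : b.support → lieAlg G} {θ : H.root} {E : lieAlg G}

theorem sum_ne_zero (hx : ∀ i : b.support, x i ∈ rootSpace H (-(i.1.1 : H → ℂ)) ∧ x i ≠ 0) :
    ∑ i, x i ≠ 0 := by
  intro h0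
  have h1 := eq_zero_of_lie_principal_eq_zero hx le_rfl (cartan_le_deg b (rhoCheck b).2)
    (by rw [h0, zero_lie])
  exact rhoCheck_ne_zero b (Subtype.ext h1)

theorem coxeterNumber_eq_height
    (hx : ∀ i : b.support, x i ∈ rootSpace H (-(i.1.1 : H → ℂ)) ∧ x i ≠ 0)
    (hθ : IsMaximalRoot b θ) (hE : E ∈ rootSpace H (θ.1 : H → ℂ) ∧ E ≠ 0) :
    (coxeterNumber H : ℤ) = b.height θ + 1 :=
  coxeterNumber_eq hx hθ hE (finrank_cartan_le_ker_ad b)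

theorem coxeterNumber_pos
    (hx : ∀ i : b.support, x i ∈ rootSpace H (-(i.1.1 : H → ℂ)) ∧ x i ≠ 0)
    (hθ : IsMaximalRoot b θ) (hE : E ∈ rootSpace H (θ.1 : H → ℂ) ∧ E ≠ 0) : 0 < coxeterNumber H := by
  have h1 := coxeterNumber_eq_height hx hθ hE
  have h2 := hθ.height_pos
  omega

/-- Otherwise the adjoint operator of N + E would be nilpotent and semisimple, hence zero.
Commutation with ρ would then make N a multiple of E, in a different degree, and N would vanish. -/
theorem not_isNilpotent_cyclic
    (hx : ∀ i : b.support, x i ∈ rootSpace H (-(i.1.1 : H → ℂ)) ∧ x i ≠ 0)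
    (hθ : IsMaximalRoot b θ) (hE : E ∈ rootSpace H (θ.1 : H → ℂ) ∧ E ≠ 0) :
    ¬ IsNilpotent (∑ i, x i + E).1 := by
  intro h
  have h1 : IsNilpotent (ad ℂ (lieAlg G) (∑ i, x i + E)) :=
    LieSubalgebra.isNilpotent_ad_of_isNilpotent_ad (lieAlg G)
      (LieAlgebra.ad_nilpotent_of_nilpotent (R := ℂ) h)
  have h2 := Module.End.eq_zero_of_isNilpotent_isSemisimple h1 (cyclic_isSemisimple hx hθ hE)
  have h3 : ⁅∑ i, x i + E, ((rhoCheck b).1 : lieAlg G)⁆ = 0 := LinearMap.congr_fun h2 _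
  have hN := sum_mem_deg hx
  have h4 := mem_deg.1 hN
  have h5 := mem_deg.1 (rootSpace_le_deg b θ hE.1)
  rw [← lie_skew, lie_add, h4, h5, neg_eq_zero] at h3
  have h6 : ∑ i, x i = (b.height θ : ℂ) • E := by
    push_cast at h3
    rw [neg_one_smul, neg_add_eq_zero] at h3
    exact h3
  have h7 : ∑ i, x i ∈ filt b 0 := by
    rw [h6]
    exact Submodule.smul_mem _ _ (deg_le_filt b hθ.height_pos.le (rootSpace_le_deg b θ hE.1))
  exact sum_ne_zero hx
    ((Submodule.disjoint_def.1 (deg_disjoint_filt b (by norm_num : (-1 : ℤ) < 0))) _ hN h7)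

theorem gauge_rho
    (hx : ∀ i : b.support, x i ∈ rootSpace H (-(i.1.1 : H → ℂ)) ∧ x i ≠ 0)
    (hθ : IsMaximalRoot b θ) (hE : E ∈ rootSpace H (θ.1 : H → ℂ) ∧ E ≠ 0)
    {g : GL (Fin n) ℂ[T;T⁻¹]} (hg : IsCocharacter T' g ((rhoCheck b).1.1)) :
    gauge derivPoly g (pullback 1 (-(coxeterNumber H : ℤ)) (nabla (∑ i, x i).1 E.1)) =
      -((T (-2) : ℂ[T;T⁻¹]) • const ℂ[T;T⁻¹] ((coxeterNumber H : ℂ) • (∑ i, x i + E).1)) -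
        (T (-1) : ℂ[T;T⁻¹]) • const ℂ[T;T⁻¹] ((rhoCheck b).1.1) := by
  have hh := coxeterNumber_eq_height hx hθ hE
  have h1 := rho_mul_sub (sum_mem_deg hx)
  have h2 := rho_mul_sub (rootSpace_le_deg b θ hE.1)
  have h3 := hg.gauge_pullback (a := 1) (m := coxeterNumber H) h1
    (by rw [hh, add_sub_cancel_right]; exact h2)
  rw [h3, Int.cast_natCast]
  rfl

theorem gauge_two_rho
    (hx : ∀ i : b.support, x i ∈ rootSpace H (-(i.1.1 : H → ℂ)) ∧ x i ≠ 0)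
    (hθ : IsMaximalRoot b θ) (hE : E ∈ rootSpace H (θ.1 : H → ℂ) ∧ E ≠ 0)
    {g : GL (Fin n) ℂ[T;T⁻¹]} (hg : IsCocharacter T' g ((2 : ℂ) • (rhoCheck b).1.1)) :
    gauge derivPoly g (pullback 1 (-(2 * coxeterNumber H : ℤ)) (nabla (∑ i, x i).1 E.1)) =
      -((T (-3) : ℂ[T;T⁻¹]) • const ℂ[T;T⁻¹] ((2 * coxeterNumber H : ℂ) • (∑ i, x i + E).1)) -
        (T (-1) : ℂ[T;T⁻¹]) • const ℂ[T;T⁻¹] ((2 : ℂ) • (rhoCheck b).1.1) := by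
  have hh := coxeterNumber_eq_height hx hθ hE
  have h1 := rho_mul_sub (sum_mem_deg hx)
  have h2 := rho_mul_sub (rootSpace_le_deg b θ hE.1)
  have h3 := hg.gauge_pullback (N := (∑ i, x i).1) (E := E.1) (a := 2) (m := 2 * coxeterNumber H)
    (by
      rw [smul_mul_assoc, mul_smul_comm, ← smul_sub, h1, smul_smul]
      norm_num)
    (by
      rw [smul_mul_assoc, mul_smul_comm, ← smul_sub, h2, smul_smul, hh]
      push_cast
      congr 1
      ring)
  rw [h3]
  push_cast
  rfl

/-- The reference trivialization at ∞, available for every G: ramification 2h and pole order 2 + 1,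
so slope 2/(2h). -/
theorem hasPole_gauge_two_rho
    (hx : ∀ i : b.support, x i ∈ rootSpace H (-(i.1.1 : H → ℂ)) ∧ x i ≠ 0)
    (hθ : IsMaximalRoot b θ) (hE : E ∈ rootSpace H (θ.1 : H → ℂ) ∧ E ≠ 0)
    {g : GL (Fin n) ℂ[T;T⁻¹]} (hg : IsCocharacter T' g ((2 : ℂ) • (rhoCheck b).1.1)) :
    ∃ L, HasPole (gauge derivSeries (Matrix.GeneralLinearGroup.map toSeries g)
      ((pullback 1 (-((2 * coxeterNumber H : ℕ) : ℤ)) (nabla (∑ i, x i).1 E.1)).map toSeries))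
        (2 + 1) L ∧ ¬ IsNilpotent L := by
  set c : ℂ := -(2 * coxeterNumber H : ℂ) with hc
  have hc0 : c ≠ 0 := by
    have := coxeterNumber_pos hx hθ hE
    rw [hc, neg_ne_zero]
    exact_mod_cast (by omega : 2 * coxeterNumber H ≠ 0)
  have hnil : ¬ IsNilpotent (c • (∑ i, x i + E).1) := by
    rintro ⟨d, hd⟩
    rw [smul_pow] at hd
    exact not_isNilpotent_cyclic hx hθ hE ⟨d, (smul_eq_zero.1 hd).resolve_left (pow_ne_zero _ hc0)⟩
  have hneg : ∀ X : Matrix (Fin n) (Fin n) ℂ, const ℂ[T;T⁻¹] (-X) = -const ℂ[T;T⁻¹] X := by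
    intro X
    ext1 i j
    exact map_neg (algebraMap ℂ ℂ[T;T⁻¹]) _
  have h1 := gauge_two_rho hx hθ hE hg
  have h2 : gauge derivPoly g
      (pullback 1 (-((2 * coxeterNumber H : ℕ) : ℤ)) (nabla (∑ i, x i).1 E.1)) =
      (T (-((2 + 1 : ℕ) : ℤ)) : ℂ[T;T⁻¹]) • const ℂ[T;T⁻¹] (c • (∑ i, x i + E).1) +
        (T (-1) : ℂ[T;T⁻¹]) • const ℂ[T;T⁻¹] (-((2 : ℂ) • (rhoCheck b).1.1)) := by
    rw [Nat.cast_mul, Nat.cast_ofNat, h1, hneg, hc, neg_smul, hneg, smul_neg, smul_neg, sub_eq_add_neg]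
    norm_num
  rw [gauge_map_toSeries, h2]
  exact ⟨_, hasPole_two_terms (by norm_num) (fun h0 => hnil (h0 ▸ IsNilpotent.zero)), hnil⟩

theorem not_isRegularSingular_infinity (hT : IsConnectedSubgroupWithLie G T' H.toSubmodule)
    (hx : ∀ i : b.support, x i ∈ rootSpace H (-(i.1.1 : H → ℂ)) ∧ x i ≠ 0)
    (hθ : IsMaximalRoot b θ) (hE : E ∈ rootSpace H (θ.1 : H → ℂ) ∧ E ≠ 0) :
    ¬ IsRegularSingular G ((pullback 1 (-1) (nabla (∑ i, x i).1 E.1)).map toSeries) := by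
  rintro ⟨g, -, hg⟩
  obtain ⟨g₀, hg₀⟩ := exists_isCocharacter_two_rho hT hx
  obtain ⟨L, ⟨hL, rfl, -⟩, hLn⟩ := hasPole_gauge_two_rho hx hθ hE hg₀
  have hpos := coxeterNumber_pos hx hθ hE
  -- A regular singularity is a pole of order at most 0 + 1 without ramification, of smaller slope
  -- than the reference one.
  refine hLn (isNilpotent_leading (a₁ := 2) (a₂ := 0) (m₁ := 2 * coxeterNumber H) (m₂ := 1)
    (by omega) one_pos (by omega) hL (g₂ := g) ?_)
  intro k hk
  exact hg k (by simpa using hk)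

theorem hasSlopeAtInfinity_iff (hT : IsConnectedSubgroupWithLie G T' H.toSubmodule)
    (hx : ∀ i : b.support, x i ∈ rootSpace H (-(i.1.1 : H → ℂ)) ∧ x i ≠ 0)
    (hθ : IsMaximalRoot b θ) (hE : E ∈ rootSpace H (θ.1 : H → ℂ) ∧ E ≠ 0) (q : ℚ) :
    HasSlopeAtInfinity G (nabla (∑ i, x i).1 E.1) q ↔ q = 1 / (coxeterNumber H : ℚ) := by
  obtain ⟨g₀, hg₀⟩ := exists_isCocharacter_two_rho hT hx
  obtain ⟨L₀, hL₀, hL₀n⟩ := hasPole_gauge_two_rho hx hθ hE hg₀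
  have hpos := coxeterNumber_pos hx hθ hE
  have hq : (coxeterNumber H : ℚ) ≠ 0 := by exact_mod_cast hpos.ne'
  constructor
  · rintro ⟨a, c, ha, hc, rfl, g, -, L, ⟨hL, rfl, -⟩, hLn⟩
    obtain ⟨h₀, rfl, -⟩ := hL₀
    -- Comparison with the reference trivialization in both directions: neither slope can be the
    -- larger, as both leading coefficients are non-nilpotent.
    have h1 : ¬ 2 * c < a * (2 * coxeterNumber H) := fun h =>
      hLn (isNilpotent_leading hc (by omega) h hL h₀)
    have h2 : ¬ a * (2 * coxeterNumber H) < 2 * c := fun h =>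
      hL₀n (isNilpotent_leading (by omega) hc h h₀ hL)
    have h3 : a * coxeterNumber H = c := by
      have : a * (2 * coxeterNumber H) = 2 * (a * coxeterNumber H) := by ring
      omega
    rw [← h3]
    push_cast
    have ha' : (a : ℚ) ≠ 0 := by exact_mod_cast ha.ne'
    field_simp
  · rintro rfl
    refine ⟨2, 2 * coxeterNumber H, by norm_num, by omega, ?_, _,
      map_toSeries_mem_points hT.le hg₀.mem, L₀, hL₀, hL₀n⟩
    push_cast
    field_simp

end Infinity

end OperConn

/-! ### Assembly of the theorem. -/

theorem mainTheorem6 {n : ℕ} (G : Subgroup (GL (Fin n) ℂ)) [OperConn.IsSimpleAlgebraicGroup G]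
    -- a Cartan subalgebra, a system of simple roots, and the corresponding torus and Borel subgroup
    (H : LieSubalgebra ℂ (OperConn.lieAlg G)) [H.IsCartanSubalgebra]
    (b : (LieAlgebra.IsKilling.rootSystem H).Base)
    (T B : Subgroup (GL (Fin n) ℂ))
    (hT : OperConn.IsConnectedSubgroupWithLie G T H.toSubmodule)
    (hB : OperConn.IsConnectedSubgroupWithLie G B (OperConn.borelSubspace b))
    -- basis vectors of the negative simple root spaces and of the maximal root space
    (x : b.support → OperConn.lieAlg G)
    (hx : ∀ i : b.support, x i ∈ LieAlgebra.rootSpace H (-(i.1.1 : H → ℂ)) ∧ x i ≠ 0)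
    (θ : H.root) (hθ : OperConn.IsMaximalRoot b θ)
    (E : OperConn.lieAlg G) (hE : E ∈ LieAlgebra.rootSpace H (θ.1 : H → ℂ) ∧ E ≠ 0)
    (N : OperConn.lieAlg G) (hN : N = ∑ i, x i) :
    -- at `0`: a simple pole, a regular singularity, principal unipotent monodromy
    (OperConn.HasPole ((OperConn.nabla N.1 E.1).map OperConn.toSeries) 1 N.1 ∧
      OperConn.IsRegularSingular G ((OperConn.nabla N.1 E.1).map OperConn.toSeries) ∧
      OperConn.HasPrincipalUnipotentMonodromy G (Module.finrank ℂ H)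
        (OperConn.nabla N.1 E.1)) ∧
    -- at `∞`: a double pole, an irregular singularity, of slope `1/h`
    (OperConn.HasPole ((OperConn.pullback 1 (-1) (OperConn.nabla N.1 E.1)).map OperConn.toSeries)
        2 (-E.1) ∧
      ¬ OperConn.IsRegularSingular G
        ((OperConn.pullback 1 (-1) (OperConn.nabla N.1 E.1)).map OperConn.toSeries) ∧
      0 < OperConn.coxeterNumber H ∧
      ∀ q : ℚ, OperConn.HasSlopeAtInfinity G (OperConn.nabla N.1 E.1) q ↔
        q = 1 / (OperConn.coxeterNumber H : ℚ)) ∧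
    -- the element `N + E` is regular semisimple
    OperConn.IsRegularSemisimple H (N + E) ∧
    -- adjoint type: `ρ` is a cocharacter
    (OperConn.IsAdjointType G →
      ∃ g, OperConn.IsCocharacter T g ((OperConn.rhoCheck b).1.1)) ∧
    -- if `ρ` is a cocharacter: the connection after `u ^ h = t⁻¹` and gauge by `ρ(u)`
    (∀ g, OperConn.IsCocharacter T g ((OperConn.rhoCheck b).1.1) →
      OperConn.gauge OperConn.derivPoly g
          (OperConn.pullback 1 (-(OperConn.coxeterNumber H : ℤ)) (OperConn.nabla N.1 E.1)) =
        -((LaurentPolynomial.T (-2) : LaurentPolynomial ℂ) •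
            OperConn.const (LaurentPolynomial ℂ) ((OperConn.coxeterNumber H : ℂ) • (N + E).1)) -
          (LaurentPolynomial.T (-1) : LaurentPolynomial ℂ) •
            OperConn.const (LaurentPolynomial ℂ) ((OperConn.rhoCheck b).1.1)) ∧
    -- in general: `2ρ` is a cocharacter, and the same with `u = w ^ 2`, so `w ^ (2h) = t⁻¹`
    (∃ g, OperConn.IsCocharacter T g ((2 : ℂ) • (OperConn.rhoCheck b).1.1) ∧
      OperConn.gauge OperConn.derivPoly g
          (OperConn.pullback 1 (-(2 * OperConn.coxeterNumber H : ℤ)) (OperConn.nabla N.1 E.1)) =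
        -((LaurentPolynomial.T (-3) : LaurentPolynomial ℂ) •
            OperConn.const (LaurentPolynomial ℂ)
              ((2 * OperConn.coxeterNumber H : ℂ) • (N + E).1)) -
          (LaurentPolynomial.T (-1) : LaurentPolynomial ℂ) •
            OperConn.const (LaurentPolynomial ℂ) ((2 : ℂ) • (OperConn.rhoCheck b).1.1)) ∧
    -- the connection is an oper, and its orbit under rescaling of `t` consists of exactly the
    -- opers that satisfy the local conditions
    OperConn.IsOper B (fun i => (x i).1) (OperConn.nabla N.1 E.1) ∧
    (∀ A : Matrix (Fin n) (Fin n) (LaurentPolynomial ℂ),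
      OperConn.IsOper B (fun i => (x i).1) A →
        ((∃ A', OperConn.OperEquiv B A A' ∧
            OperConn.SatisfiesLocalConditions G B (Module.finrank ℂ H) (fun i => (x i).1)
              ((LieAlgebra.rootSpace H (θ.1 : H → ℂ)).toSubmodule.map
                (OperConn.lieAlg G).toSubmodule.subtype) A') ↔
          ∃ c : ℂˣ, OperConn.OperEquiv B A
            (OperConn.pullback c 1 (OperConn.nabla N.1 E.1)))) := by
  subst hN
  have hE0 : E.1 ≠ 0 := fun h => hE.2 (Subtype.ext h)
  refine ⟨⟨?_, OperConn.isRegularSingular_nabla G _ _, OperConn.hasPrincipalUnipotentMonodromy_sum hx E⟩,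
    ⟨?_, OperConn.not_isRegularSingular_infinity hT hx hθ hE, OperConn.coxeterNumber_pos hx hθ hE,
      OperConn.hasSlopeAtInfinity_iff hT hx hθ hE⟩,
    OperConn.cyclic_isRegularSemisimple hx hθ hE (OperConn.finrank_cartan_le_ker_ad b),
    OperConn.exists_isCocharacter_rho hT hx, fun g hg => OperConn.gauge_rho hx hθ hE hg, ?_,
    OperConn.isOper_nabla hB hθ hE.1, fun A _ => ⟨?_, ?_⟩⟩
  · rw [OperConn.nabla_eq_two_terms]
    exact OperConn.hasPole_two_terms (by norm_num) fun h => OperConn.sum_ne_zero hx (Subtype.ext h)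
  · rw [OperConn.pullback_neg_one_nabla]
    exact OperConn.hasPole_two_terms (by norm_num) (neg_ne_zero.2 hE0)
  · obtain ⟨g, hg⟩ := OperConn.exists_isCocharacter_two_rho hT hx
    exact ⟨g, hg, OperConn.gauge_two_rho hx hθ hE hg⟩
  · rintro ⟨A', hAA', hA'⟩
    obtain ⟨c, hc⟩ := OperConn.operEquiv_nabla_of_satisfiesLocalConditions hB hx hθ hE hA'
    refine ⟨c, ?_⟩
    rw [OperConn.pullback_one_nabla]
    exact hAA'.trans hB.isClosed hc
  · rintro ⟨c, hc⟩
    rw [OperConn.pullback_one_nabla] at hc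
    -- Rescaling t fixes N dt/t and replaces E by cE, another nonzero vector of the highest root
    -- space.
    exact ⟨_, hc, OperConn.satisfiesLocalConditions_nabla (E := (c : ℂ) • E) hB hx hθ
      (Submodule.smul_mem _ _ hE.1) (smul_ne_zero c.ne_zero hE.2)⟩
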